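/- **Conventions.** Let $\mathbb D=\{|z|<1\}$ and $\partial\mathbb D=\{|z|=1\}$. For $t>0$ and a doubly indexed family $X_{n,N}$, write $\lim_{n/N\to t}X_{n,N}=X$ if $X_{n_i,N_i}\to X$ for all sequences $n_i,N_i\in\mathbb N$ with $n_i\to\infty$, $N_i\to\infty$, $n_i/N_i\to t$ (and likewise with $kp/N\to t$, for sequences $k_i,N_i$). Given $\{\alpha_{n,N}\}_{n,N\ge0}\subset\mathbb D$, let $\Phi_{0,N}=1$ and $\Phi_{n+1,N}(z)=z\Phi_{n,N}(z)-\overline{\alpha_{n,N}}\,\Phi^*_{n,N}(z)$, where $\Phi^*_{n,N}(z)=z^n\overline{\Phi_{n,N}(1/\bar z)}$; for $\beta\in\partial\mathbb D$ and $n\ge1$ let $\Phi^{(\beta)}_{n,N}(z)=z\Phi_{n-1,N}(z)-\bar\beta\,\Phi^*_{n-1,N}(z)$. Let $\Lambda_{\beta,t}$ be the set of $\zeta\in\partial\mathbb D$ such that $\liminf_{i\to\infty}\operatorname{dist}\big(\zeta,\{z\in\partial\mathbb D:\Phi^{(\beta)}_{n_i,N_i}(z)=0\}\big)=0$ for some sequences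 $n_i,N_i\to\infty$ with $n_i/N_i\to t$, and let $\Lambda_t=\bigcap_{\beta\in\partial\mathbb D}\Lambda_{\beta,t}$. For a sequence $(\gamma_n)_{n\ge0}$ in $\mathbb D$ let $\mathcal C$ be the CMV operator on $\ell^2(\mathbb N_0)$ with Verblunsky coefficients $\gamma_n$, that is, $\mathcal C=\mathcal L\mathcal M$ with $\mathcal L=\Theta(\gamma_0)\oplus\Theta(\gamma_2)\oplus\cdots$, $\mathcal M=1\oplus\Theta(\gamma_1)\oplus\Theta(\gamma_3)\oplus\cdots$ and $\Theta(\gamma)=\begin{pmatrix}\bar\gamma&\rho\\ \rho&-\gamma\end{pmatrix}$, $\rho=\sqrt{1-|\gamma|^2}$. Its Carathéodory function is $F(z)=\langle e_0,(\mathcal C+z)(\mathcal C-z)^{-1}e_0\rangle$ and its Schur function is $f(z)=\frac1z\frac{F(z)-1}{F(z)+1}$, for $|z|\ne1$ (with $f(0)$ taken as the limit, and $f(z)=\infty$ where $F(z)=-1$). **Statement.** Let $p\ge1$, $\beta\in\partial\mathbb D$, $t>0$, and let $(\alpha_j)_{j\ge0}$ be a $p$-periodic sequence in $\mathbb D$ that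 is not identically zero. Let $\{\alpha_{n,N}\}_{n,N\ge0}\subset\mathbb D$ satisfy $$\lim_{kp/N\to t}\alpha_{kp+j,N}=\alpha_j,\qquad j=0,\dots,p-1 .$$ For $j\ge0$ let $f_1^{(j)}$ be the Schur function of the CMV operator with Verblunsky coefficients $(\gamma_{n+j})_{n\ge0}$, where $(\gamma_n)$ is the $p$-periodic sequence with first $p$ terms $-\bar\alpha_{p-1},-\bar\alpha_{p-2},\dots,-\bar\alpha_0$, and let $$\mathcal Z=\bigcup_{j=0}^{p-1}\{z\in\mathbb D: f_1^{(j)}(z)=0\},\qquad \mathcal P=\bigcup_{j=0}^{p-1}\{z\in\mathbb C\setminus\overline{\mathbb D}: f_1^{(j)}(z)=\infty\}.$$ With $\rho_j=\sqrt{1-|\alpha_j|^2}$, let $$\Delta(z)=z^{-p/2}\operatorname{Tr}\big(A(\alpha_{p-1},z)\cdots A(\alpha_0,z)\big),\quad A(\alpha,z)=\frac1{\sqrt{1-|\alpha|^2}}\begin{pmatrix}z&-\bar\alpha\\-\alpha z&1\end{pmatrix},\quad G_\Delta(z)=\frac{z^{p/2}}2\Big(\prod_{j=0}^{p-1}\rho_j\Big)\Big(\Delta(z)+\sqrt{\Delta(z)^2-4}\Big)$$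 for $z\neq0$, where the square root is the one that maximizes $|\Delta(z)+\sqrt{\Delta(z)^2-4}|$ and the same branch of $z^{1/2}$ is used in $z^{p/2}$ and in $\Delta$ (the choice does not matter), and let $G_\Delta(0)=1$ (its limit at $0$). Then $$\lim_{n/N\to t}\frac{\Phi^{(\beta)}_{n+p,N}(z)}{\Phi^{(\beta)}_{n,N}(z)}=\lim_{n/N\to t}\frac{\Phi_{n+p,N}(z)}{\Phi_{n,N}(z)}=\lim_{n/N\to t}\frac{\Phi^*_{n+p,N}(z)}{\Phi^*_{n,N}(z)}=G_\Delta(z),$$ uniformly on compact subsets of $\mathbb C\setminus\Lambda_{\beta,t}$, $\mathbb C\setminus(\Lambda_t\cup\mathcal Z)$ and $\mathbb C\setminus(\Lambda_t\cup\mathcal P)$, respectively. (For given sequences $n_i,N_i$ and a given compact set, the denominators have no zeros on the compact set for all large $i$, so the quotients are eventually defined there.) -/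

import Mathlib

open Filter Topology Polynomial
open scoped ENNReal

noncomputable section

namespace VaryingOPUC

/-! ### Limits along `n / N → t` -/

/-- `IsRatioSeq t n N`: the sequences `n_i`, `N_i` tend to infinity and `n_i / N_i → t`. -/
structure IsRatioSeq (t : ℝ) (n N : ℕ → ℕ) : Prop where
  tendsto_left : Tendsto n atTop atTop
  tendsto_right : Tendsto N atTop atTop
  tendsto_ratio : Tendsto (fun i => (n i : ℝ) / (N i : ℝ)) atTop (𝓝 t)

/-- The doubly indexed complex coefficients `a n N` are asymptotically `p`-periodic at `t` with
limits `α 0, …, α (p - 1)`: for each `j < p`, `a (k p + j) N → α j` as `k p / N → t`. -/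
def AsymptoticallyPeriodic (a : ℕ → ℕ → ℂ) (t : ℝ) (p : ℕ) (α : ℕ → ℂ) : Prop :=
  ∀ j < p, ∀ k N : ℕ → ℕ, IsRatioSeq t (fun i => k i * p) N →
    Tendsto (fun i => a (k i * p + j) (N i)) atTop (𝓝 (α j))

/-! ### Orthogonal and paraorthogonal polynomials on the unit circle -/

/-- The reversed polynomial `z ^ n * conj (P (1 / conj z))` of a polynomial `P` of degree at
most `n`: the coefficients are conjugated, and their order is reversed. -/
def reversed (n : ℕ) (P : ℂ[X]) : ℂ[X] :=
  (P.map (starRingEnd ℂ)).reflect n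

/-- The monic orthogonal polynomials with Verblunsky coefficients `α`, through the Szegő
recurrence `Φ_{n+1} = z Φ_n - conj α_n * Φ_n^*`, `Φ_0 = 1`. -/
def opuc (α : ℕ → ℂ) : ℕ → ℂ[X]
  | 0 => 1
  | n + 1 => X * opuc α n - C (starRingEnd ℂ (α n)) * reversed n (opuc α n)

/-- The reversed polynomials `Φ_n^*`. -/
def opucStar (α : ℕ → ℂ) (n : ℕ) : ℂ[X] :=
  reversed n (opuc α n)

/-- The paraorthogonal polynomials `Φ_{n+1}^{(β)} = z Φ_n - conj β * Φ_n^*`. (They have positive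
index; the value at index `0` is a convention that no limit `n → ∞` sees.) -/
def popuc (α : ℕ → ℂ) (β : ℂ) : ℕ → ℂ[X]
  | 0 => 1
  | n + 1 => X * opuc α n - C (starRingEnd ℂ β) * opucStar α n

/-! ### Limit points of the zeros of paraorthogonal polynomials

Here `a n N` is the `n`-th Verblunsky coefficient of the `N`-th sequence, so the `N`-th sequence
is `fun m => a m N`. -/

/-- The zeros on the unit circle of the paraorthogonal polynomial with indices `n`, `N`. -/
def popucZeros (a : ℕ → ℕ → ℂ) (β : ℂ) (n N : ℕ) : Set ℂ :=
  {z | ‖z‖ = 1 ∧ (popuc (fun m => a m N) β n).eval z = 0}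

/-- The set `Λ_{β,t}` of weak limit points of zeros of the paraorthogonal polynomials. -/
def limitZeros (a : ℕ → ℕ → ℂ) (t : ℝ) (β : ℂ) : Set ℂ :=
  {z | ‖z‖ = 1 ∧ ∃ n N : ℕ → ℕ, IsRatioSeq t n N ∧
    liminf (fun i => Metric.infEDist z (popucZeros a β (n i) (N i))) atTop = 0}

/-- The set `Λ_t`, the intersection of all `Λ_{β,t}` with `β` on the unit circle. -/
def limitZerosInter (a : ℕ → ℕ → ℂ) (t : ℝ) : Set ℂ :=
  {z | ∀ β : ℂ, ‖β‖ = 1 → z ∈ limitZeros a t β}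

/-! ### CMV operators -/

/-- `ρ = √(1 - |α|²)`. -/
def rho (α : ℂ) : ℝ := √(1 - ‖α‖ ^ 2)

/-- The Hilbert space `ℓ²(ℕ)`. -/
abbrev EllTwo : Type := lp (fun _ : ℕ => ℂ) 2

theorem memℓp_two_iff (x : ℕ → ℂ) : Memℓp x 2 ↔ Summable fun i => ‖x i‖ ^ 2 := by
  rw [memℓp_gen_iff (by norm_num)]
  simp

theorem norm_sq_eq_tsum (x : EllTwo) : ‖x‖ ^ 2 = ∑' i, ‖x i‖ ^ 2 := by
  have h := lp.norm_rpow_eq_tsum (p := 2) (by norm_num) x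
  simpa using h

theorem summable_norm_sq (x : EllTwo) : Summable fun i => ‖x i‖ ^ 2 :=
  (memℓp_two_iff _).1 (lp.memℓp x)

theorem summable_norm_sq_comp (x : EllTwo) {σ : ℕ → ℕ} (hσ : Function.Involutive σ) :
    Summable fun i => ‖x (σ i)‖ ^ 2 :=
  (summable_norm_sq x).comp_injective hσ.injective

theorem norm_sq_mul_add_mul_le {a b u v : ℂ} (ha : ‖a‖ ≤ 1) (hb : ‖b‖ ≤ 1) :
    ‖a * u + b * v‖ ^ 2 ≤ 2 * ‖u‖ ^ 2 + 2 * ‖v‖ ^ 2 := by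
  have h : ‖a * u + b * v‖ ≤ ‖u‖ + ‖v‖ := by
    refine (norm_add_le _ _).trans ?_
    rw [norm_mul, norm_mul]
    exact add_le_add (mul_le_of_le_one_left (norm_nonneg _) ha)
      (mul_le_of_le_one_left (norm_nonneg _) hb)
  nlinarith [norm_nonneg (a * u + b * v), sq_nonneg (‖u‖ - ‖v‖)]

/-- The bounded operator `(T x)_i = d_i x_i + o_i x_{σ i}` on `ℓ²(ℕ)`, for an involution `σ` of
the index set and coefficients of modulus at most one. -/
def pairOp (σ : ℕ → ℕ) (hσ : Function.Involutive σ) (d o : ℕ → ℂ)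
    (hd : ∀ i, ‖d i‖ ≤ 1) (ho : ∀ i, ‖o i‖ ≤ 1) : EllTwo →L[ℂ] EllTwo :=
  have hsum : ∀ x : EllTwo, Summable fun i => 2 * ‖x i‖ ^ 2 + 2 * ‖x (σ i)‖ ^ 2 := fun x =>
    ((summable_norm_sq x).mul_left 2).add ((summable_norm_sq_comp x hσ).mul_left 2)
  LinearMap.mkContinuous
    { toFun := fun x => (⟨fun i => d i * x i + o i * x (σ i), (memℓp_two_iff _).2
        (Summable.of_nonneg_of_le (fun i => by positivity)
          (fun i => norm_sq_mul_add_mul_le (hd i) (ho i)) (hsum x))⟩ : EllTwo)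
      map_add' := fun x y => by
        ext i
        simp only [lp.coeFn_add, Pi.add_apply]
        ring
      map_smul' := fun c x => by
        ext i
        simp only [lp.coeFn_smul, Pi.smul_apply, smul_eq_mul, RingHom.id_apply]
        ring }
    2 (fun x => by
      refine le_of_sq_le_sq ?_ (by positivity)
      rw [norm_sq_eq_tsum, mul_pow, norm_sq_eq_tsum x]
      have h1 : ∑' i, ‖x (σ i)‖ ^ 2 = ∑' i, ‖x i‖ ^ 2 :=
        (hσ.toPerm σ).tsum_eq (fun i => ‖x i‖ ^ 2)
      have h2 : ∑' i, (2 * ‖x i‖ ^ 2 + 2 * ‖x (σ i)‖ ^ 2) = 2 ^ 2 * ∑' i, ‖x i‖ ^ 2 := by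
        rw [Summable.tsum_add ((summable_norm_sq x).mul_left 2)
          ((summable_norm_sq_comp x hσ).mul_left 2),
          tsum_mul_left, tsum_mul_left, h1]
        ring
      rw [← h2]
      exact Summable.tsum_le_tsum (fun i => norm_sq_mul_add_mul_le (hd i) (ho i))
        (Summable.of_nonneg_of_le (fun i => by positivity)
          (fun i => norm_sq_mul_add_mul_le (hd i) (ho i)) (hsum x)) (hsum x))

theorem pairOp_apply (σ : ℕ → ℕ) (hσ : Function.Involutive σ) (d o : ℕ → ℂ)
    (hd : ∀ i, ‖d i‖ ≤ 1) (ho : ∀ i, ‖o i‖ ≤ 1) (x : EllTwo) (i : ℕ) :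
    pairOp σ hσ d o hd ho x i = d i * x i + o i * x (σ i) := rfl

/-- The involution with orbits `{0, 1}, {2, 3}, …`. -/
def evenPartner (i : ℕ) : ℕ := if Even i then i + 1 else i - 1

/-- The involution with orbits `{0}, {1, 2}, {3, 4}, …`. -/
def oddPartner (i : ℕ) : ℕ := if Odd i then i + 1 else i - 1

theorem evenPartner_involutive : Function.Involutive evenPartner := by
  intro i
  unfold evenPartner
  grind

theorem oddPartner_involutive : Function.Involutive oddPartner := by
  intro i
  unfold oddPartner
  grind

theorem norm_rho_le (α : ℂ) : ‖(rho α : ℂ)‖ ≤ 1 := by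
  rw [Complex.norm_real, rho, Real.norm_of_nonneg (Real.sqrt_nonneg _)]
  exact Real.sqrt_le_one.2 (by nlinarith [sq_nonneg ‖α‖])

/-- Diagonal entries of `Θ(α_0) ⊕ Θ(α_2) ⊕ …`, where `Θ(α)` is the symmetric unitary matrix with
rows `(conj α, ρ)` and `(ρ, -α)`. -/
def evenDiag (α : ℕ → ℂ) (i : ℕ) : ℂ :=
  if Even i then starRingEnd ℂ (α i) else -α (i - 1)

/-- Off-diagonal entries of `Θ(α_0) ⊕ Θ(α_2) ⊕ …`. -/
def evenOff (α : ℕ → ℂ) (i : ℕ) : ℂ :=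
  if Even i then (rho (α i) : ℂ) else (rho (α (i - 1)) : ℂ)

/-- Diagonal entries of `1 ⊕ Θ(α_1) ⊕ Θ(α_3) ⊕ …`. -/
def oddDiag (α : ℕ → ℂ) (i : ℕ) : ℂ :=
  if i = 0 then 1 else if Odd i then starRingEnd ℂ (α i) else -α (i - 1)

/-- Off-diagonal entries of `1 ⊕ Θ(α_1) ⊕ Θ(α_3) ⊕ …`. -/
def oddOff (α : ℕ → ℂ) (i : ℕ) : ℂ :=
  if i = 0 then 0 else if Odd i then (rho (α i) : ℂ) else (rho (α (i - 1)) : ℂ)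

theorem norm_evenDiag_le {α : ℕ → ℂ} (hα : ∀ n, ‖α n‖ < 1) (i : ℕ) : ‖evenDiag α i‖ ≤ 1 := by
  unfold evenDiag
  split_ifs
  · simpa using (hα i).le
  · simpa using (hα (i - 1)).le

theorem norm_evenOff_le (α : ℕ → ℂ) (i : ℕ) : ‖evenOff α i‖ ≤ 1 := by
  unfold evenOff
  split_ifs <;> exact norm_rho_le _

theorem norm_oddDiag_le {α : ℕ → ℂ} (hα : ∀ n, ‖α n‖ < 1) (i : ℕ) : ‖oddDiag α i‖ ≤ 1 := by
  unfold oddDiag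
  split_ifs
  · simp
  · simpa using (hα i).le
  · simpa using (hα (i - 1)).le

theorem norm_oddOff_le (α : ℕ → ℂ) (i : ℕ) : ‖oddOff α i‖ ≤ 1 := by
  unfold oddOff
  split_ifs
  · simp
  · exact norm_rho_le _
  · exact norm_rho_le _

/-- The CMV operator with Verblunsky coefficients `α`, as the product of
`Θ(α_0) ⊕ Θ(α_2) ⊕ …` and `1 ⊕ Θ(α_1) ⊕ Θ(α_3) ⊕ …`. Multiplied out, this is the five-diagonal
matrix with rows, for `k ≥ 0` and with `α_{-1} = -1`, `ρ_{-1} = 0`,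
`(conj α_{2k} ρ_{2k-1}, -conj α_{2k} α_{2k-1}, conj α_{2k+1} ρ_{2k}, ρ_{2k+1} ρ_{2k})` and
`(ρ_{2k} ρ_{2k-1}, -ρ_{2k} α_{2k-1}, -conj α_{2k+1} α_{2k}, -ρ_{2k+1} α_{2k})`
in the columns `2k-1, 2k, 2k+1, 2k+2`. -/
def cmv (α : ℕ → ℂ) (hα : ∀ n, ‖α n‖ < 1) : EllTwo →L[ℂ] EllTwo :=
  pairOp evenPartner evenPartner_involutive (evenDiag α) (evenOff α)
      (norm_evenDiag_le hα) (norm_evenOff_le α) *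
    pairOp oddPartner oddPartner_involutive (oddDiag α) (oddOff α)
      (norm_oddDiag_le hα) (norm_oddOff_le α)

/-! ### Carathéodory and Schur functions -/

/-- The first vector of the standard basis of `ℓ²(ℕ)`. -/
def e₀ : EllTwo := lp.single 2 0 1

/-- The Carathéodory function `F(z) = ⟨e₀, (𝒞 + z) (𝒞 - z)⁻¹ e₀⟩` of the CMV operator `𝒞` with
Verblunsky coefficients `α`, for `z` outside the spectrum of `𝒞`. -/
def caratheodory (α : ℕ → ℂ) (hα : ∀ n, ‖α n‖ < 1) (z : ℂ) : ℂ :=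
  inner ℂ e₀ (((cmv α hα + z • (1 : EllTwo →L[ℂ] EllTwo)) *
    Ring.inverse (cmv α hα - z • (1 : EllTwo →L[ℂ] EllTwo))) e₀)

/-- The Schur function `f(z) = z⁻¹ (F(z) - 1) / (F(z) + 1)`, with the value `∞` where
`F(z) = -1`, and at `z = 0` through the limit. -/
def schur (α : ℕ → ℂ) (hα : ∀ n, ‖α n‖ < 1) (z : ℂ) : OnePoint ℂ :=
  if z = 0 then
    ((limUnder (𝓝[≠] (0 : ℂ)) fun w =>
      1 / w * ((caratheodory α hα w - 1) / (caratheodory α hα w + 1)) : ℂ) : OnePoint ℂ)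
  else if caratheodory α hα z = -1 then OnePoint.infty
  else ((1 / z * ((caratheodory α hα z - 1) / (caratheodory α hα z + 1)) : ℂ) : OnePoint ℂ)

/-- The zeros of a Schur function in the open unit disk. -/
def schurZeros (f : ℂ → OnePoint ℂ) : Set ℂ :=
  {z | ‖z‖ < 1 ∧ f z = ((0 : ℂ) : OnePoint ℂ)}

/-- The poles of a Schur function outside the closed unit disk. -/
def schurPoles (f : ℂ → OnePoint ℂ) : Set ℂ :=
  {z | 1 < ‖z‖ ∧ f z = OnePoint.infty}

/-! ### The reversed periodic sequence and its discriminant -/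

/-- The `p`-periodic sequence with first `p` terms `-conj α_{p-1}, -conj α_{p-2}, …, -conj α_0`. -/
def reversedCoeff (p : ℕ) (α : ℕ → ℂ) (n : ℕ) : ℂ :=
  -starRingEnd ℂ (α (p - 1 - n % p))

theorem norm_reversedCoeff_lt (p : ℕ) {α : ℕ → ℂ} (hα : ∀ n, ‖α n‖ < 1) (n : ℕ) :
    ‖reversedCoeff p α n‖ < 1 := by
  simpa [reversedCoeff] using hα (p - 1 - n % p)

/-- The Schur function `f_1^{(j)}` of the `j` times stripped CMV operator of the reversed periodic
sequence: its Verblunsky coefficients are those of that sequence from index `j` on. -/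
def strippedSchur (p : ℕ) (α : ℕ → ℂ) (hα : ∀ n, ‖α n‖ < 1) (j : ℕ) : ℂ → OnePoint ℂ :=
  schur (fun n => reversedCoeff p α (n + j)) (fun n => norm_reversedCoeff_lt p hα (n + j))

/-- The set `𝒵`. -/
def zeroSet (p : ℕ) (α : ℕ → ℂ) (hα : ∀ n, ‖α n‖ < 1) : Set ℂ :=
  ⋃ j ∈ Finset.range p, schurZeros (strippedSchur p α hα j)

/-- The set `𝒫`. -/
def poleSet (p : ℕ) (α : ℕ → ℂ) (hα : ∀ n, ‖α n‖ < 1) : Set ℂ :=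
  ⋃ j ∈ Finset.range p, schurPoles (strippedSchur p α hα j)

/-- The one-step transfer matrix `A(α, z)`. -/
def stepMatrix (α z : ℂ) : Matrix (Fin 2) (Fin 2) ℂ :=
  (1 / (rho α : ℂ)) • !![z, -starRingEnd ℂ α; -α * z, 1]

/-- The product `A(α_{n-1}, z) ⋯ A(α_0, z)`. -/
def transferMatrix (α : ℕ → ℂ) (z : ℂ) : ℕ → Matrix (Fin 2) (Fin 2) ℂ
  | 0 => 1
  | n + 1 => stepMatrix (α n) z * transferMatrix α z n

/-- The discriminant `Δ(z) = z ^ (-p/2) Tr (A(α_{p-1}, z) ⋯ A(α_0, z))`, for `z ≠ 0`, with the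
principal branch of the power. -/
def discriminant (p : ℕ) (α : ℕ → ℂ) (z : ℂ) : ℂ :=
  z ^ (-(p : ℂ) / 2) * (transferMatrix α z p).trace

/-- The square root of `d ^ 2 - 4` for which `|d + √(d ^ 2 - 4)|` is the larger one. (The two
moduli agree only for `d` in `[-2, 2]`.) -/
def dominantSqrt (d : ℂ) : ℂ :=
  if ‖d - (d ^ 2 - 4) ^ (1 / 2 : ℂ)‖ ≤ ‖d + (d ^ 2 - 4) ^ (1 / 2 : ℂ)‖
  then (d ^ 2 - 4) ^ (1 / 2 : ℂ) else -(d ^ 2 - 4) ^ (1 / 2 : ℂ)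

/-- The function `G_Δ(z) = (z ^ (p/2) / 2) (∏_{j<p} ρ_j) (Δ(z) + √(Δ(z) ^ 2 - 4))`, with its
limit `1` at the removable singularity `z = 0`. The same branch of `z ^ (1/2)` is used in
`z ^ (p/2)` and in `Δ(z)`; the value does not depend on it. -/
def gDelta (p : ℕ) (α : ℕ → ℂ) (z : ℂ) : ℂ :=
  if z = 0 then 1
  else z ^ ((p : ℂ) / 2) / 2 * (∏ j ∈ Finset.range p, (rho (α j) : ℂ)) *
    (discriminant p α z + dominantSqrt (discriminant p α z))

/-- The quotients `P n N / Q n N` converge to `G` as `n / N → t`, uniformly on compact subsets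
of `S`. On each such subset the quotients are eventually defined, that is, the denominators
have no zeros there. -/
def QuotientsConverge (t : ℝ) (P Q : ℕ → ℕ → ℂ[X]) (G : ℂ → ℂ) (S : Set ℂ) : Prop :=
  ∀ K : Set ℂ, K ⊆ S → IsCompact K → ∀ n N : ℕ → ℕ, IsRatioSeq t n N →
    (∀ᶠ i in atTop, ∀ z ∈ K, (Q (n i) (N i)).eval z ≠ 0) ∧
    TendstoUniformlyOn (fun i z => (P (n i) (N i)).eval z / (Q (n i) (N i)).eval z) G atTop K

end VaryingOPUC

end

/-! Write `f_n = Φ_n / Φ_n^*`. In the closed disk `f_n` obeys the Schur algorithm, whose step is a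
strict contraction inside the disk, so `f_{n,N}` forgets its initial value and approaches the
`p`-periodic solution `φ_n` of the limiting recurrence; the values of `φ` are the Schur functions
`f_1^{(j)}`. Since `Φ_{n+1}^* = (1 - α_n z f_n) Φ_n^*`, the quotients of `Φ^*` converge to
`∏_j (1 - α_j z φ_j)`, which is `∏_j ρ_j` times the dominant eigenvalue of the transfer matrix over
a period, that is `G_Δ`. The quotients of `Φ` and `Φ^{(β)}` follow through `f_n`, and `z ↦ 1 / z̄`
gives the exterior. Near a point of the unit circle at which the zeros of `Φ^{(β)}` do not
accumulate, `Φ`, `Φ^*` and `Φ^{(β)}` are mutually comparable, so Vitali's theorem carries the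
convergence over from the disk, and continuation across the circle identifies the limit. -/

noncomputable section

namespace VaryingOPUC

open scoped ComplexConjugate

/-! ### Recurrences for the orthogonal polynomials -/

theorem natDegree_opuc_le (α : ℕ → ℂ) (n : ℕ) : (opuc α n).natDegree ≤ n := by
  induction n with
  | zero => simp [opuc]
  | succ n ih =>
    rw [opuc]
    refine (natDegree_sub_le _ _).trans (max_le ?_ ?_)
    · exact (natDegree_mul_le).trans (by have := natDegree_X_le (R := ℂ); omega)
    · refine (natDegree_C_mul_le _ _).trans ?_
      rw [reversed]
      refine natDegree_le_iff_coeff_eq_zero.2 fun m hm => ?_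
      rw [coeff_reflect, revAt_eq_self_of_lt (by omega), coeff_map,
        coeff_eq_zero_of_natDegree_lt (by omega), map_zero]

theorem reversed_X_mul (n : ℕ) {P : ℂ[X]} (hP : P.natDegree ≤ n) :
    reversed (n + 1) (X * P) = reversed n P := by
  have hX : reflect 1 (X : ℂ[X]) = 1 := by simp
  rw [reversed, reversed, Polynomial.map_mul, map_X, add_comm n 1,
    reflect_mul _ _ natDegree_X_le (natDegree_map_le.trans hP), hX, one_mul]

theorem reversed_reversed (n : ℕ) {P : ℂ[X]} (hP : P.natDegree ≤ n) :
    reversed (n + 1) (reversed n P) = X * P := by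
  ext m
  rw [reversed, reversed, coeff_reflect, coeff_map, coeff_reflect, coeff_map]
  rcases m with _ | m
  · rw [revAt_le (Nat.zero_le _), Nat.sub_zero, revAt_eq_self_of_lt (Nat.lt_succ_self n),
      coeff_eq_zero_of_natDegree_lt (by omega)]
    simp
  · rw [coeff_X_mul]
    by_cases h : m ≤ n
    · rw [revAt_le (show m + 1 ≤ n + 1 by omega), Nat.add_sub_add_right,
        revAt_le (Nat.sub_le n m), Complex.conj_conj, Nat.sub_sub_self h]
    · rw [revAt_eq_self_of_lt (show n + 1 < m + 1 by omega),
        revAt_eq_self_of_lt (show n < m + 1 by omega),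
        coeff_eq_zero_of_natDegree_lt (by omega), coeff_eq_zero_of_natDegree_lt (by omega)]
      simp

theorem opucStar_succ (α : ℕ → ℂ) (n : ℕ) :
    opucStar α (n + 1) = opucStar α n - C (α n) * (X * opuc α n) := by
  have h : reversed (n + 1) (C (conj (α n)) * reversed n (opuc α n)) =
      C (α n) * (X * opuc α n) := by
    rw [← reversed_reversed n (natDegree_opuc_le α n), reversed, Polynomial.map_mul, map_C,
      reflect_C_mul, Complex.conj_conj]
    rfl
  rw [opucStar, opuc, ← h, opucStar, ← reversed_X_mul n (natDegree_opuc_le α n)]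
  simp only [reversed, Polynomial.map_sub, reflect_sub]

theorem eval_opuc_zero (α : ℕ → ℂ) (z : ℂ) : (opuc α 0).eval z = 1 := by simp [opuc]

theorem eval_opucStar_zero (α : ℕ → ℂ) (z : ℂ) : (opucStar α 0).eval z = 1 := by
  simp [opucStar, opuc, reversed]

theorem eval_opuc_succ (α : ℕ → ℂ) (n : ℕ) (z : ℂ) :
    (opuc α (n + 1)).eval z =
      z * (opuc α n).eval z - conj (α n) * (opucStar α n).eval z := by
  simp [opuc, opucStar]

theorem eval_opucStar_succ (α : ℕ → ℂ) (n : ℕ) (z : ℂ) :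
    (opucStar α (n + 1)).eval z =
      (opucStar α n).eval z - α n * z * (opuc α n).eval z := by
  simp [opucStar_succ, mul_assoc]

theorem eval_popuc_succ (α : ℕ → ℂ) (β : ℂ) (n : ℕ) (z : ℂ) :
    (popuc α β (n + 1)).eval z =
      z * (opuc α n).eval z - conj β * (opucStar α n).eval z := by
  simp [popuc]

theorem eval_opuc_inv_and_eval_opucStar_inv (α : ℕ → ℂ) {z : ℂ} (hz : z ≠ 0) (n : ℕ) :
    (opuc α n).eval z = z ^ n * (opucStar (fun j => conj (α j)) n).eval z⁻¹ ∧
    (opucStar α n).eval z = z ^ n * (opuc (fun j => conj (α j)) n).eval z⁻¹ := by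
  induction n with
  | zero => simp [eval_opuc_zero, eval_opucStar_zero]
  | succ n ih =>
    simp only [eval_opuc_succ, eval_opucStar_succ, ih.1, ih.2, Complex.conj_conj]
    constructor <;> (field_simp; ring)

theorem eval_opuc_inv (α : ℕ → ℂ) {z : ℂ} (hz : z ≠ 0) (n : ℕ) :
    (opuc α n).eval z = z ^ n * (opucStar (fun j => conj (α j)) n).eval z⁻¹ :=
  (eval_opuc_inv_and_eval_opucStar_inv α hz n).1

theorem eval_opucStar_inv (α : ℕ → ℂ) {z : ℂ} (hz : z ≠ 0) (n : ℕ) :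
    (opucStar α n).eval z = z ^ n * (opuc (fun j => conj (α j)) n).eval z⁻¹ :=
  (eval_opuc_inv_and_eval_opucStar_inv α hz n).2

theorem eval_popuc_succ_inv (α : ℕ → ℂ) {β z : ℂ} (hβ : ‖β‖ = 1) (hz : z ≠ 0) (n : ℕ) :
    (popuc α β (n + 1)).eval z = -conj β * z ^ (n + 1) *
      (popuc (fun j => conj (α j)) (conj β) (n + 1)).eval z⁻¹ := by
  have hββ : conj β * β = 1 := by simp [Complex.conj_mul', hβ]
  rw [eval_popuc_succ, eval_popuc_succ, eval_opuc_inv α hz, eval_opucStar_inv α hz,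
    Complex.conj_conj]
  generalize (opucStar (fun j => conj (α j)) n).eval z⁻¹ = x
  generalize (opuc (fun j => conj (α j)) n).eval z⁻¹ = y
  linear_combination -(z ^ (n + 1) * x) * hββ + conj β * z ^ n * y * mul_inv_cancel₀ hz

/-! ### The Schur algorithm, run backwards -/

/-- The step `w ↦ (z w - conj α) / (1 - α z w)`, which sends `Φ_n / Φ_n^*` to
`Φ_{n+1} / Φ_{n+1}^*`. -/
def schurStep (α z w : ℂ) : ℂ := (z * w - conj α) / (1 - α * z * w)

/-- The iterated step, with coefficients `α 0, α 1, …` in this order. -/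
def schurIterate (α : ℕ → ℂ) (z w : ℂ) : ℕ → ℂ
  | 0 => w
  | n + 1 => schurStep (α n) z (schurIterate α z w n)

theorem one_sub_norm_le {a z w : ℂ} (ha : ‖a‖ ≤ 1) (hw : ‖w‖ ≤ 1) :
    1 - ‖z‖ ≤ ‖1 - a * z * w‖ := by
  have h : ‖a * z * w‖ ≤ ‖z‖ := by
    rw [norm_mul, norm_mul]
    calc ‖a‖ * ‖z‖ * ‖w‖ ≤ 1 * ‖z‖ * 1 := by gcongr
      _ = ‖z‖ := by ring
  have := norm_sub_norm_le (1 : ℂ) (a * z * w)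
  rw [norm_one] at this
  linarith

theorem schurStep_denom_ne_zero {a z w : ℂ} (ha : ‖a‖ < 1) (hz : ‖z‖ ≤ 1) (hw : ‖w‖ ≤ 1) :
    1 - a * z * w ≠ 0 := by
  rw [mul_comm a z]
  exact norm_pos_iff.1 ((sub_pos.2 ha).trans_le (one_sub_norm_le hz hw))

theorem one_sub_norm_sq_pos {w : ℂ} (hw : ‖w‖ < 1) : 0 < 1 - ‖w‖ ^ 2 := by
  nlinarith [norm_nonneg w]

theorem one_sub_norm_sq_nonneg {w : ℂ} (hw : ‖w‖ ≤ 1) : 0 ≤ 1 - ‖w‖ ^ 2 := by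
  nlinarith [norm_nonneg w]

theorem norm_mul_le_one {z w : ℂ} (hz : ‖z‖ ≤ 1) (hw : ‖w‖ ≤ 1) : ‖z * w‖ ≤ 1 := by
  rw [norm_mul]
  exact mul_le_one₀ hz (norm_nonneg _) hw

theorem norm_mul_lt_one {z w : ℂ} (hz : ‖z‖ < 1) (hw : ‖w‖ ≤ 1) : ‖z * w‖ < 1 := by
  rw [norm_mul]
  exact (mul_le_of_le_one_right (norm_nonneg _) hw).trans_lt hz

theorem one_sub_norm_sq_schurStep {a z w : ℂ} (h : 1 - a * z * w ≠ 0) :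
    1 - ‖schurStep a z w‖ ^ 2 =
      (1 - ‖a‖ ^ 2) * (1 - ‖z * w‖ ^ 2) / ‖1 - a * z * w‖ ^ 2 := by
  have hne : ‖1 - a * z * w‖ ^ 2 ≠ 0 := pow_ne_zero _ (norm_ne_zero_iff.2 h)
  have hnum : ‖1 - a * z * w‖ ^ 2 - ‖z * w - conj a‖ ^ 2 =
      (1 - ‖a‖ ^ 2) * (1 - ‖z * w‖ ^ 2) := by
    simp only [← Complex.normSq_eq_norm_sq, Complex.normSq_apply, Complex.sub_re, Complex.sub_im,
      Complex.mul_re, Complex.mul_im, Complex.conj_re, Complex.conj_im, Complex.one_re,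
      Complex.one_im]
    ring
  rw [schurStep, norm_div, div_pow, eq_div_iff hne, sub_mul, div_mul_cancel₀ _ hne, one_mul, hnum]

theorem norm_schurStep_le {a z w : ℂ} (ha : ‖a‖ < 1) (hz : ‖z‖ ≤ 1) (hw : ‖w‖ ≤ 1) :
    ‖schurStep a z w‖ ≤ 1 := by
  have h : 0 ≤ 1 - ‖schurStep a z w‖ ^ 2 := by
    rw [one_sub_norm_sq_schurStep (schurStep_denom_ne_zero ha hz hw)]
    have := one_sub_norm_sq_pos ha
    have := one_sub_norm_sq_nonneg (norm_mul_le_one hz hw)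
    positivity
  exact (sq_le_one_iff₀ (norm_nonneg _)).1 (sub_nonneg.1 h)

theorem norm_schurStep_lt {a z w : ℂ} (ha : ‖a‖ < 1) (hz : ‖z‖ < 1) (hw : ‖w‖ ≤ 1) :
    ‖schurStep a z w‖ < 1 := by
  have hne := schurStep_denom_ne_zero ha hz.le hw
  have h : 0 < 1 - ‖schurStep a z w‖ ^ 2 := by
    rw [one_sub_norm_sq_schurStep hne]
    have := one_sub_norm_sq_pos ha
    have := one_sub_norm_sq_pos (norm_mul_lt_one hz hw)
    positivity
  exact (sq_lt_one_iff₀ (norm_nonneg _)).1 (sub_pos.1 h)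

theorem norm_schurIterate_le {α : ℕ → ℂ} (hα : ∀ n, ‖α n‖ < 1) {z w : ℂ} (hz : ‖z‖ ≤ 1)
    (hw : ‖w‖ ≤ 1) (n : ℕ) : ‖schurIterate α z w n‖ ≤ 1 := by
  induction n with
  | zero => exact hw
  | succ n ih => exact norm_schurStep_le (hα n) hz ih

theorem schurIterate_add (α : ℕ → ℂ) (z w : ℂ) (n m : ℕ) :
    schurIterate α z w (n + m) =
      schurIterate (fun j => α (n + j)) z (schurIterate α z w n) m := by
  induction m with
  | zero => rfl
  | succ m ih => rw [← add_assoc, schurIterate, ih, schurIterate]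

theorem conj_schurStep (a z w : ℂ) :
    conj (schurStep a z w) = schurStep (conj a) (conj z) (conj w) := by
  simp [schurStep]

theorem conj_schurIterate (α : ℕ → ℂ) (z w : ℂ) (n : ℕ) :
    conj (schurIterate α z w n) =
      schurIterate (fun j => conj (α j)) (conj z) (conj w) n := by
  induction n with
  | zero => rfl
  | succ n ih => rw [schurIterate, conj_schurStep, ih, schurIterate]

section ClosedDisk

variable {α : ℕ → ℂ} {z : ℂ}

theorem eval_opuc_eq_schurIterate_mul (hα : ∀ n, ‖α n‖ < 1) (hz : ‖z‖ ≤ 1) (n : ℕ) :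
    (opuc α n).eval z = schurIterate α z 1 n * (opucStar α n).eval z := by
  induction n with
  | zero => simp [eval_opuc_zero, eval_opucStar_zero, schurIterate]
  | succ n ih =>
    have hne := schurStep_denom_ne_zero (hα n) hz (norm_schurIterate_le hα hz norm_one.le n)
    rw [eval_opuc_succ, eval_opucStar_succ, ih, schurIterate, schurStep, div_mul_eq_mul_div,
      eq_div_iff hne]
    ring

theorem eval_opucStar_succ_eq_mul (hα : ∀ n, ‖α n‖ < 1) (hz : ‖z‖ ≤ 1) (n : ℕ) :
    (opucStar α (n + 1)).eval z =
      (1 - α n * z * schurIterate α z 1 n) * (opucStar α n).eval z := by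
  rw [eval_opucStar_succ, eval_opuc_eq_schurIterate_mul hα hz]
  ring

theorem eval_opucStar_ne_zero (hα : ∀ n, ‖α n‖ < 1) (hz : ‖z‖ ≤ 1) (n : ℕ) :
    (opucStar α n).eval z ≠ 0 := by
  induction n with
  | zero => simp [eval_opucStar_zero]
  | succ n ih =>
    rw [eval_opucStar_succ_eq_mul hα hz]
    exact mul_ne_zero
      (schurStep_denom_ne_zero (hα n) hz (norm_schurIterate_le hα hz norm_one.le n)) ih

theorem schurIterate_one_eq_div (hα : ∀ n, ‖α n‖ < 1) (hz : ‖z‖ ≤ 1) (n : ℕ) :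
    schurIterate α z 1 n = (opuc α n).eval z / (opucStar α n).eval z := by
  rw [eval_opuc_eq_schurIterate_mul hα hz, mul_div_cancel_right₀ _ (eval_opucStar_ne_zero hα hz n)]

theorem norm_eval_opuc_le (hα : ∀ n, ‖α n‖ < 1) (hz : ‖z‖ ≤ 1) (n : ℕ) :
    ‖(opuc α n).eval z‖ ≤ ‖(opucStar α n).eval z‖ := by
  rw [eval_opuc_eq_schurIterate_mul hα hz, norm_mul]
  exact mul_le_of_le_one_left (norm_nonneg _) (norm_schurIterate_le hα hz norm_one.le n)

end ClosedDisk

/-! ### Contraction of the Schur algorithm inside the disk -/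

theorem schurStep_sub_schurStep {a z w w' : ℂ} (h : 1 - a * z * w ≠ 0) (h' : 1 - a * z * w' ≠ 0) :
    schurStep a z w - schurStep a z w' =
      ((1 - ‖a‖ ^ 2 : ℝ) : ℂ) * (z * (w - w')) / ((1 - a * z * w) * (1 - a * z * w')) := by
  have haa : ((‖a‖ ^ 2 : ℝ) : ℂ) = conj a * a := by
    push_cast
    exact (Complex.conj_mul' a).symm
  rw [Complex.ofReal_sub, haa, schurStep, schurStep, div_sub_div _ _ h h', Complex.ofReal_one]
  ring

theorem norm_sq_schurStep_sub_le {a z w w' : ℂ} {c : ℝ} (hc : 0 ≤ c) (ha : ‖a‖ < 1) (hz : ‖z‖ < 1)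
    (hw : ‖w‖ ≤ 1) (hw' : ‖w'‖ ≤ 1)
    (h : ‖w - w'‖ ^ 2 ≤ c * ((1 - ‖z * w‖ ^ 2) * (1 - ‖z * w'‖ ^ 2))) :
    ‖schurStep a z w - schurStep a z w'‖ ^ 2 ≤ ‖z‖ ^ 2 * c *
      ((1 - ‖z * schurStep a z w‖ ^ 2) * (1 - ‖z * schurStep a z w'‖ ^ 2)) := by
  have hd := schurStep_denom_ne_zero ha hz.le hw
  have hd' := schurStep_denom_ne_zero ha hz.le hw'
  have hweight (v : ℂ) : ‖z * v‖ ≤ ‖v‖ := by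
    rw [norm_mul]
    exact mul_le_of_le_one_left (norm_nonneg _) hz.le
  calc ‖schurStep a z w - schurStep a z w'‖ ^ 2
      = ‖z‖ ^ 2 * (1 - ‖a‖ ^ 2) ^ 2 / (‖1 - a * z * w‖ ^ 2 * ‖1 - a * z * w'‖ ^ 2) *
          ‖w - w'‖ ^ 2 := by
        rw [schurStep_sub_schurStep hd hd', norm_div, norm_mul, norm_mul, norm_mul,
          Complex.norm_of_nonneg (one_sub_norm_sq_pos ha).le]
        ring
    _ ≤ ‖z‖ ^ 2 * (1 - ‖a‖ ^ 2) ^ 2 / (‖1 - a * z * w‖ ^ 2 * ‖1 - a * z * w'‖ ^ 2) *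
          (c * ((1 - ‖z * w‖ ^ 2) * (1 - ‖z * w'‖ ^ 2))) := by gcongr
    _ = ‖z‖ ^ 2 * c * ((1 - ‖schurStep a z w‖ ^ 2) * (1 - ‖schurStep a z w'‖ ^ 2)) := by
        rw [one_sub_norm_sq_schurStep hd, one_sub_norm_sq_schurStep hd']
        ring
    _ ≤ _ := by
        have hs := norm_schurStep_le ha hz.le hw
        have hs' := norm_schurStep_le ha hz.le hw'
        gcongr
        · exact one_sub_norm_sq_nonneg hs'
        · exact one_sub_norm_sq_nonneg ((hweight _).trans hs)
        · exact hweight _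
        · exact hweight _

theorem norm_schurIterate_sub_le {α : ℕ → ℂ} (hα : ∀ n, ‖α n‖ < 1) {z w w' : ℂ} (hz : ‖z‖ < 1)
    (hw : ‖w‖ ≤ 1) (hw' : ‖w'‖ ≤ 1) (n : ℕ) :
    ‖schurIterate α z w n - schurIterate α z w' n‖ ≤ 2 / (1 - ‖z‖ ^ 2) * ‖z‖ ^ n := by
  have hz2 := one_sub_norm_sq_pos hz
  have hweight {v : ℂ} (hv : ‖v‖ ≤ 1) : ‖z * v‖ ≤ ‖z‖ := by
    rw [norm_mul]
    exact mul_le_of_le_one_right (norm_nonneg _) hv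
  have hpseudo : ‖schurIterate α z w n - schurIterate α z w' n‖ ^ 2 ≤
      (2 / (1 - ‖z‖ ^ 2) * ‖z‖ ^ n) ^ 2 *
        ((1 - ‖z * schurIterate α z w n‖ ^ 2) * (1 - ‖z * schurIterate α z w' n‖ ^ 2)) := by
    induction n with
    | zero =>
      have h2 : ‖w - w'‖ ≤ 2 := (norm_sub_le _ _).trans (by linarith)
      calc ‖w - w'‖ ^ 2 ≤ 2 ^ 2 := by gcongr
        _ = (2 / (1 - ‖z‖ ^ 2) * ‖z‖ ^ 0) ^ 2 * ((1 - ‖z‖ ^ 2) * (1 - ‖z‖ ^ 2)) := by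
          field_simp
        _ ≤ (2 / (1 - ‖z‖ ^ 2) * ‖z‖ ^ 0) ^ 2 *
            ((1 - ‖z * w‖ ^ 2) * (1 - ‖z * w'‖ ^ 2)) := by
          gcongr
          · exact one_sub_norm_sq_nonneg ((hweight hw).trans hz.le)
          · exact hweight hw
          · exact hweight hw'
    | succ n ih =>
      refine (norm_sq_schurStep_sub_le (sq_nonneg _) (hα n) hz (norm_schurIterate_le hα hz.le hw n)
        (norm_schurIterate_le hα hz.le hw' n) ih).trans_eq ?_
      rw [schurIterate, schurIterate]
      ring
  refine le_of_sq_le_sq (hpseudo.trans (mul_le_of_le_one_right (sq_nonneg _) ?_)) (by positivity)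
  have hz1 {v : ℂ} (hv : ‖v‖ ≤ 1) := one_sub_norm_sq_nonneg (norm_mul_le_one hz.le hv)
  exact mul_le_one₀ (sub_le_self _ (sq_nonneg _)) (hz1 (norm_schurIterate_le hα hz.le hw' n))
    (sub_le_self _ (sq_nonneg _))

theorem norm_schurStep_sub_schurStep_le {a b z w w' : ℂ} (ha : ‖a‖ ≤ 1) (hb : ‖b‖ < 1)
    (hz : ‖z‖ < 1) (hw : ‖w‖ ≤ 1) (hw' : ‖w'‖ ≤ 1) :
    ‖schurStep a z w - schurStep b z w'‖ ≤ 2 * (‖a - b‖ + ‖w - w'‖) / (1 - ‖z‖) := by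
  have hz' : 0 < 1 - ‖z‖ := sub_pos.2 hz
  have hden : 1 - ‖z‖ ≤ ‖1 - a * z * w‖ := one_sub_norm_le ha hw
  have hne : 1 - a * z * w ≠ 0 := norm_pos_iff.1 (hz'.trans_le hden)
  have hnum : ‖z * (w - w') - conj (a - b)‖ ≤ ‖a - b‖ + ‖w - w'‖ := by
    refine (norm_sub_le _ _).trans ?_
    rw [RCLike.norm_conj, norm_mul, add_comm]
    gcongr
    exact mul_le_of_le_one_left (norm_nonneg _) hz.le
  have hden' : ‖(a - b) * (z * w) + b * z * (w - w')‖ ≤ ‖a - b‖ + ‖w - w'‖ := by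
    refine (norm_add_le _ _).trans ?_
    rw [norm_mul (a - b), norm_mul (b * z)]
    gcongr
    · exact mul_le_of_le_one_right (norm_nonneg _) (norm_mul_lt_one hz hw).le
    · exact mul_le_of_le_one_left (norm_nonneg _) (norm_mul_le_one hb.le hz.le)
  have hsub : schurStep a z w - schurStep b z w' = (z * (w - w') - conj (a - b) +
      schurStep b z w' * ((a - b) * (z * w) + b * z * (w - w'))) / (1 - a * z * w) := by
    have hs : schurStep b z w' * (1 - b * z * w') = z * w' - conj b :=
      div_mul_cancel₀ _ (schurStep_denom_ne_zero hb hz.le hw')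
    rw [eq_div_iff hne, sub_mul, schurStep, div_mul_cancel₀ _ hne, map_sub]
    linear_combination -hs
  rw [hsub, norm_div]
  gcongr
  calc _ ≤ ‖z * (w - w') - conj (a - b)‖ +
        ‖schurStep b z w'‖ * ‖(a - b) * (z * w) + b * z * (w - w')‖ := by
        rw [← norm_mul]
        exact norm_add_le _ _
    _ ≤ (‖a - b‖ + ‖w - w'‖) + 1 * (‖a - b‖ + ‖w - w'‖) := by
        gcongr
        exact norm_schurStep_le hb hz.le hw'
    _ = 2 * (‖a - b‖ + ‖w - w'‖) := by ring

/-! ### The Schur functions of a periodic sequence -/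

/-- The limit of the Schur algorithm along the indices `n + k p`, for `p`-periodic coefficients.
It does not depend on the start, here `1`, and equals `lim Φ_{n + kp} / Φ_{n + kp}^*`. -/
def periodicSchur (p : ℕ) (α : ℕ → ℂ) (z : ℂ) (n : ℕ) : ℂ :=
  limUnder atTop fun k => schurIterate α z 1 (n + k * p)

section Periodic

variable {p : ℕ} {α : ℕ → ℂ} {z : ℂ}

theorem tendsto_add_mul_atTop (hp : 0 < p) (n : ℕ) : Tendsto (fun k => n + k * p) atTop atTop :=
  tendsto_atTop_mono (fun _ => Nat.le_add_left _ n) (tendsto_id.atTop_mul_const' hp)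

theorem norm_schurIterate_periodic_sub_le (hα : ∀ n, ‖α n‖ < 1) (hper : Function.Periodic α p)
    (hz : ‖z‖ < 1) (n k l : ℕ) :
    ‖schurIterate α z 1 (n + (k + l) * p) - schurIterate α z 1 (n + l * p)‖ ≤
      2 / (1 - ‖z‖ ^ 2) * ‖z‖ ^ (n + l * p) := by
  have hshift : (fun j => α (k * p + j)) = α := by
    ext j
    rw [add_comm]
    exact hper.nat_mul k j
  rw [show n + (k + l) * p = k * p + (n + l * p) by ring, schurIterate_add, hshift]
  exact norm_schurIterate_sub_le hα hz (norm_schurIterate_le hα hz.le norm_one.le _) norm_one.le _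

theorem tendsto_periodicSchur (hp : 0 < p) (hα : ∀ n, ‖α n‖ < 1) (hper : Function.Periodic α p)
    (hz : ‖z‖ < 1) (n : ℕ) :
    Tendsto (fun k => schurIterate α z 1 (n + k * p)) atTop (𝓝 (periodicSchur p α z n)) := by
  have hgeom : Tendsto (fun l => 2 / (1 - ‖z‖ ^ 2) * ‖z‖ ^ (n + l * p)) atTop (𝓝 0) := by
    simpa using ((tendsto_pow_atTop_nhds_zero_of_lt_one (norm_nonneg z) hz).comp
      (tendsto_add_mul_atTop hp n)).const_mul (2 / (1 - ‖z‖ ^ 2))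
  refine (cauchySeq_of_le_tendsto_0' _ (fun l k hlk => ?_) hgeom).tendsto_limUnder
  rw [dist_comm, dist_eq_norm, ← Nat.sub_add_cancel hlk]
  exact norm_schurIterate_periodic_sub_le hα hper hz n _ l

theorem norm_periodicSchur_le (hp : 0 < p) (hα : ∀ n, ‖α n‖ < 1) (hper : Function.Periodic α p)
    (hz : ‖z‖ < 1) (n : ℕ) : ‖periodicSchur p α z n‖ ≤ 1 :=
  le_of_tendsto (tendsto_periodicSchur hp hα hper hz n).norm
    (Eventually.of_forall fun _ => norm_schurIterate_le hα hz.le norm_one.le _)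

theorem periodicSchur_succ (hp : 0 < p) (hα : ∀ n, ‖α n‖ < 1) (hper : Function.Periodic α p)
    (hz : ‖z‖ < 1) (n : ℕ) :
    periodicSchur p α z (n + 1) = schurStep (α n) z (periodicSchur p α z n) := by
  have h := tendsto_periodicSchur hp hα hper hz n
  have hne := schurStep_denom_ne_zero (hα n) hz.le (norm_periodicSchur_le hp hα hper hz n)
  have hstep : Tendsto (fun k => schurStep (α n) z (schurIterate α z 1 (n + k * p))) atTop
      (𝓝 (schurStep (α n) z (periodicSchur p α z n))) :=
    ((h.const_mul z).sub_const _).div ((h.const_mul (α n * z)).const_sub 1) hne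
  refine tendsto_nhds_unique (tendsto_periodicSchur hp hα hper hz (n + 1)) (hstep.congr fun k => ?_)
  have hα_eq : α (n + k * p) = α n := hper.nat_mul k n
  rw [add_right_comm, schurIterate, hα_eq]

theorem periodic_periodicSchur (hp : 0 < p) (hα : ∀ n, ‖α n‖ < 1) (hper : Function.Periodic α p)
    (hz : ‖z‖ < 1) : Function.Periodic (periodicSchur p α z) p := by
  intro n
  refine tendsto_nhds_unique (tendsto_periodicSchur hp hα hper hz (n + p)) ?_
  refine ((tendsto_periodicSchur hp hα hper hz n).comp (tendsto_add_atTop_nat 1)).congr fun k => ?_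
  rw [Function.comp, add_mul, one_mul, add_right_comm, add_assoc]

theorem norm_periodicSchur_lt (hp : 0 < p) (hα : ∀ n, ‖α n‖ < 1) (hper : Function.Periodic α p)
    (hz : ‖z‖ < 1) (n : ℕ) : ‖periodicSchur p α z n‖ < 1 := by
  obtain ⟨q, rfl⟩ := Nat.exists_eq_succ_of_ne_zero hp.ne'
  rw [← periodic_periodicSchur hp hα hper hz n, Nat.succ_eq_add_one, ← add_assoc,
    periodicSchur_succ hp hα hper hz]
  exact norm_schurStep_lt (hα _) hz (norm_periodicSchur_le hp hα hper hz _)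

theorem conj_periodicSchur (hp : 0 < p) (hα : ∀ n, ‖α n‖ < 1) (hper : Function.Periodic α p)
    (hz : ‖z‖ < 1) (n : ℕ) :
    conj (periodicSchur p α z n) = periodicSchur p (fun j => conj (α j)) (conj z) n := by
  have h := (Complex.continuous_conj.tendsto _).comp (tendsto_periodicSchur hp hα hper hz n)
  rw [← h.limUnder_eq, periodicSchur]
  congr 1
  ext k
  rw [Function.comp, conj_schurIterate, map_one]

theorem periodicSchur_add (hp : 0 < p) (hα : ∀ n, ‖α n‖ < 1) (hper : Function.Periodic α p)
    (hz : ‖z‖ < 1) (n m : ℕ) :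
    periodicSchur p α z (n + m) =
      schurIterate (fun j => α (n + j)) z (periodicSchur p α z n) m := by
  induction m with
  | zero => rfl
  | succ m ih => rw [← add_assoc, periodicSchur_succ hp hα hper hz, ih, schurIterate]

theorem norm_schurIterate_sub_periodicSchur_le (hp : 0 < p) (hα : ∀ n, ‖α n‖ < 1)
    (hper : Function.Periodic α p) (hz : ‖z‖ < 1) (n : ℕ) :
    ‖schurIterate α z 1 n - periodicSchur p α z n‖ ≤ 2 / (1 - ‖z‖ ^ 2) * ‖z‖ ^ n := by
  have h := periodicSchur_add hp hα hper hz 0 n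
  simp only [zero_add] at h
  rw [h]
  exact norm_schurIterate_sub_le hα hz norm_one.le (norm_periodicSchur_le hp hα hper hz 0) n

theorem continuousOn_schurIterate (hα : ∀ n, ‖α n‖ < 1) (n : ℕ) :
    ContinuousOn (fun z => schurIterate α z 1 n) (Metric.ball 0 1) := by
  have hball {w : ℂ} (hw : w ∈ Metric.ball (0 : ℂ) 1) : ‖w‖ ≤ 1 := (mem_ball_zero_iff.1 hw).le
  refine ContinuousOn.congr (f := fun z => (opuc α n).eval z / (opucStar α n).eval z) ?_
    fun w hw => schurIterate_one_eq_div hα (hball hw) n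
  exact (opuc α n).continuous.continuousOn.div (opucStar α n).continuous.continuousOn
    fun w hw => eval_opucStar_ne_zero hα (hball hw) n

theorem continuousOn_periodicSchur (hp : 0 < p) (hα : ∀ n, ‖α n‖ < 1)
    (hper : Function.Periodic α p) (n : ℕ) :
    ContinuousOn (fun z => periodicSchur p α z n) (Metric.ball 0 1) := by
  intro z₀ hz₀
  obtain ⟨r, hr₀, hr⟩ := exists_between (mem_ball_zero_iff.1 hz₀)
  have hr0 : 0 ≤ r := (norm_nonneg z₀).trans hr₀.le
  have hr2 : 0 < 1 - r ^ 2 := by nlinarith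
  have hlim : TendstoUniformlyOn (fun k z => schurIterate α z 1 (n + k * p))
      (fun z => periodicSchur p α z n) atTop (Metric.ball 0 r) := by
    have hgeom : Tendsto (fun k => 2 / (1 - r ^ 2) * r ^ (n + k * p)) atTop (𝓝 0) := by
      simpa using ((tendsto_pow_atTop_nhds_zero_of_lt_one hr0 hr).comp
        (tendsto_add_mul_atTop hp n)).const_mul (2 / (1 - r ^ 2))
    refine Metric.tendstoUniformlyOn_iff.2 fun ε hε => ?_
    filter_upwards [hgeom.eventually_lt_const hε] with k hk z hz
    have hzr : ‖z‖ < r := mem_ball_zero_iff.1 hz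
    have hz1 : ‖z‖ < 1 := hzr.trans hr
    have hle := norm_schurIterate_sub_periodicSchur_le hp hα hper hz1 (n + k * p)
    have hmod : periodicSchur p α z (n + k * p) = periodicSchur p α z n :=
      (periodic_periodicSchur hp hα hper hz1).nat_mul k n
    rw [hmod] at hle
    rw [dist_comm, dist_eq_norm]
    refine (hle.trans ?_).trans_lt hk
    gcongr
  have hcont := hlim.continuousOn (Eventually.of_forall fun k =>
    (continuousOn_schurIterate hα (n + k * p)).mono (Metric.ball_subset_ball hr.le)).frequently
  exact (hcont.continuousAt (Metric.isOpen_ball.mem_nhds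
    (mem_ball_zero_iff.2 hr₀))).continuousWithinAt

end Periodic

/-! ### CMV operators are unitary -/

theorem adjoint_pairOp (σ : ℕ → ℕ) (hσ : Function.Involutive σ) (d o : ℕ → ℂ)
    (hd : ∀ i, ‖d i‖ ≤ 1) (ho : ∀ i, ‖o i‖ ≤ 1) (hreal : ∀ i, conj (o i) = o i)
    (hoσ : ∀ i, o (σ i) = o i) :
    star (pairOp σ hσ d o hd ho) =
      pairOp σ hσ (fun i => conj (d i)) o (fun i => by simpa using hd i) ho := by
  symm
  rw [ContinuousLinearMap.star_eq_adjoint, ContinuousLinearMap.eq_adjoint_iff]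
  intro x y
  have hs : ∀ (c : ℕ → ℂ), (∀ i, ‖c i‖ ≤ 1) → ∀ (x y : ℕ → ℂ), (Summable fun i => ‖x i‖ ^ 2) →
      (Summable fun i => ‖y i‖ ^ 2) → Summable fun i => c i * (y i * conj (x i)) := by
    intro c hc x y hx hy
    refine Summable.of_norm_bounded (hx.add hy) fun i => ?_
    rw [norm_mul, norm_mul, RCLike.norm_conj]
    have h1 : ‖c i‖ * (‖y i‖ * ‖x i‖) ≤ ‖y i‖ * ‖x i‖ :=
      mul_le_of_le_one_left (by positivity) (hc i)
    nlinarith [sq_nonneg (‖x i‖ - ‖y i‖), sq_nonneg ‖x i‖, sq_nonneg ‖y i‖]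
  rw [lp.inner_eq_tsum, lp.inner_eq_tsum]
  simp only [pairOp_apply, RCLike.inner_apply, map_add, map_mul, Complex.conj_conj, hreal]
  have hx := summable_norm_sq x
  have hy := summable_norm_sq y
  have hxσ := summable_norm_sq_comp x hσ
  have hyσ := summable_norm_sq_comp y hσ
  have e1 : ∀ i, y i * (d i * conj (x i) + o i * conj (x (σ i))) =
      d i * (y i * conj (x i)) + o i * (y i * conj (x (σ i))) := fun i => by ring
  have e2 : ∀ i, (d i * y i + o i * y (σ i)) * conj (x i) =
      d i * (y i * conj (x i)) + o i * (y (σ i) * conj (x i)) := fun i => by ring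
  simp only [e1, e2]
  rw [(hs d hd _ _ hx hy).tsum_add (hs o ho _ _ hxσ hy),
    (hs d hd _ _ hx hy).tsum_add (hs o ho _ _ hx hyσ)]
  congr 1
  rw [← (hσ.toPerm σ).tsum_eq (fun i => o i * (y i * conj (x (σ i))))]
  refine tsum_congr fun i => ?_
  simp only [Function.Involutive.coe_toPerm]
  rw [hσ i, hoσ i]

theorem pairOp_mem_unitary (σ : ℕ → ℕ) (hσ : Function.Involutive σ) (d o : ℕ → ℂ)
    (hd : ∀ i, ‖d i‖ ≤ 1) (ho : ∀ i, ‖o i‖ ≤ 1) (hreal : ∀ i, conj (o i) = o i)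
    (hoσ : ∀ i, o (σ i) = o i) (hone : ∀ i, d i * conj (d i) + o i * o i = 1)
    (hzero : ∀ i, o i * (conj (d i) + d (σ i)) = 0) :
    pairOp σ hσ d o hd ho ∈ unitary (EllTwo →L[ℂ] EllTwo) := by
  rw [Unitary.mem_iff, adjoint_pairOp σ hσ d o hd ho hreal hoσ]
  have hzero' : ∀ i, o i * (d i + conj (d (σ i))) = 0 := fun i => by
    have := hzero (σ i)
    rw [hoσ, hσ] at this
    linear_combination this
  constructor
  · ext x i
    simp only [mul_apply_eq_comp, one_apply_eq_self, pairOp_apply, hσ i,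
      hoσ]
    linear_combination x i * hone i + x (σ i) * hzero i
  · ext x i
    simp only [mul_apply_eq_comp, one_apply_eq_self, pairOp_apply, hσ i,
      hoσ]
    linear_combination x i * hone i + x (σ i) * hzero' i

theorem rho_mul_rho {α : ℂ} (hα : ‖α‖ < 1) :
    (rho α : ℂ) * rho α = 1 - α * starRingEnd ℂ α := by
  rw [← Complex.ofReal_mul, rho, Real.mul_self_sqrt (one_sub_norm_sq_pos hα).le, Complex.mul_conj']
  push_cast
  rfl

theorem rho_pos {α : ℂ} (hα : ‖α‖ < 1) : 0 < rho α :=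
  Real.sqrt_pos.2 (one_sub_norm_sq_pos hα)

theorem rho_sq {α : ℂ} (hα : ‖α‖ < 1) : rho α ^ 2 = 1 - ‖α‖ ^ 2 :=
  Real.sq_sqrt (one_sub_norm_sq_pos hα).le

section CMV

variable {γ : ℕ → ℂ} (hγ : ∀ n, ‖γ n‖ < 1)

variable (γ) in
/-- The factor `ℒ = Θ(γ_0) ⊕ Θ(γ_2) ⊕ …` of the CMV operator. -/
def evenOp : EllTwo →L[ℂ] EllTwo :=
  pairOp evenPartner evenPartner_involutive (evenDiag γ) (evenOff γ)
    (norm_evenDiag_le hγ) (norm_evenOff_le γ)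

variable (γ) in
/-- The factor `ℳ = 1 ⊕ Θ(γ_1) ⊕ Θ(γ_3) ⊕ …` of the CMV operator. -/
def oddOp : EllTwo →L[ℂ] EllTwo :=
  pairOp oddPartner oddPartner_involutive (oddDiag γ) (oddOff γ)
    (norm_oddDiag_le hγ) (norm_oddOff_le γ)

theorem evenOp_apply_two_mul (x : EllTwo) (k : ℕ) :
    evenOp γ hγ x (2 * k) = conj (γ (2 * k)) * x (2 * k) + rho (γ (2 * k)) * x (2 * k + 1) := by
  simp [evenOp, pairOp_apply, evenDiag, evenOff, evenPartner]

theorem evenOp_apply_two_mul_add_one (x : EllTwo) (k : ℕ) :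
    evenOp γ hγ x (2 * k + 1) = rho (γ (2 * k)) * x (2 * k) - γ (2 * k) * x (2 * k + 1) := by
  simp [evenOp, pairOp_apply, evenDiag, evenOff, evenPartner]
  ring

theorem oddOp_apply_zero (x : EllTwo) : oddOp γ hγ x 0 = x 0 := by
  simp [oddOp, pairOp_apply, oddDiag, oddOff]

theorem oddOp_apply_two_mul_add_one (x : EllTwo) (k : ℕ) :
    oddOp γ hγ x (2 * k + 1) =
      conj (γ (2 * k + 1)) * x (2 * k + 1) + rho (γ (2 * k + 1)) * x (2 * k + 2) := by
  simp [oddOp, pairOp_apply, oddDiag, oddOff, oddPartner]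

theorem oddOp_apply_two_mul_add_two (x : EllTwo) (k : ℕ) :
    oddOp γ hγ x (2 * k + 2) =
      rho (γ (2 * k + 1)) * x (2 * k + 1) - γ (2 * k + 1) * x (2 * k + 2) := by
  have h : ¬ Odd (2 * k + 2) := by grind
  simp [oddOp, pairOp_apply, oddDiag, oddOff, oddPartner, h]
  ring

theorem evenOp_mem_unitary : evenOp γ hγ ∈ unitary (EllTwo →L[ℂ] EllTwo) := by
  have key {P : ℕ → Prop} (heven : ∀ k, P (2 * k)) (hodd : ∀ k, P (2 * k + 1)) (i : ℕ) : P i := by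
    obtain ⟨k, rfl | rfl⟩ := i.even_or_odd'
    exacts [heven k, hodd k]
  refine pairOp_mem_unitary _ _ _ _ _ _ (key ?_ ?_) (key ?_ ?_) (key ?_ ?_) (key ?_ ?_) <;>
    intro k <;>
    simp only [evenDiag, evenOff, evenPartner, even_two, Even.mul_right, Nat.not_even_bit1,
      if_true, if_false, Nat.add_sub_cancel, Complex.conj_ofReal, Complex.conj_conj, map_neg,
      rho_mul_rho (hγ _)] <;>
    ring

theorem oddOp_mem_unitary : oddOp γ hγ ∈ unitary (EllTwo →L[ℂ] EllTwo) := by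
  have hne (k : ℕ) : ¬ Odd (2 * k + 2) := by grind
  have key {P : ℕ → Prop} (hzero : P 0) (hodd : ∀ k, P (2 * k + 1)) (heven : ∀ k, P (2 * k + 2))
      (i : ℕ) : P i := by
    rcases i with _ | i
    · exact hzero
    · obtain ⟨k, rfl | rfl⟩ := i.even_or_odd'
      exacts [hodd k, heven k]
  refine pairOp_mem_unitary _ _ _ _ _ _ (key ?_ ?_ ?_) (key ?_ ?_ ?_) (key ?_ ?_ ?_)
    (key ?_ ?_ ?_) <;> try intro k
  all_goals simp [oddDiag, oddOff, oddPartner, rho_mul_rho (hγ _), hne, mul_comm (conj _)]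

theorem cmv_mem_unitary : cmv γ hγ ∈ unitary (EllTwo →L[ℂ] EllTwo) :=
  mul_mem (evenOp_mem_unitary hγ) (oddOp_mem_unitary hγ)

/-! ### The resolvent of the CMV operator -/

theorem inner_e₀ (x : EllTwo) : inner ℂ e₀ x = x 0 := by
  rw [e₀, lp.inner_single_left]
  simp

theorem e₀_zero : e₀ 0 = 1 := by
  rw [e₀, lp.single_apply_self]

theorem e₀_succ (n : ℕ) : e₀ (n + 1) = 0 :=
  lp.single_apply_ne _ _ _ (by simp)

theorem isUnit_cmv_sub {z : ℂ} (hz : ‖z‖ ≠ 1) :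
    IsUnit (cmv γ hγ - z • (1 : EllTwo →L[ℂ] EllTwo)) := by
  have h : z ∉ spectrum ℂ (cmv γ hγ) := fun h => hz (by
    simpa using spectrum.subset_circle_of_unitary (cmv_mem_unitary hγ) h)
  rw [spectrum.notMem_iff, Algebra.algebraMap_eq_smul_one] at h
  rw [← neg_sub]
  exact h.neg

theorem exists_resolvent {z : ℂ} (hz : ‖z‖ ≠ 1) :
    ∃ x : EllTwo, cmv γ hγ x - z • x = e₀ ∧
      caratheodory γ hγ z = inner ℂ e₀ (cmv γ hγ x + z • x) :=
  ⟨Ring.inverse (cmv γ hγ - z • (1 : EllTwo →L[ℂ] EllTwo)) e₀,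
    congrArg (fun T : EllTwo →L[ℂ] EllTwo => T e₀)
      (Ring.mul_inverse_cancel _ (isUnit_cmv_sub hγ hz)), rfl⟩

theorem caratheodory_eq_of_resolvent {z : ℂ} (hz : ‖z‖ ≠ 1) {x : EllTwo}
    (hx : cmv γ hγ x - z • x = e₀) : caratheodory γ hγ z = 1 + 2 * z * x 0 := by
  have hinv : Ring.inverse (cmv γ hγ - z • (1 : EllTwo →L[ℂ] EllTwo)) e₀ = x := by
    rw [← hx]
    exact congrArg (fun T : EllTwo →L[ℂ] EllTwo => T x)
      (Ring.inverse_mul_cancel _ (isUnit_cmv_sub hγ hz))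
  have hF : caratheodory γ hγ z = inner ℂ e₀ (cmv γ hγ x + z • x) := by
    rw [caratheodory, mul_apply_eq_comp, hinv]
    rfl
  rw [hF, sub_eq_iff_eq_add.1 hx, inner_e₀]
  simp only [lp.coeFn_add, lp.coeFn_smul, Pi.add_apply, Pi.smul_apply, smul_eq_mul, e₀_zero]
  ring

theorem inner_cmv_cmv (x y : EllTwo) : inner ℂ (cmv γ hγ x) (cmv γ hγ y) = inner ℂ x y := by
  rw [← ContinuousLinearMap.adjoint_inner_right, ← ContinuousLinearMap.star_eq_adjoint,
    ← mul_apply_eq_comp, (cmv_mem_unitary hγ).1, one_apply_eq_self]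

theorem caratheodory_reflect {z : ℂ} (hz0 : z ≠ 0) (hz : ‖z‖ ≠ 1) :
    caratheodory γ hγ z = -conj (caratheodory γ hγ (conj z)⁻¹) := by
  set w := (conj z)⁻¹ with hw
  have hw1 : ‖w‖ ≠ 1 := by
    rw [hw, norm_inv, RCLike.norm_conj]
    simpa using hz
  have hzw : z * conj w = 1 := by
    rw [hw, map_inv₀, Complex.conj_conj, mul_inv_cancel₀ hz0]
  obtain ⟨y, hy, hFz⟩ := exists_resolvent hγ hz
  obtain ⟨x, hx, hFw⟩ := exists_resolvent hγ hw1
  have hz_inner : caratheodory γ hγ z = inner ℂ (cmv γ hγ x - w • x) (cmv γ hγ y + z • y) := by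
    rw [hFz, hx]
  have hw_inner : conj (caratheodory γ hγ w) =
      inner ℂ (cmv γ hγ x + w • x) (cmv γ hγ y - z • y) := by
    rw [hFw, inner_conj_symm, hy]
  rw [hz_inner, hw_inner]
  simp only [inner_sub_left, inner_add_right, inner_add_left, inner_sub_right, inner_cmv_cmv,
    inner_smul_left, inner_smul_right]
  linear_combination (-2 * inner ℂ x y) * hzw

end CMV
/-! ### Geronimus' theorem -/

/-- A chain of Schur parameters at the point `z`: values in the closed unit disk related by the
steps of the Schur algorithm with parameters `γ n`. For `‖z‖ < 1` its value at index `0` is the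
Schur function of the CMV operator with Verblunsky coefficients `γ`. -/
structure IsSchurChain (γ : ℕ → ℂ) (z : ℂ) (φ : ℕ → ℂ) : Prop where
  norm_le (n : ℕ) : ‖φ n‖ ≤ 1
  eq_schurStep (n : ℕ) : φ n = schurStep (-conj (γ n)) z (φ (n + 1))

/-- The entries from which the vector `(𝒞 - z)⁻¹ e₀` is built. -/
def weylSeq (γ : ℕ → ℂ) (z : ℂ) (φ : ℕ → ℂ) : ℕ → ℂ
  | 0 => 1 / (1 - z * φ 0)
  | n + 1 => rho (γ n) * weylSeq γ z φ n / (1 + conj (γ n) * z * φ (n + 1))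

/-- The entries of the vector `(𝒞 - z)⁻¹ e₀`. -/
def weylVec (γ : ℕ → ℂ) (z : ℂ) (φ : ℕ → ℂ) : ℕ → ℂ
  | 0 => φ 0 * weylSeq γ z φ 0
  | i + 1 => z ^ (i / 2) * (if Even i then φ (i + 1) else 1) * weylSeq γ z φ (i + 1)

namespace IsSchurChain

variable {γ : ℕ → ℂ} {z : ℂ} {φ : ℕ → ℂ}

theorem denom_ne_zero (hφ : IsSchurChain γ z φ) (hγ : ∀ n, ‖γ n‖ < 1) (hz : ‖z‖ < 1) (n : ℕ) :
    1 + conj (γ n) * z * φ (n + 1) ≠ 0 := by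
  simpa using schurStep_denom_ne_zero (a := -conj (γ n)) (by simpa using hγ n) hz.le
    (hφ.norm_le (n + 1))

theorem mul_denom (hφ : IsSchurChain γ z φ) (hγ : ∀ n, ‖γ n‖ < 1) (hz : ‖z‖ < 1) (n : ℕ) :
    φ n * (1 + conj (γ n) * z * φ (n + 1)) = z * φ (n + 1) + γ n := by
  rw [hφ.eq_schurStep n, schurStep]
  simpa using div_mul_cancel₀ (z * φ (n + 1) + γ n) (hφ.denom_ne_zero hγ hz n)

theorem weylSeq_succ_mul_denom (hφ : IsSchurChain γ z φ) (hγ : ∀ n, ‖γ n‖ < 1) (hz : ‖z‖ < 1)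
    (n : ℕ) : weylSeq γ z φ (n + 1) * (1 + conj (γ n) * z * φ (n + 1)) =
      rho (γ n) * weylSeq γ z φ n :=
  div_mul_cancel₀ _ (hφ.denom_ne_zero hγ hz n)

theorem theta_fst (hφ : IsSchurChain γ z φ) (hγ : ∀ n, ‖γ n‖ < 1) (hz : ‖z‖ < 1) (n : ℕ) :
    conj (γ n) * (φ n * weylSeq γ z φ n) + rho (γ n) * weylSeq γ z φ (n + 1) =
      weylSeq γ z φ n := by
  refine mul_right_cancel₀ (hφ.denom_ne_zero hγ hz n) ?_
  linear_combination conj (γ n) * weylSeq γ z φ n * hφ.mul_denom hγ hz n +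
    rho (γ n) * hφ.weylSeq_succ_mul_denom hγ hz n + weylSeq γ z φ n * rho_mul_rho (hγ n)

theorem theta_snd (hφ : IsSchurChain γ z φ) (hγ : ∀ n, ‖γ n‖ < 1) (hz : ‖z‖ < 1) (n : ℕ) :
    rho (γ n) * (φ n * weylSeq γ z φ n) - γ n * weylSeq γ z φ (n + 1) =
      z * (φ (n + 1) * weylSeq γ z φ (n + 1)) := by
  refine mul_right_cancel₀ (hφ.denom_ne_zero hγ hz n) ?_
  linear_combination rho (γ n) * weylSeq γ z φ n * hφ.mul_denom hγ hz n -
    (γ n + z * φ (n + 1)) * hφ.weylSeq_succ_mul_denom hγ hz n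

theorem energy_succ_le (hφ : IsSchurChain γ z φ) (hγ : ∀ n, ‖γ n‖ < 1) (hz : ‖z‖ < 1) (n : ℕ) :
    ‖weylSeq γ z φ (n + 1)‖ ^ 2 * (1 - ‖z * φ (n + 1)‖ ^ 2) ≤
      ‖weylSeq γ z φ n‖ ^ 2 * (1 - ‖z * φ n‖ ^ 2) := by
  have hD := hφ.denom_ne_zero hγ hz n
  have hstep : 1 - ‖φ n‖ ^ 2 = rho (γ n) ^ 2 * (1 - ‖z * φ (n + 1)‖ ^ 2) /
      ‖1 + conj (γ n) * z * φ (n + 1)‖ ^ 2 := by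
    have h := one_sub_norm_sq_schurStep (a := -conj (γ n)) (z := z) (w := φ (n + 1))
      (by simpa using hD)
    rw [← hφ.eq_schurStep] at h
    simpa [rho_sq (hγ n)] using h
  have hx : ‖weylSeq γ z φ (n + 1)‖ ^ 2 = rho (γ n) ^ 2 * ‖weylSeq γ z φ n‖ ^ 2 /
      ‖1 + conj (γ n) * z * φ (n + 1)‖ ^ 2 := by
    rw [weylSeq, norm_div, norm_mul, Complex.norm_real, div_pow, mul_pow, Real.norm_eq_abs, sq_abs]
  calc ‖weylSeq γ z φ (n + 1)‖ ^ 2 * (1 - ‖z * φ (n + 1)‖ ^ 2)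
      = ‖weylSeq γ z φ n‖ ^ 2 * (1 - ‖φ n‖ ^ 2) := by rw [hx, hstep]; ring
    _ ≤ ‖weylSeq γ z φ n‖ ^ 2 * (1 - ‖z * φ n‖ ^ 2) := by
        rw [norm_mul]
        gcongr
        exact mul_le_of_le_one_left (norm_nonneg _) hz.le

theorem exists_norm_sq_weylSeq_le (hφ : IsSchurChain γ z φ) (hγ : ∀ n, ‖γ n‖ < 1)
    (hz : ‖z‖ < 1) : ∃ C, ∀ n, ‖weylSeq γ z φ n‖ ^ 2 ≤ C := by
  have hE : Antitone fun n => ‖weylSeq γ z φ n‖ ^ 2 * (1 - ‖z * φ n‖ ^ 2) :=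
    antitone_nat_of_succ_le (hφ.energy_succ_le hγ hz)
  refine ⟨‖weylSeq γ z φ 0‖ ^ 2 * (1 - ‖z * φ 0‖ ^ 2) / (1 - ‖z‖ ^ 2), fun n => ?_⟩
  rw [le_div_iff₀ (one_sub_norm_sq_pos hz)]
  calc ‖weylSeq γ z φ n‖ ^ 2 * (1 - ‖z‖ ^ 2)
      ≤ ‖weylSeq γ z φ n‖ ^ 2 * (1 - ‖z * φ n‖ ^ 2) := by
        rw [norm_mul]
        gcongr
        exact mul_le_of_le_one_right (norm_nonneg _) (hφ.norm_le n)
    _ ≤ _ := hE n.zero_le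

theorem summable_norm_sq_weylVec (hφ : IsSchurChain γ z φ) (hγ : ∀ n, ‖γ n‖ < 1)
    (hz : ‖z‖ < 1) : Summable fun i => ‖weylVec γ z φ i‖ ^ 2 := by
  obtain ⟨C, hC⟩ := hφ.exists_norm_sq_weylSeq_le hγ hz
  have hbound (i : ℕ) : ‖weylVec γ z φ (i + 1)‖ ^ 2 ≤ (‖z‖ ^ 2) ^ (i / 2) * C := by
    have hle : ‖(if Even i then φ (i + 1) else 1 : ℂ)‖ ≤ 1 := by
      split_ifs
      exacts [hφ.norm_le _, norm_one.le]
    rw [weylVec, norm_mul, norm_mul, norm_pow, mul_pow, mul_pow, ← pow_mul, ← pow_mul, mul_comm 2]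
    exact mul_le_mul (mul_le_of_le_one_right (by positivity) (pow_le_one₀ (norm_nonneg _) hle))
      (hC _) (by positivity) (by positivity)
  have hgeom : Summable fun k : ℕ => (‖z‖ ^ 2) ^ k * C :=
    (summable_geometric_of_lt_one (by positivity) (by nlinarith [norm_nonneg z])).mul_right C
  refine (summable_nat_add_iff 1).1 (Summable.of_nonneg_of_le (fun i => by positivity) hbound ?_)
  refine (HasSum.even_add_odd (f := fun i => (‖z‖ ^ 2) ^ (i / 2) * C) (m := ∑' k, (‖z‖ ^ 2) ^ k * C)
    (m' := ∑' k, (‖z‖ ^ 2) ^ k * C) ?_ ?_).summable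
  · simpa using hgeom.hasSum
  · have (k : ℕ) : (2 * k + 1) / 2 = k := by omega
    simpa only [this] using hgeom.hasSum

theorem weylVec_two_mul_add_one (k : ℕ) : weylVec γ z φ (2 * k + 1) =
    z ^ k * (φ (2 * k + 1) * weylSeq γ z φ (2 * k + 1)) := by
  simp [weylVec, mul_assoc]

theorem weylVec_two_mul_add_two (k : ℕ) : weylVec γ z φ (2 * k + 2) =
    z ^ k * weylSeq γ z φ (2 * k + 2) := by
  have (k : ℕ) : (2 * k + 1) / 2 = k := by omega
  simp [weylVec, this]

theorem oddOp_weylVec_two_mul (hφ : IsSchurChain γ z φ) (hγ : ∀ n, ‖γ n‖ < 1) (hz : ‖z‖ < 1)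
    {u : EllTwo} (hu : ∀ i, u i = weylVec γ z φ i) (k : ℕ) :
    oddOp γ hγ u (2 * k) = z ^ k * (φ (2 * k) * weylSeq γ z φ (2 * k)) := by
  rcases k with _ | k
  · rw [mul_zero, oddOp_apply_zero, hu, weylVec, pow_zero, one_mul]
  · rw [mul_add, mul_one, oddOp_apply_two_mul_add_two, hu, hu, weylVec_two_mul_add_one,
      weylVec_two_mul_add_two, pow_succ]
    linear_combination z ^ k * hφ.theta_snd hγ hz (2 * k + 1)

theorem oddOp_weylVec_two_mul_add_one (hφ : IsSchurChain γ z φ) (hγ : ∀ n, ‖γ n‖ < 1)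
    (hz : ‖z‖ < 1) {u : EllTwo} (hu : ∀ i, u i = weylVec γ z φ i) (k : ℕ) :
    oddOp γ hγ u (2 * k + 1) = z ^ k * weylSeq γ z φ (2 * k + 1) := by
  rw [oddOp_apply_two_mul_add_one, hu, hu, weylVec_two_mul_add_one, weylVec_two_mul_add_two]
  linear_combination z ^ k * hφ.theta_fst hγ hz (2 * k + 1)

theorem one_sub_mul_ne_zero (hφ : IsSchurChain γ z φ) (hz : ‖z‖ < 1) : 1 - z * φ 0 ≠ 0 :=
  sub_ne_zero.2 fun h => (norm_mul_lt_one hz (hφ.norm_le 0)).ne (by rw [← h, norm_one])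

theorem cmv_weylVec (hφ : IsSchurChain γ z φ) (hγ : ∀ n, ‖γ n‖ < 1) (hz : ‖z‖ < 1)
    {u : EllTwo} (hu : ∀ i, u i = weylVec γ z φ i) : cmv γ hγ u - z • u = e₀ := by
  have hcmv : cmv γ hγ u = evenOp γ hγ (oddOp γ hγ u) := rfl
  have heven (k : ℕ) : cmv γ hγ u (2 * k) = z ^ k * weylSeq γ z φ (2 * k) := by
    rw [hcmv, evenOp_apply_two_mul, hφ.oddOp_weylVec_two_mul hγ hz hu,
      hφ.oddOp_weylVec_two_mul_add_one hγ hz hu]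
    linear_combination z ^ k * hφ.theta_fst hγ hz (2 * k)
  have hodd (k : ℕ) : cmv γ hγ u (2 * k + 1) = z * u (2 * k + 1) := by
    rw [hcmv, evenOp_apply_two_mul_add_one, hφ.oddOp_weylVec_two_mul hγ hz hu,
      hφ.oddOp_weylVec_two_mul_add_one hγ hz hu, hu, weylVec_two_mul_add_one]
    linear_combination z ^ k * hφ.theta_snd hγ hz (2 * k)
  ext i
  simp only [lp.coeFn_sub, lp.coeFn_smul, Pi.sub_apply, Pi.smul_apply, smul_eq_mul]
  rcases i with _ | i
  · have hden := hφ.one_sub_mul_ne_zero hz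
    rw [e₀_zero, ← mul_zero 2, heven, mul_zero, hu, weylVec, weylSeq]
    field_simp
  · rw [e₀_succ, sub_eq_zero]
    obtain ⟨k, rfl | rfl⟩ := i.even_or_odd'
    · exact hodd k
    · rw [show 2 * k + 1 + 1 = 2 * (k + 1) by ring, heven, hu, mul_add, mul_one,
        weylVec_two_mul_add_two]
      ring

theorem caratheodory_eq (hφ : IsSchurChain γ z φ) (hγ : ∀ n, ‖γ n‖ < 1) (hz : ‖z‖ < 1) :
    caratheodory γ hγ z = (1 + z * φ 0) / (1 - z * φ 0) := by
  have hden := hφ.one_sub_mul_ne_zero hz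
  let u : EllTwo := ⟨weylVec γ z φ, (memℓp_two_iff _).2 (hφ.summable_norm_sq_weylVec hγ hz)⟩
  rw [caratheodory_eq_of_resolvent hγ hz.ne (hφ.cmv_weylVec hγ hz (u := u) fun _ => rfl)]
  change 1 + 2 * z * (φ 0 * (1 / (1 - z * φ 0))) = _
  field_simp
  ring

theorem caratheodory_ne_neg_one (hφ : IsSchurChain γ z φ) (hγ : ∀ n, ‖γ n‖ < 1) (hz : ‖z‖ < 1) :
    caratheodory γ hγ z ≠ -1 := by
  rw [hφ.caratheodory_eq hγ hz, Ne, div_eq_iff (hφ.one_sub_mul_ne_zero hz)]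
  intro h
  exact two_ne_zero (α := ℂ) (by linear_combination h)

theorem one_div_mul_eq (hφ : IsSchurChain γ z φ) (hγ : ∀ n, ‖γ n‖ < 1) (hz : ‖z‖ < 1)
    (hz0 : z ≠ 0) :
    1 / z * ((caratheodory γ hγ z - 1) / (caratheodory γ hγ z + 1)) = φ 0 := by
  have hden := hφ.one_sub_mul_ne_zero hz
  have hsub : caratheodory γ hγ z - 1 = 2 * (z * φ 0) / (1 - z * φ 0) := by
    rw [hφ.caratheodory_eq hγ hz, div_sub_one hden]
    ring
  have hadd : caratheodory γ hγ z + 1 = 2 / (1 - z * φ 0) := by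
    rw [hφ.caratheodory_eq hγ hz, div_add_one hden]
    ring
  rw [hsub, hadd]
  field_simp

end IsSchurChain

theorem tendsto_schurChain_zero {γ : ℕ → ℂ} {φ : ℂ → ℕ → ℂ}
    (hφ : ∀ z, ‖z‖ < 1 → IsSchurChain γ z (φ z)) : Tendsto (fun z => φ z 0) (𝓝 0) (𝓝 (φ 0 0)) := by
  have hball : ∀ᶠ z : ℂ in 𝓝 0, ‖z‖ < 1 :=
    continuous_norm.continuousAt.eventually_lt_const (by simp)
  have hmul : Tendsto (fun z => z * φ z 1) (𝓝 0) (𝓝 0) := by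
    refine tendsto_id.zero_mul_isBoundedUnder_le ⟨1, ?_⟩
    rw [eventually_map]
    exact hball.mono fun z hz => (hφ z hz).norm_le 1
  have hlim := (hmul.sub_const (conj (-conj (γ 0)))).div
    ((hmul.const_mul (-conj (γ 0))).const_sub 1) (by simp)
  rw [(hφ 0 (by simp)).eq_schurStep 0, schurStep]
  simp only [zero_mul, mul_zero] at hlim ⊢
  refine hlim.congr' (hball.mono fun z hz => ?_)
  change _ = φ z 0
  rw [(hφ z hz).eq_schurStep 0, schurStep, zero_add, mul_assoc]
  rfl

theorem schur_eq {γ : ℕ → ℂ} (hγ : ∀ n, ‖γ n‖ < 1) {φ : ℂ → ℕ → ℂ}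
    (hφ : ∀ z, ‖z‖ < 1 → IsSchurChain γ z (φ z)) {z : ℂ} (hz : ‖z‖ < 1) :
    schur γ hγ z = ((φ z 0 : ℂ) : OnePoint ℂ) := by
  rw [schur]
  split_ifs with h0 hneg
  · congr 1
    rw [h0]
    refine Tendsto.limUnder_eq
      (((tendsto_schurChain_zero hφ).mono_left nhdsWithin_le_nhds).congr' ?_)
    have hball : ∀ᶠ z : ℂ in 𝓝 0, ‖z‖ < 1 :=
      continuous_norm.continuousAt.eventually_lt_const (by simp)
    filter_upwards [nhdsWithin_le_nhds hball, self_mem_nhdsWithin] with w hw hw0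
    exact ((hφ w hw).one_div_mul_eq hγ hw hw0).symm
  · exact absurd hneg ((hφ z hz).caratheodory_ne_neg_one hγ hz)
  · rw [(hφ z hz).one_div_mul_eq hγ hz h0]

theorem schur_eq_infty {γ : ℕ → ℂ} (hγ : ∀ n, ‖γ n‖ < 1) {z : ℂ} (hz : 1 < ‖z‖) {φ : ℕ → ℂ}
    (hφ : IsSchurChain γ (conj z)⁻¹ φ) (h0 : φ 0 = 0) : schur γ hγ z = OnePoint.infty := by
  have hz0 : z ≠ 0 := norm_pos_iff.1 (one_pos.trans hz)
  have hw : ‖(conj z)⁻¹‖ < 1 := by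
    rw [norm_inv, RCLike.norm_conj]
    exact inv_lt_one_of_one_lt₀ hz
  have h : caratheodory γ hγ z = -1 := by
    rw [caratheodory_reflect hγ hz0 hz.ne', hφ.caratheodory_eq hγ hw, h0]
    simp
  rw [schur, if_neg hz0, if_pos h]

/-! ### Zeros and poles of the Schur functions of the reversed periodic sequence -/

section Reversed

variable {p : ℕ} {α : ℕ → ℂ} {z : ℂ}

theorem isSchurChain_periodicSchur (hp : 0 < p) (hα : ∀ n, ‖α n‖ < 1)
    (hper : Function.Periodic α p) (hz : ‖z‖ < 1) (j : ℕ) :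
    IsSchurChain (fun n => reversedCoeff p α (n + j)) z
      (fun n => periodicSchur p α z (p - (n + j) % p)) where
  norm_le n := norm_periodicSchur_le hp hα hper hz _
  eq_schurStep n := by
    have hlt := Nat.mod_lt (n + j) hp
    have hnext : periodicSchur p α z (p - (n + 1 + j) % p) =
        periodicSchur p α z (p - 1 - (n + j) % p) := by
      rw [add_right_comm, ← Nat.mod_add_mod]
      rcases eq_or_lt_of_le (Nat.le_sub_one_of_lt hlt) with h | h
      · rw [h, Nat.sub_add_cancel hp, Nat.mod_self, Nat.sub_zero, Nat.sub_self]
        simpa using periodic_periodicSchur hp hα hper hz 0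
      · rw [Nat.mod_eq_of_lt (by omega)]
        congr 1
        omega
    rw [hnext, show p - (n + j) % p = p - 1 - (n + j) % p + 1 by omega,
      periodicSchur_succ hp hα hper hz, reversedCoeff]
    simp

theorem exists_periodicSchur_eq (hp : 0 < p) (hα : ∀ n, ‖α n‖ < 1) (hper : Function.Periodic α p)
    (hz : ‖z‖ < 1) (n : ℕ) : ∃ j < p, periodicSchur p α z n = periodicSchur p α z (p - j % p) := by
  have hmod := (periodic_periodicSchur hp hα hper hz).map_mod_nat
  have hlt := Nat.mod_lt n hp
  rcases Nat.eq_zero_or_pos (n % p) with h0 | h0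
  · refine ⟨0, hp, ?_⟩
    rw [← hmod, h0, Nat.zero_mod, Nat.sub_zero, ← hmod p, Nat.mod_self]
  · refine ⟨p - n % p, by omega, ?_⟩
    rw [Nat.mod_eq_of_lt (show p - n % p < p by omega), Nat.sub_sub_self hlt.le, hmod]

theorem periodicSchur_ne_zero_of_notMem_zeroSet (hp : 0 < p) (hα : ∀ n, ‖α n‖ < 1)
    (hper : Function.Periodic α p) (hz : ‖z‖ < 1) (hZ : z ∉ zeroSet p α hα) (n : ℕ) :
    periodicSchur p α z n ≠ 0 := by
  intro h
  obtain ⟨j, hj, hnj⟩ := exists_periodicSchur_eq hp hα hper hz n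
  refine hZ (Set.mem_biUnion (Finset.mem_range.2 hj) ⟨hz, ?_⟩)
  rw [strippedSchur, schur_eq _ (fun z hz => isSchurChain_periodicSchur hp hα hper hz j) hz,
    zero_add, ← hnj, h]

theorem periodicSchur_conj_ne_zero_of_notMem_poleSet (hp : 0 < p) (hα : ∀ n, ‖α n‖ < 1)
    (hper : Function.Periodic α p) (hz : 1 < ‖z‖) (hP : z ∉ poleSet p α hα) (n : ℕ) :
    periodicSchur p (fun j => conj (α j)) z⁻¹ n ≠ 0 := by
  intro h
  have hw : ‖(conj z)⁻¹‖ < 1 := by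
    rw [norm_inv, RCLike.norm_conj]
    exact inv_lt_one_of_one_lt₀ hz
  have h' : periodicSchur p α (conj z)⁻¹ n = 0 := by
    have := conj_periodicSchur hp hα hper hw n
    rw [map_inv₀, Complex.conj_conj, h] at this
    simpa using this
  obtain ⟨j, hj, hnj⟩ := exists_periodicSchur_eq hp hα hper hw n
  refine hP (Set.mem_biUnion (Finset.mem_range.2 hj)
    ⟨hz, schur_eq_infty _ hz (isSchurChain_periodicSchur hp hα hper hw j) ?_⟩)
  rw [zero_add, ← hnj, h']

end Reversed

/-! ### The dominant eigenvalue of the transfer matrix -/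

theorem det_stepMatrix {a : ℂ} (ha : ‖a‖ < 1) (z : ℂ) : (stepMatrix a z).det = z := by
  have h : (rho a : ℂ) ≠ 0 := Complex.ofReal_ne_zero.2 (rho_pos ha).ne'
  rw [stepMatrix, Matrix.det_smul, Matrix.det_fin_two_of, Fintype.card_fin, div_pow, one_pow,
    div_mul_eq_mul_div, div_eq_iff (pow_ne_zero _ h)]
  linear_combination -z * rho_mul_rho ha

theorem det_transferMatrix {α : ℕ → ℂ} (hα : ∀ n, ‖α n‖ < 1) (z : ℂ) (n : ℕ) :
    (transferMatrix α z n).det = z ^ n := by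
  induction n with
  | zero => simp [transferMatrix]
  | succ n ih => rw [transferMatrix, Matrix.det_mul, det_stepMatrix (hα n), ih, pow_succ']

theorem rho_conj (a : ℂ) : rho (conj a) = rho a := by simp [rho]

theorem stepMatrix_inv (a : ℂ) {z : ℂ} (hz : z ≠ 0) :
    stepMatrix a z = z • (!![0, 1; 1, 0] * stepMatrix (conj a) z⁻¹ * !![0, 1; 1, 0]) := by
  ext i j
  fin_cases i <;> fin_cases j <;> simp [stepMatrix, rho_conj] <;> field_simp

theorem transferMatrix_inv (α : ℕ → ℂ) {z : ℂ} (hz : z ≠ 0) (n : ℕ) :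
    transferMatrix α z n = z ^ n • (!![0, 1; 1, 0] *
      transferMatrix (fun j => conj (α j)) z⁻¹ n * !![0, 1; 1, 0]) := by
  have hJ : (!![0, 1; 1, 0] : Matrix (Fin 2) (Fin 2) ℂ) * !![0, 1; 1, 0] = 1 := by
    simp [Matrix.one_fin_two]
  induction n with
  | zero => simp [transferMatrix, hJ]
  | succ n ih =>
    rw [transferMatrix, ih, stepMatrix_inv (α n) hz, transferMatrix, smul_mul_smul_comm,
      ← pow_succ']
    congr 1
    simp only [Matrix.mul_assoc]
    congr 2
    rw [← Matrix.mul_assoc !![0, 1; 1, 0] !![0, 1; 1, 0], hJ, Matrix.one_mul]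

theorem trace_transferMatrix_inv (α : ℕ → ℂ) {z : ℂ} (hz : z ≠ 0) (n : ℕ) :
    (transferMatrix α z n).trace =
      z ^ n * (transferMatrix (fun j => conj (α j)) z⁻¹ n).trace := by
  rw [transferMatrix_inv α hz, Matrix.trace_smul, smul_eq_mul, Matrix.trace_mul_comm,
    ← Matrix.mul_assoc]
  simp [← Matrix.one_fin_two]

theorem continuous_transferMatrix (α : ℕ → ℂ) (n : ℕ) :
    Continuous fun z => transferMatrix α z n := by
  induction n with
  | zero => exact continuous_const
  | succ n ih =>
    have hentries : Continuous fun z : ℂ =>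
        (!![z, -conj (α n); -α n * z, 1] : Matrix (Fin 2) (Fin 2) ℂ) := by
      refine continuous_matrix fun i j => ?_
      fin_cases i <;> fin_cases j
      exacts [continuous_id, continuous_const, continuous_const_mul (-α n), continuous_const]
    exact (hentries.const_smul (1 / (rho (α n) : ℂ))).matrix_mul ih

/-- The product of the `ρ_j` over a period. -/
def rhoProd (p : ℕ) (α : ℕ → ℂ) : ℂ := ∏ j ∈ Finset.range p, (rho (α j) : ℂ)

theorem rhoProd_ne_zero (p : ℕ) {α : ℕ → ℂ} (hα : ∀ n, ‖α n‖ < 1) : rhoProd p α ≠ 0 :=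
  Finset.prod_ne_zero_iff.2 fun j _ => Complex.ofReal_ne_zero.2 (rho_pos (hα j)).ne'

theorem rhoProd_conj (p : ℕ) (α : ℕ → ℂ) : rhoProd p (fun j => conj (α j)) = rhoProd p α := by
  simp only [rhoProd, rho_conj]

/-- `l` is the eigenvalue of strictly larger modulus of the transfer matrix over a period, whose
determinant is `z ^ p`. -/
structure IsDominantEigenvalue (p : ℕ) (α : ℕ → ℂ) (z l : ℂ) : Prop where
  charpoly_eq_zero : l ^ 2 - (transferMatrix α z p).trace * l + z ^ p = 0
  norm_pow_lt : ‖z‖ ^ p < ‖l‖ ^ 2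

theorem dominantSqrt_add_inv {w : ℂ} (hw : 1 < ‖w‖) : dominantSqrt (w + w⁻¹) = w - w⁻¹ := by
  have hw0 : w ≠ 0 := norm_pos_iff.1 (one_pos.trans hw)
  have hroot : (((w + w⁻¹) ^ 2 - 4) ^ (1 / 2 : ℂ)) ^ 2 = (w - w⁻¹) ^ 2 := by
    rw [← Complex.cpow_nat_mul, show ((2 : ℕ) : ℂ) * (1 / 2) = 1 by norm_num, Complex.cpow_one]
    field_simp
    ring
  have hadd : w + w⁻¹ + (w - w⁻¹) = 2 * w := by ring
  have hsub : w + w⁻¹ - (w - w⁻¹) = 2 * w⁻¹ := by ring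
  have hlt : ‖2 * w⁻¹‖ < ‖2 * w‖ := by
    rw [norm_mul, norm_mul, norm_inv]
    exact mul_lt_mul_of_pos_left ((inv_lt_one_of_one_lt₀ hw).trans hw) (by simp)
  rw [dominantSqrt]
  rcases sq_eq_sq_iff_eq_or_eq_neg.1 hroot with h | h
  · rw [h, hadd, hsub, if_pos hlt.le]
  · rw [h, sub_neg_eq_add, ← sub_eq_add_neg, hadd, hsub, if_neg (not_le.2 hlt), neg_neg]

theorem IsDominantEigenvalue.gDelta_eq {p : ℕ} {α : ℕ → ℂ} {z l : ℂ}
    (hl : IsDominantEigenvalue p α z l) (hz : z ≠ 0) : gDelta p α z = rhoProd p α * l := by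
  set s : ℂ := z ^ ((p : ℂ) / 2) with hs
  have hss : s ^ 2 = z ^ p := by
    rw [hs, sq, ← Complex.cpow_add _ _ hz, add_halves, Complex.cpow_natCast]
  have hs0 : s ≠ 0 := fun h => pow_ne_zero p hz (by rw [← hss, h, zero_pow two_ne_zero])
  have hsl : ‖s‖ < ‖l‖ := lt_of_pow_lt_pow_left₀ 2 (norm_nonneg l) (by
    rw [← norm_pow, hss, norm_pow]
    exact hl.norm_pow_lt)
  have hl0 : l ≠ 0 := norm_pos_iff.1 ((norm_nonneg s).trans_lt hsl)
  have hw : 1 < ‖l / s‖ := by rwa [norm_div, one_lt_div (norm_pos_iff.2 hs0)]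
  have hd : discriminant p α z = l / s + (l / s)⁻¹ := by
    rw [discriminant, neg_div, Complex.cpow_neg, ← hs, inv_div]
    field_simp
    linear_combination -hl.charpoly_eq_zero - hss
  rw [gDelta, if_neg hz, hd, dominantSqrt_add_inv hw, ← hs, rhoProd]
  field_simp
  ring

section Disk

variable {p : ℕ} {α : ℕ → ℂ} {z : ℂ}

/-- The product of the factors `(1 - α_j z f_j) / ρ_j` over `j < n`, where `f_j` are the periodic
Schur functions. For `n = p` this is an eigenvalue of the transfer matrix over a period. -/
def schurMultiplier (p : ℕ) (α : ℕ → ℂ) (z : ℂ) (n : ℕ) : ℂ :=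
  ∏ j ∈ Finset.range n, ((1 - α j * z * periodicSchur p α z j) / rho (α j))

theorem transferMatrix_mulVec (hp : 0 < p) (hα : ∀ n, ‖α n‖ < 1) (hper : Function.Periodic α p)
    (hz : ‖z‖ < 1) (n : ℕ) :
    (transferMatrix α z n).mulVec ![periodicSchur p α z 0, 1] =
      schurMultiplier p α z n • ![periodicSchur p α z n, 1] := by
  induction n with
  | zero => simp [transferMatrix, schurMultiplier]
  | succ n ih =>
    have hstep : (stepMatrix (α n) z).mulVec ![periodicSchur p α z n, 1] =
        ((1 - α n * z * periodicSchur p α z n) / rho (α n)) •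
          ![periodicSchur p α z (n + 1), 1] := by
      have hmul := div_mul_cancel₀ (z * periodicSchur p α z n - conj (α n))
        (schurStep_denom_ne_zero (hα n) hz.le (norm_periodicSchur_le hp hα hper hz n))
      rw [← schurStep, ← periodicSchur_succ hp hα hper hz] at hmul
      ext i
      fin_cases i <;>
        simp only [stepMatrix, Matrix.mulVec, dotProduct, Fin.sum_univ_two, Fin.zero_eta,
          Fin.mk_one, Fin.isValue, Matrix.smul_apply, Matrix.of_apply, Matrix.cons_val_zero,
          Matrix.cons_val_one, Matrix.cons_val_fin_one, Pi.smul_apply, smul_eq_mul]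
      · linear_combination -hmul / rho (α n)
      · ring
    rw [transferMatrix, ← Matrix.mulVec_mulVec, ih, Matrix.mulVec_smul, hstep, smul_smul,
      schurMultiplier, schurMultiplier, Finset.prod_range_succ]

theorem charpoly_schurMultiplier (hp : 0 < p) (hα : ∀ n, ‖α n‖ < 1)
    (hper : Function.Periodic α p) (hz : ‖z‖ < 1) :
    schurMultiplier p α z p ^ 2 - (transferMatrix α z p).trace * schurMultiplier p α z p +
      z ^ p = 0 := by
  have hmul := transferMatrix_mulVec hp hα hper hz p
  rw [(periodic_periodicSchur hp hα hper hz).eq] at hmul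
  have h0 := congrFun hmul 0
  have h1 := congrFun hmul 1
  simp only [Matrix.mulVec, dotProduct, Fin.sum_univ_two, Fin.isValue, Matrix.cons_val_zero,
    Matrix.cons_val_one, Matrix.cons_val_fin_one, Pi.smul_apply, smul_eq_mul, mul_one] at h0 h1
  rw [← det_transferMatrix hα z p, Matrix.det_fin_two, Matrix.trace_fin_two]
  linear_combination (transferMatrix α z p 0 0 - schurMultiplier p α z p) * h1 -
    transferMatrix α z p 1 0 * h0

theorem one_sub_norm_sq_periodicSchur_le (hp : 0 < p) (hα : ∀ n, ‖α n‖ < 1)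
    (hper : Function.Periodic α p) (hz : ‖z‖ < 1) (n : ℕ) :
    1 - ‖periodicSchur p α z 0‖ ^ 2 ≤
      ‖schurMultiplier p α z n‖ ^ 2 * (1 - ‖periodicSchur p α z n‖ ^ 2) := by
  induction n with
  | zero => simp [schurMultiplier]
  | succ n ih =>
    set f := periodicSchur p α z n
    have hden : 1 - α n * z * f ≠ 0 :=
      schurStep_denom_ne_zero (hα n) hz.le (norm_periodicSchur_le hp hα hper hz n)
    have hstep : ‖(1 - α n * z * f) / rho (α n)‖ ^ 2 * (1 - ‖schurStep (α n) z f‖ ^ 2) =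
        1 - ‖z * f‖ ^ 2 := by
      have hn := norm_ne_zero_iff.2 hden
      have hr := (rho_pos (hα n)).ne'
      rw [one_sub_norm_sq_schurStep hden, ← rho_sq (hα n), norm_div, Complex.norm_real,
        Real.norm_of_nonneg (rho_pos (hα n)).le]
      field_simp
    calc 1 - ‖periodicSchur p α z 0‖ ^ 2
        ≤ ‖schurMultiplier p α z n‖ ^ 2 * (1 - ‖f‖ ^ 2) := ih
      _ ≤ ‖schurMultiplier p α z n‖ ^ 2 * (1 - ‖z * f‖ ^ 2) := by
          rw [norm_mul]
          gcongr
          exact mul_le_of_le_one_left (norm_nonneg _) hz.le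
      _ = _ := by
          rw [periodicSchur_succ hp hα hper hz, ← hstep, schurMultiplier, schurMultiplier,
            Finset.prod_range_succ, norm_mul _ (_ / _)]
          ring

theorem one_le_norm_schurMultiplier (hp : 0 < p) (hα : ∀ n, ‖α n‖ < 1)
    (hper : Function.Periodic α p) (hz : ‖z‖ < 1) : 1 ≤ ‖schurMultiplier p α z p‖ := by
  have h := one_sub_norm_sq_periodicSchur_le hp hα hper hz p
  rw [(periodic_periodicSchur hp hα hper hz).eq] at h
  refine (one_le_sq_iff₀ (norm_nonneg _)).1 (le_of_mul_le_mul_right ?_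
    (one_sub_norm_sq_pos (norm_periodicSchur_lt hp hα hper hz 0)))
  rwa [one_mul]

theorem isDominantEigenvalue_schurMultiplier (hp : 0 < p) (hα : ∀ n, ‖α n‖ < 1)
    (hper : Function.Periodic α p) (hz : ‖z‖ < 1) :
    IsDominantEigenvalue p α z (schurMultiplier p α z p) where
  charpoly_eq_zero := charpoly_schurMultiplier hp hα hper hz
  norm_pow_lt := (pow_lt_one₀ (norm_nonneg _) hz hp.ne').trans_le
    (one_le_pow₀ (one_le_norm_schurMultiplier hp hα hper hz))

theorem gDelta_eq_prod (hp : 0 < p) (hα : ∀ n, ‖α n‖ < 1) (hper : Function.Periodic α p)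
    (hz : ‖z‖ < 1) :
    gDelta p α z = ∏ j ∈ Finset.range p, (1 - α j * z * periodicSchur p α z j) := by
  rcases eq_or_ne z 0 with rfl | h0
  · simp [gDelta]
  · rw [(isDominantEigenvalue_schurMultiplier hp hα hper hz).gDelta_eq h0, rhoProd,
      schurMultiplier, ← Finset.prod_mul_distrib]
    exact Finset.prod_congr rfl fun j _ =>
      mul_div_cancel₀ _ (Complex.ofReal_ne_zero.2 (rho_pos (hα j)).ne')

theorem prod_range_add_of_periodic {g : ℕ → ℂ} (hg : Function.Periodic g p) (n : ℕ) :
    ∏ j ∈ Finset.range p, g (n + j) = ∏ j ∈ Finset.range p, g j := by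
  induction n with
  | zero => simp
  | succ n ih =>
    rw [← ih]
    rcases p with _ | p
    · simp
    · rw [Finset.prod_range_succ, Finset.prod_range_succ', add_zero]
      simp only [← hg n, add_comm, add_left_comm]

theorem gDelta_eq_prod_add (hp : 0 < p) (hα : ∀ n, ‖α n‖ < 1) (hper : Function.Periodic α p)
    (hz : ‖z‖ < 1) (n : ℕ) : gDelta p α z =
      ∏ j ∈ Finset.range p, (1 - α (n + j) * z * periodicSchur p α z (n + j)) := by
  rw [gDelta_eq_prod hp hα hper hz,
    prod_range_add_of_periodic (g := fun j => 1 - α j * z * periodicSchur p α z j)]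
  intro j
  simp only [hper j, periodic_periodicSchur hp hα hper hz j]

end Disk

section OffCircle

variable {p : ℕ} {α : ℕ → ℂ} {z : ℂ}

theorem IsDominantEigenvalue.of_inv {l : ℂ}
    (hl : IsDominantEigenvalue p (fun j => conj (α j)) z⁻¹ l) (hz : z ≠ 0) :
    IsDominantEigenvalue p α z (z ^ p * l) where
  charpoly_eq_zero := by
    have hzp : z ^ p * z⁻¹ ^ p = 1 := by rw [← mul_pow, mul_inv_cancel₀ hz, one_pow]
    rw [trace_transferMatrix_inv α hz]
    linear_combination (z ^ p) ^ 2 * hl.charpoly_eq_zero - z ^ p * hzp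
  norm_pow_lt := by
    have hzp : 0 < ‖z‖ ^ p := pow_pos (norm_pos_iff.2 hz) p
    have h := hl.norm_pow_lt
    rw [norm_inv, inv_pow, inv_lt_iff_one_lt_mul₀ hzp] at h
    rw [norm_mul, norm_pow]
    nlinarith

theorem gDelta_eq_pow_mul (hp : 0 < p) (hα : ∀ n, ‖α n‖ < 1) (hper : Function.Periodic α p)
    (hz : 1 < ‖z‖) : gDelta p α z = z ^ p * gDelta p (fun j => conj (α j)) z⁻¹ := by
  have hz0 : z ≠ 0 := norm_pos_iff.1 (one_pos.trans hz)
  have hw : ‖z⁻¹‖ < 1 := by simpa using inv_lt_one_of_one_lt₀ hz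
  have hl : IsDominantEigenvalue p (fun j => conj (α j)) z⁻¹ _ :=
    isDominantEigenvalue_schurMultiplier hp (fun n => by simpa using hα n) (hper.comp conj) hw
  rw [(hl.of_inv hz0).gDelta_eq hz0, hl.gDelta_eq (inv_ne_zero hz0), rhoProd_conj]
  ring

theorem isDominantEigenvalue_gDelta (hp : 0 < p) (hα : ∀ n, ‖α n‖ < 1)
    (hper : Function.Periodic α p) (hz0 : z ≠ 0) (hz : ‖z‖ ≠ 1) :
    IsDominantEigenvalue p α z (gDelta p α z / rhoProd p α) := by
  obtain ⟨l, hl⟩ : ∃ l, IsDominantEigenvalue p α z l := by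
    rcases hz.lt_or_gt with h | h
    · exact ⟨_, isDominantEigenvalue_schurMultiplier hp hα hper h⟩
    · exact ⟨_, (isDominantEigenvalue_schurMultiplier hp (fun n => by simpa using hα n)
        (hper.comp conj) (by simpa using inv_lt_one_of_one_lt₀ h)).of_inv hz0⟩
  rwa [hl.gDelta_eq hz0, mul_div_cancel_left₀ _ (rhoProd_ne_zero p hα)]

theorem dense_norm_ne_one : Dense {w : ℂ | ‖w‖ ≠ 1} := by
  have h := interior_eq_empty_iff_dense_compl.1 (interior_sphere (0 : ℂ) one_ne_zero)
  simpa [Set.compl_def] using h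

theorem norm_pow_lt_of_isPreconnected {U : Set ℂ} (hU : IsOpen U) (hUc : IsPreconnected U)
    {l : ℂ → ℂ} (hl : DifferentiableOn ℂ l U) (hl0 : ∀ w ∈ U, l w ≠ 0)
    (hle : ∀ w ∈ U, ‖w‖ ^ p ≤ ‖l w‖ ^ 2) (hlt : ∃ w ∈ U, ‖w‖ ^ p < ‖l w‖ ^ 2) (hz : z ∈ U) :
    ‖z‖ ^ p < ‖l z‖ ^ 2 := by
  refine (hle z hz).lt_of_ne fun heq => ?_
  have hpos (w : ℂ) (hw : w ∈ U) : 0 < ‖l w‖ ^ 2 := pow_pos (norm_pos_iff.2 (hl0 w hw)) 2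
  let q : ℂ → ℂ := fun w => w ^ p / l w ^ 2
  have hqn (w : ℂ) : ‖q w‖ = ‖w‖ ^ p / ‖l w‖ ^ 2 := by rw [norm_div, norm_pow, norm_pow]
  have hqd : DifferentiableOn ℂ q U :=
    (differentiable_id.pow p).differentiableOn.div (hl.pow 2) fun w hw => pow_ne_zero _ (hl0 w hw)
  have hqz : ‖q z‖ = 1 := by rw [hqn, heq, div_self (hpos z hz).ne']
  have hmax : IsMaxOn (norm ∘ q) U z := fun w hw => by
    simp only [Set.mem_ofPred_eq, Function.comp_apply]
    rw [hqz, hqn, div_le_one (hpos w hw)]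
    exact hle w hw
  obtain ⟨w, hw, hwlt⟩ := hlt
  have hqw : ‖q w‖ = 1 := by
    rw [Complex.eqOn_of_isPreconnected_of_isMaxOn_norm hUc hU hqd hz hmax hw, Function.const_apply,
      hqz]
  rw [hqn, div_eq_one_iff_eq (hpos w hw).ne'] at hqw
  exact hwlt.ne hqw

theorem eqOn_gDelta_of_eqOn_norm_ne_one (hp : 0 < p) (hα : ∀ n, ‖α n‖ < 1)
    (hper : Function.Periodic α p) {U : Set ℂ} (hU : IsOpen U) (hUc : IsPreconnected U)
    (hU0 : 0 ∉ U) {H : ℂ → ℂ} (hH : DifferentiableOn ℂ H U)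
    (hHG : Set.EqOn H (gDelta p α) (U ∩ {w | ‖w‖ ≠ 1})) : Set.EqOn H (gDelta p α) U := by
  intro z hz
  have hne (w : ℂ) (hw : w ∈ U) : w ≠ 0 := ne_of_mem_of_not_mem hw hU0
  have hcl : U ⊆ closure (U ∩ {w | ‖w‖ ≠ 1}) := dense_norm_ne_one.open_subset_closure_inter hU
  let l : ℂ → ℂ := fun w => H w / rhoProd p α
  have hl : DifferentiableOn ℂ l U := hH.div_const _
  have hoff (w : ℂ) (hw : w ∈ U ∩ {w | ‖w‖ ≠ 1}) : IsDominantEigenvalue p α w (l w) := by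
    simp only [l, hHG hw]
    exact isDominantEigenvalue_gDelta hp hα hper (hne w hw.1) hw.2
  have htr : Continuous fun w => (transferMatrix α w p).trace :=
    (continuous_transferMatrix α p).matrix_trace
  have hchar : Set.EqOn (fun w => l w ^ 2 - (transferMatrix α w p).trace * l w + w ^ p) 0 U :=
    Set.EqOn.of_subset_closure (fun w hw => (hoff w hw).charpoly_eq_zero)
      (((hl.continuousOn.pow 2).sub (htr.continuousOn.mul hl.continuousOn)).add
        (continuous_pow p).continuousOn) continuousOn_const Set.inter_subset_left hcl
  have hle (w : ℂ) (hw : w ∈ U) : ‖w‖ ^ p ≤ ‖l w‖ ^ 2 :=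
    ContinuousWithinAt.closure_le (hcl hw) (by fun_prop)
      (((hl.continuousOn w hw).mono Set.inter_subset_left).norm.pow 2)
      fun v hv => (hoff v hv).norm_pow_lt.le
  have hl0 (w : ℂ) (hw : w ∈ U) : l w ≠ 0 := fun h => by
    have := hle w hw
    rw [h, norm_zero, zero_pow two_ne_zero] at this
    exact this.not_gt (pow_pos (norm_pos_iff.2 (hne w hw)) p)
  obtain ⟨w, hw⟩ := (closure_nonempty_iff.1 ⟨z, hcl hz⟩)
  have hlt := norm_pow_lt_of_isPreconnected hU hUc hl hl0 hle
    ⟨w, hw.1, (hoff w hw).norm_pow_lt⟩ hz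
  rw [IsDominantEigenvalue.gDelta_eq ⟨hchar hz, hlt⟩ (hne z hz),
    mul_div_cancel₀ _ (rhoProd_ne_zero p hα)]

end OffCircle

/-! ### Convergence as `n / N → t` and `z → ζ` -/

/-- The filter on pairs `(n, N)` along which `n → ∞`, `N → ∞` and `n / N → t`. -/
def ratioFilter (t : ℝ) : Filter (ℕ × ℕ) :=
  comap Prod.fst atTop ⊓ comap Prod.snd atTop ⊓
    comap (fun x : ℕ × ℕ => (x.1 : ℝ) / (x.2 : ℝ)) (𝓝 t)

instance (t : ℝ) : (ratioFilter t).IsCountablyGenerated := by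
  unfold ratioFilter
  infer_instance

theorem tendsto_ratioFilter_iff {ι : Type*} {l : Filter ι} {t : ℝ} {f : ι → ℕ × ℕ} :
    Tendsto f l (ratioFilter t) ↔ Tendsto (fun i => (f i).1) l atTop ∧
      Tendsto (fun i => (f i).2) l atTop ∧
      Tendsto (fun i => ((f i).1 : ℝ) / ((f i).2 : ℝ)) l (𝓝 t) := by
  simp only [ratioFilter, tendsto_inf, tendsto_comap_iff, and_assoc]
  rfl

theorem isRatioSeq_iff {t : ℝ} {n N : ℕ → ℕ} :
    IsRatioSeq t n N ↔ Tendsto (fun i => (n i, N i)) atTop (ratioFilter t) := by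
  rw [tendsto_ratioFilter_iff]
  exact ⟨fun h => ⟨h.1, h.2, h.3⟩, fun h => ⟨h.1, h.2.1, h.2.2⟩⟩

theorem ratioFilter_neBot {t : ℝ} (ht : 0 < t) : (ratioFilter t).NeBot := by
  have hcast := tendsto_natCast_atTop_atTop (R := ℝ)
  have hseq : Tendsto (fun i : ℕ => (⌊t * i⌋₊, i)) atTop (ratioFilter t) :=
    tendsto_ratioFilter_iff.2 ⟨tendsto_nat_floor_atTop.comp (hcast.const_mul_atTop ht),
      tendsto_id, (tendsto_nat_floor_mul_div_atTop ht.le).comp hcast⟩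
  exact hseq.neBot

theorem tendsto_ratioFilter_of_bounded_sub (t : ℝ) {g : ℕ → ℕ} {c : ℕ} (h1 : ∀ n, n ≤ g n + c)
    (h2 : ∀ n, g n ≤ n + c) :
    Tendsto (fun x : ℕ × ℕ => (g x.1, x.2)) (ratioFilter t) (ratioFilter t) := by
  obtain ⟨hn, hN, hr⟩ := tendsto_ratioFilter_iff.1 (tendsto_id (x := ratioFilter t))
  simp only [id] at hn hN hr
  refine tendsto_ratioFilter_iff.2 ⟨?_, hN, ?_⟩
  · exact tendsto_atTop_mono (fun x : ℕ × ℕ => tsub_le_iff_right.2 (h1 x.1))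
      ((tendsto_sub_atTop_nat c).comp hn)
  · have hc : Tendsto (fun x : ℕ × ℕ => (c : ℝ) / (x.2 : ℝ)) (ratioFilter t) (𝓝 0) :=
      (tendsto_natCast_atTop_atTop.comp hN).const_div_atTop (c : ℝ)
    have hdiff : Tendsto (fun x : ℕ × ℕ => ((g x.1 : ℝ) - x.1) / (x.2 : ℝ)) (ratioFilter t)
        (𝓝 0) := by
      refine squeeze_zero_norm (fun x => ?_) hc
      have e1 : (x.1 : ℝ) ≤ g x.1 + c := mod_cast h1 x.1
      have e2 : (g x.1 : ℝ) ≤ x.1 + c := mod_cast h2 x.1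
      rw [norm_div, Real.norm_natCast, Real.norm_eq_abs]
      gcongr
      exact abs_le.2 ⟨by linarith, by linarith⟩
    simpa [← add_div] using hr.add hdiff

theorem AsymptoticallyPeriodic.tendsto_sub {a : ℕ → ℕ → ℂ} {t : ℝ} {p : ℕ} {α : ℕ → ℂ}
    (hp : 0 < p) (hper : Function.Periodic α p) (h : AsymptoticallyPeriodic a t p α) :
    Tendsto (fun x : ℕ × ℕ => a x.1 x.2 - α x.1) (ratioFilter t) (𝓝 0) := by
  let blocks : Filter (ℕ × ℕ) := comap (fun x : ℕ × ℕ => (x.1 * p, x.2)) (ratioFilter t)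
  have hdiv : Tendsto (fun x : ℕ × ℕ => (x.1 / p, x.2)) (ratioFilter t) blocks := by
    refine tendsto_comap_iff.2 (tendsto_ratioFilter_of_bounded_sub t (c := p) (fun n => ?_)
      fun n => (Nat.div_mul_le_self n p).trans (Nat.le_add_right n p))
    exact (Nat.div_add_mod' n p).ge.trans (Nat.add_le_add_left (Nat.mod_lt n hp).le _)
  have hres : ∀ j < p, Tendsto (fun x : ℕ × ℕ => a (x.1 * p + j) x.2) blocks (𝓝 (α j)) :=
    fun j hj => tendsto_of_seq_tendsto fun y hy =>
      h j hj (fun i => (y i).1) (fun i => (y i).2) (isRatioSeq_iff.2 (tendsto_comap_iff.1 hy))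
  rw [Metric.tendsto_nhds]
  intro ε hε
  have hall : ∀ᶠ x in blocks, ∀ j ∈ Finset.range p, dist (a (x.1 * p + j) x.2) (α j) < ε :=
    (Filter.eventually_all_finset _).2 fun j hj =>
      Metric.tendsto_nhds.1 (hres j (Finset.mem_range.1 hj)) ε hε
  filter_upwards [hdiv.eventually hall] with x hx
  have hmod := hx (x.1 % p) (Finset.mem_range.2 (Nat.mod_lt _ hp))
  rwa [Nat.div_add_mod', hper.map_mod_nat, dist_eq_norm, ← dist_zero_right] at hmod

/-- The filter of triples `((n, N), z)` along which `n / N → t` and `z → ζ`. Convergence along it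
for every `ζ ∈ S` amounts to locally uniform convergence on `S` as `n / N → t`. -/
def nearFilter (t : ℝ) (ζ : ℂ) : Filter ((ℕ × ℕ) × ℂ) := ratioFilter t ×ˢ 𝓝 ζ

/-- The translation `n ↦ n + m` of the first index in triples `((n, N), z)`. -/
def shift (m : ℕ) (y : (ℕ × ℕ) × ℂ) : (ℕ × ℕ) × ℂ := ((y.1.1 + m, y.1.2), y.2)

section NearFilter

variable {t : ℝ} {ζ : ℂ}

theorem tendsto_fst_nearFilter : Tendsto Prod.fst (nearFilter t ζ) (ratioFilter t) := tendsto_fst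

theorem tendsto_snd_nearFilter : Tendsto Prod.snd (nearFilter t ζ) (𝓝 ζ) := tendsto_snd

theorem eventually_norm_lt {r : ℝ} (h : ‖ζ‖ < r) : ∀ᶠ y in nearFilter t ζ, ‖y.2‖ < r :=
  tendsto_snd_nearFilter.eventually (continuous_norm.continuousAt.eventually_lt_const h)

theorem eventually_eventually_nearFilter {P : (ℕ × ℕ) × ℂ → Prop}
    (h : ∀ᶠ y in nearFilter t ζ, P y) : ∀ᶠ z in 𝓝 ζ, ∀ᶠ y in nearFilter t z, P y := by
  obtain ⟨A, hA, B, hB, hAB⟩ := eventually_prod_iff.1 h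
  exact hB.eventually_nhds.mono fun z hz => eventually_prod_iff.2 ⟨A, hA, B, hz, hAB⟩

theorem map_shift (m : ℕ) : map (shift m) (nearFilter t ζ) = nearFilter t ζ := by
  have hadd := tendsto_ratioFilter_of_bounded_sub t (g := fun n => n + m) (c := m)
    (fun n => by lia) fun n => le_rfl
  have hsub := tendsto_ratioFilter_of_bounded_sub t (g := fun n => n - m) (c := m)
    (fun n => by lia) fun n => by lia
  refine le_antisymm (hadd.prodMap tendsto_id) (le_map_of_right_inverse
    (mba := fun y => ((y.1.1 - m, y.1.2), y.2)) ?_ (hsub.prodMap tendsto_id))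
  filter_upwards [(tendsto_ratioFilter_iff.1
    (tendsto_fst_nearFilter (t := t) (ζ := ζ))).1.eventually_ge_atTop m] with y hy
  simp only [shift, Function.comp_apply, Nat.sub_add_cancel hy, id]

theorem tendsto_shift (m : ℕ) : Tendsto (shift m) (nearFilter t ζ) (nearFilter t ζ) :=
  (map_shift m).le

theorem eventually_of_eventually_shift (m : ℕ) {P : (ℕ × ℕ) × ℂ → Prop}
    (h : ∀ᶠ y in nearFilter t ζ, P (shift m y)) : ∀ᶠ y in nearFilter t ζ, P y := by
  rwa [← map_shift m, eventually_map]

theorem tendsto_inv_nearFilter (hζ : ζ ≠ 0) :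
    Tendsto (fun y => (y.1, y.2⁻¹)) (nearFilter t ζ) (nearFilter t ζ⁻¹) :=
  tendsto_id.prodMap (tendsto_inv₀ hζ)

end NearFilter

/-- The quotients of the values of `T` at `((n + p, N), z)` and `((n, N), z)` tend to `G` as
`n / N → t` and `z → ζ`, and the denominators are eventually nonzero. -/
def QuotientTendsto (t : ℝ) (p : ℕ) (T : (ℕ × ℕ) × ℂ → ℂ) (ζ G : ℂ) : Prop :=
  (∀ᶠ y in nearFilter t ζ, T y ≠ 0) ∧
    Tendsto (fun y => T (shift p y) / T y) (nearFilter t ζ) (𝓝 G)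

section QuotientTendsto

variable {t : ℝ} {p : ℕ} {ζ G : ℂ}

theorem QuotientTendsto.of_shift {T : (ℕ × ℕ) × ℂ → ℂ} (m : ℕ)
    (h : QuotientTendsto t p (fun y => T (shift m y)) ζ G) : QuotientTendsto t p T ζ G := by
  refine ⟨eventually_of_eventually_shift m h.1, ?_⟩
  rw [← map_shift m, tendsto_map'_iff]
  refine h.2.congr fun y => ?_
  simp only [Function.comp_apply, shift, add_right_comm]

/-- The quotient `T' / T` equals `P' / P` up to the factor `(T' / P') / (T / P)`, which tends to
`1`. -/
theorem QuotientTendsto.of_tendsto_sub {P T : (ℕ × ℕ) × ℂ → ℂ} (hP : QuotientTendsto t p P ζ G)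
    (hsub : Tendsto (fun y => T (shift p y) / P (shift p y) - T y / P y) (nearFilter t ζ) (𝓝 0))
    (hPT : P =O[nearFilter t ζ] T) : QuotientTendsto t p T ζ G := by
  have hT : ∀ᶠ y in nearFilter t ζ, T y ≠ 0 := by
    filter_upwards [hPT.eq_zero_imp, hP.1] with y himp hne h0 using hne (himp h0)
  have hbdd : (fun y => P y / T y) =O[nearFilter t ζ] (1 : (ℕ × ℕ) × ℂ → ℝ) :=
    (Asymptotics.div_isBoundedUnder_of_isBigO hPT).isBigO_one ℝ
  have hsmall : Tendsto (fun y => (T (shift p y) / P (shift p y) - T y / P y) * (P y / T y))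
      (nearFilter t ζ) (𝓝 0) := by
    have := ((Asymptotics.isLittleO_one_iff ℝ).2 hsub).mul_isBigO hbdd
    simpa using this
  refine ⟨hT, ?_⟩
  have hlim : Tendsto (fun y => P (shift p y) / P y *
      (1 + (T (shift p y) / P (shift p y) - T y / P y) * (P y / T y))) (nearFilter t ζ) (𝓝 G) := by
    simpa using hP.2.mul (hsmall.const_add 1)
  refine hlim.congr' ?_
  filter_upwards [hT, hP.1, (tendsto_shift p).eventually hP.1] with y h0 h1 h2
  field_simp
  ring

theorem QuotientTendsto.of_inv {T T' : (ℕ × ℕ) × ℂ → ℂ} {c : ℂ → ℂ} (hc : ∀ z ≠ 0, c z ≠ 0)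
    (hT : ∀ y, y.2 ≠ 0 → T y = c y.2 * y.2 ^ y.1.1 * T' (y.1, y.2⁻¹)) (hζ : ζ ≠ 0)
    (h : QuotientTendsto t p T' ζ⁻¹ G) : QuotientTendsto t p T ζ (ζ ^ p * G) := by
  have hne : ∀ᶠ y in nearFilter t ζ, y.2 ≠ 0 := tendsto_snd_nearFilter.eventually_ne hζ
  have hT' : ∀ᶠ y in nearFilter t ζ, T' (y.1, y.2⁻¹) ≠ 0 :=
    (tendsto_inv_nearFilter hζ).eventually h.1
  constructor
  · filter_upwards [hne, hT'] with y hy hy'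
    rw [hT y hy]
    exact mul_ne_zero (mul_ne_zero (hc _ hy) (pow_ne_zero _ hy)) hy'
  · refine ((tendsto_snd_nearFilter.pow p).mul
      (h.2.comp (tendsto_inv_nearFilter hζ))).congr' ?_
    filter_upwards [hne] with y hy
    have hcy := hc _ hy
    rw [hT y hy, hT (shift p y) hy]
    simp only [shift, Function.comp_apply, pow_add]
    field_simp

theorem continuousOn_of_tendsto_prod_nhds {ι X Y : Type*} [TopologicalSpace X]
    [PseudoMetricSpace Y] {l : Filter ι} [l.NeBot] {F : ι × X → Y} {G : X → Y} {S : Set X}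
    (h : ∀ z ∈ S, Tendsto F (l ×ˢ 𝓝 z) (𝓝 (G z))) : ContinuousOn G S := by
  intro z hz
  rw [ContinuousWithinAt, Metric.tendsto_nhds]
  intro ε hε
  have hnear : ∀ᶠ w in 𝓝 z, ∀ᶠ i in l, dist (F (i, w)) (G z) < ε / 2 :=
    (tendsto_prod_swap.eventually (Metric.tendsto_nhds.1 (h z hz) (ε / 2) (half_pos hε))).curry
  filter_upwards [mem_nhdsWithin_of_mem_nhds hnear, self_mem_nhdsWithin] with w hw hwS
  have hlim : Tendsto (fun i => F (i, w)) l (𝓝 (G w)) :=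
    (h w hwS).comp (tendsto_id.prodMk (tendsto_const_nhds (x := w)))
  exact (le_of_tendsto (hlim.dist tendsto_const_nhds) (hw.mono fun _ hi => hi.le)).trans_lt
    (half_lt_self hε)

theorem tendstoLocallyUniformlyOn_of_tendsto_prod_nhds {ι X Y : Type*} [TopologicalSpace X]
    [PseudoMetricSpace Y] {l : Filter ι} [l.NeBot] {F : ι × X → Y} {G : X → Y} {S : Set X}
    (h : ∀ z ∈ S, Tendsto F (l ×ˢ 𝓝 z) (𝓝 (G z))) :
    TendstoLocallyUniformlyOn (fun i z => F (i, z)) G l S := by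
  rw [tendstoLocallyUniformlyOn_iff_forall_tendsto]
  intro z hz
  have hG : Tendsto (fun y : ι × X => G y.2) (l ×ˢ 𝓝[S] z) (𝓝 (G z)) :=
    (continuousOn_of_tendsto_prod_nhds h z hz).tendsto.comp tendsto_snd
  have hF : Tendsto F (l ×ˢ 𝓝[S] z) (𝓝 (G z)) :=
    (h z hz).mono_left (Filter.prod_mono le_rfl nhdsWithin_le_nhds)
  exact tendsto_uniformity_iff_dist_tendsto_zero.2 (by simpa using hG.dist hF)

theorem quotientsConverge_of_quotientTendsto {T : ℕ → ℕ → ℂ[X]} {G : ℂ → ℂ} {S : Set ℂ}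
    (h : ∀ z ∈ S, QuotientTendsto t p (fun y => (T y.1.1 y.1.2).eval y.2) z (G z)) :
    QuotientsConverge t (fun n N => T (n + p) N) T G S := by
  intro K hKS hK n N hnN
  have hseq (z : ℂ) :
      Tendsto (fun y : ℕ × ℂ => ((n y.1, N y.1), y.2)) (atTop ×ˢ 𝓝 z) (nearFilter t z) :=
    (isRatioSeq_iff.1 hnN).prodMap tendsto_id
  have hne : ∀ᶠ y in atTop ×ˢ 𝓝ˢ K, (T (n y.1) (N y.1)).eval y.2 ≠ 0 :=
    hK.mem_prod_nhdsSet_of_forall fun z hz => (hseq z).eventually (h z (hKS hz)).1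
  exact ⟨hne.curry.mono fun _ hi => hi.self_of_nhdsSet,
    (tendstoLocallyUniformlyOn_iff_tendstoUniformlyOn_of_compact hK).1
      (tendstoLocallyUniformlyOn_of_tendsto_prod_nhds fun z hz =>
        (h z (hKS hz)).2.comp (hseq z))⟩

end QuotientTendsto

/-- The value `Φ_{n,N}(z)` as a function of the triple `((n, N), z)`. -/
def opucVal (a : ℕ → ℕ → ℂ) (y : (ℕ × ℕ) × ℂ) : ℂ :=
  (opuc (fun m => a m y.1.2) y.1.1).eval y.2

/-- The value `Φ_{n,N}^*(z)` as a function of the triple `((n, N), z)`. -/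
def starVal (a : ℕ → ℕ → ℂ) (y : (ℕ × ℕ) × ℂ) : ℂ :=
  (opucStar (fun m => a m y.1.2) y.1.1).eval y.2

/-- The value `Φ_{n+1,N}^{(β)}(z)` as a function of the triple `((n, N), z)`; the index is shifted
because the paraorthogonal polynomials start at degree one. -/
def popucVal (a : ℕ → ℕ → ℂ) (β : ℂ) (y : (ℕ × ℕ) × ℂ) : ℂ :=
  (popuc (fun m => a m y.1.2) β (y.1.1 + 1)).eval y.2

theorem popucVal_eq (a : ℕ → ℕ → ℂ) (β : ℂ) (y : (ℕ × ℕ) × ℂ) :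
    popucVal a β y = y.2 * opucVal a y - conj β * starVal a y :=
  eval_popuc_succ _ _ _ _

theorem starVal_shift_one (a : ℕ → ℕ → ℂ) (y : (ℕ × ℕ) × ℂ) :
    starVal a (shift 1 y) = starVal a y - a y.1.1 y.1.2 * y.2 * opucVal a y :=
  eval_opucStar_succ _ _ _

/-- The Schur iterate `Φ_{n,N}(z) / Φ_{n,N}^*(z)` as a function of the triple `((n, N), z)`. -/
def schurVal (a : ℕ → ℕ → ℂ) (y : (ℕ × ℕ) × ℂ) : ℂ :=
  schurIterate (fun m => a m y.1.2) y.2 1 y.1.1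

section UnitDisk

variable {a : ℕ → ℕ → ℂ} (ha : ∀ n N, ‖a n N‖ < 1) {y : (ℕ × ℕ) × ℂ} (hy : ‖y.2‖ ≤ 1)

include ha hy

theorem starVal_ne_zero : starVal a y ≠ 0 := eval_opucStar_ne_zero (fun n => ha n _) hy _

theorem norm_schurVal_le : ‖schurVal a y‖ ≤ 1 :=
  norm_schurIterate_le (fun n => ha n _) hy norm_one.le _

theorem opucVal_eq_schurVal_mul : opucVal a y = schurVal a y * starVal a y :=
  eval_opuc_eq_schurIterate_mul (fun n => ha n _) hy _

theorem opucVal_div_starVal : opucVal a y / starVal a y = schurVal a y :=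
  (schurIterate_one_eq_div (fun n => ha n _) hy _).symm

theorem popucVal_eq_mul_starVal {β : ℂ} :
    popucVal a β y = (y.2 * schurVal a y - conj β) * starVal a y := by
  rw [popucVal_eq, opucVal_eq_schurVal_mul ha hy]
  ring

theorem starVal_shift_div (m : ℕ) : starVal a (shift m y) / starVal a y =
    ∏ j ∈ Finset.range m, (1 - a (y.1.1 + j) y.1.2 * y.2 * schurVal a (shift j y)) := by
  induction m with
  | zero => simpa [shift] using div_self (starVal_ne_zero ha hy)
  | succ m ih =>
    rw [Finset.prod_range_succ, ← ih, div_mul_eq_mul_div, mul_comm]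
    congr 1
    exact eval_opucStar_succ_eq_mul (fun n => ha n y.1.2) hy (y.1.1 + m)

end UnitDisk

/-! ### Convergence in the disk -/

theorem tendsto_prod_sub_prod {ι κ : Type*} {l : Filter ι} {u v : κ → ι → ℂ} (s : Finset κ)
    (hv : ∀ j, v j =O[l] (1 : ι → ℝ)) (h : ∀ j, Tendsto (fun i => u j i - v j i) l (𝓝 0)) :
    Tendsto (fun i => ∏ j ∈ s, u j i - ∏ j ∈ s, v j i) l (𝓝 0) := by
  classical
  simp only [← Asymptotics.isLittleO_one_iff ℝ] at h ⊢
  induction s using Finset.induction_on with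
  | empty => simp [tendsto_const_nhds]
  | insert j s hj ih =>
    have hu : u j =O[l] (1 : ι → ℝ) :=
      ((h j).isBigO.add (hv j)).congr_left fun _ => sub_add_cancel _ _
    have hprod : (fun i => ∏ j ∈ s, v j i) =O[l] (1 : ι → ℝ) :=
      (Asymptotics.IsBigO.finsetProd fun j _ => hv j).congr_right fun _ => by simp
    have hsum := (hu.mul_isLittleO ih).add ((h j).mul_isBigO hprod)
    simp only [Pi.one_apply, mul_one] at hsum
    refine hsum.congr_left fun i => ?_
    rw [Finset.prod_insert hj, Finset.prod_insert hj]
    ring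

section Disk

variable {p : ℕ} {α : ℕ → ℂ} {a : ℕ → ℕ → ℂ} {t : ℝ} {ζ : ℂ} (hp : 0 < p) (hα : ∀ n, ‖α n‖ < 1)
  (hper : Function.Periodic α p) (ha : ∀ n N, ‖a n N‖ < 1)
  (hlim : Tendsto (fun x : ℕ × ℕ => a x.1 x.2 - α x.1) (ratioFilter t) (𝓝 0)) (hζ : ‖ζ‖ < 1)

include hlim in
theorem tendsto_coeff_sub (m : ℕ) :
    Tendsto (fun y => a (y.1.1 + m) y.1.2 - α (y.1.1 + m)) (nearFilter t ζ) (𝓝 0) :=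
  hlim.comp (tendsto_fst_nearFilter.comp (tendsto_shift m))

include hα ha hlim hζ in
theorem tendsto_schurVal_shift_sub (m : ℕ) :
    Tendsto (fun y => schurVal a (shift m y) -
      schurIterate (fun j => α (y.1.1 + j)) y.2 (schurVal a y) m) (nearFilter t ζ) (𝓝 0) := by
  induction m with
  | zero => simpa [shift, schurIterate] using tendsto_const_nhds
  | succ m ih =>
    obtain ⟨r, hr, hr1⟩ := exists_between hζ
    have hbound : Tendsto (fun y => 2 * (‖a (y.1.1 + m) y.1.2 - α (y.1.1 + m)‖ +
        ‖schurVal a (shift m y) -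
          schurIterate (fun j => α (y.1.1 + j)) y.2 (schurVal a y) m‖) / (1 - r))
        (nearFilter t ζ) (𝓝 0) := by
      simpa using (((tendsto_coeff_sub hlim m).norm.add ih.norm).const_mul 2).div_const (1 - r)
    refine squeeze_zero_norm' ?_ hbound
    filter_upwards [eventually_norm_lt hr] with y hy
    have hy1 := hy.trans hr1
    refine (norm_schurStep_sub_schurStep_le (ha _ _).le (hα _) hy1
      (norm_schurVal_le ha (y := shift m y) hy1.le)
      (norm_schurIterate_le (fun j => hα _) hy1.le (norm_schurVal_le ha hy1.le) m)).trans ?_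
    exact div_le_div_of_nonneg_left (by positivity) (sub_pos.2 hr1) (sub_le_sub_left hy.le 1)

include hp hα hper ha hlim hζ

/-- Both sequences follow the same recurrence up to `o(1)`, and the iteration forgets its initial
value at a geometric rate. -/
theorem tendsto_schurVal_sub_periodicSchur :
    Tendsto (fun y => schurVal a y - periodicSchur p α y.2 y.1.1) (nearFilter t ζ) (𝓝 0) := by
  obtain ⟨r, hr, hr1⟩ := exists_between hζ
  have hr0 : 0 ≤ r := (norm_nonneg ζ).trans hr.le
  have hr2 : 0 < 1 - r ^ 2 := by nlinarith
  rw [NormedAddGroup.tendsto_nhds_zero]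
  intro ε hε
  obtain ⟨m, hm⟩ : ∃ m, 2 / (1 - r ^ 2) * r ^ m < ε / 2 := by
    have hgeom := (tendsto_pow_atTop_nhds_zero_of_lt_one hr0 hr1).const_mul (2 / (1 - r ^ 2))
    rw [mul_zero] at hgeom
    exact (hgeom.eventually_lt_const (half_pos hε)).exists
  refine eventually_of_eventually_shift m ?_
  filter_upwards [eventually_norm_lt hr, NormedAddGroup.tendsto_nhds_zero.1
    (tendsto_schurVal_shift_sub hα ha hlim hζ m) (ε / 2) (half_pos hε)] with y hy hym
  have hy1 := hy.trans hr1
  have hforget := norm_schurIterate_sub_le (α := fun j => α (y.1.1 + j)) (fun j => hα _) hy1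
    (norm_schurVal_le ha hy1.le) (norm_periodicSchur_le hp hα hper hy1 y.1.1) m
  rw [← periodicSchur_add hp hα hper hy1] at hforget
  have hrate : 2 / (1 - ‖y.2‖ ^ 2) * ‖y.2‖ ^ m ≤ 2 / (1 - r ^ 2) * r ^ m := by gcongr
  calc _ ≤ _ := norm_sub_le_norm_sub_add_norm_sub _ _ _
    _ < ε / 2 + ε / 2 := add_lt_add hym (hforget.trans_lt (hrate.trans_lt hm))
    _ = ε := add_halves ε

theorem tendsto_schurVal_shift_sub_schurVal :
    Tendsto (fun y => schurVal a (shift p y) - schurVal a y) (nearFilter t ζ) (𝓝 0) := by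
  have h := tendsto_schurVal_sub_periodicSchur hp hα hper ha hlim hζ
  have hsub := (h.comp (tendsto_shift p)).sub h
  rw [sub_zero] at hsub
  refine hsub.congr' ?_
  filter_upwards [eventually_norm_lt hζ] with y hy
  rw [Function.comp_apply, show periodicSchur p α (shift p y).2 (shift p y).1.1 =
    periodicSchur p α y.2 y.1.1 from periodic_periodicSchur hp hα hper hy y.1.1]
  ring

theorem tendsto_one_sub_mul_schurVal_sub (j : ℕ) :
    Tendsto (fun y => (1 - a (y.1.1 + j) y.1.2 * y.2 * schurVal a (shift j y)) -
      (1 - α (y.1.1 + j) * y.2 * periodicSchur p α y.2 (y.1.1 + j))) (nearFilter t ζ) (𝓝 0) := by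
  have hcoeff := tendsto_coeff_sub (ζ := ζ) hlim j
  have hschur := (tendsto_schurVal_sub_periodicSchur hp hα hper ha hlim hζ).comp (tendsto_shift j)
  refine squeeze_zero_norm' ?_ (a := fun y => ‖a (y.1.1 + j) y.1.2 - α (y.1.1 + j)‖ +
    ‖schurVal a (shift j y) - periodicSchur p α y.2 (y.1.1 + j)‖)
    (by simpa [shift] using hcoeff.norm.add hschur.norm)
  filter_upwards [eventually_norm_lt hζ] with y hy
  have hf : ‖y.2 * schurVal a (shift j y)‖ ≤ 1 :=
    norm_mul_le_one hy.le (norm_schurVal_le ha (y := shift j y) hy.le)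
  have hαz : ‖α (y.1.1 + j) * y.2‖ ≤ 1 := norm_mul_le_one (hα _).le hy.le
  calc _ = ‖(a (y.1.1 + j) y.1.2 - α (y.1.1 + j)) * (y.2 * schurVal a (shift j y)) +
        α (y.1.1 + j) * y.2 * (schurVal a (shift j y) - periodicSchur p α y.2 (y.1.1 + j))‖ := by
        rw [← norm_neg]
        congr 1
        ring
    _ ≤ _ := by
        refine (norm_add_le _ _).trans ?_
        rw [norm_mul, norm_mul _ (schurVal a (shift j y) - _)]
        exact add_le_add (mul_le_of_le_one_right (norm_nonneg _) hf)
          (mul_le_of_le_one_left (norm_nonneg _) hαz)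

omit ha hlim in
theorem continuousAt_gDelta : ContinuousAt (gDelta p α) ζ := by
  have hball : Metric.ball (0 : ℂ) 1 ∈ 𝓝 ζ :=
    Metric.isOpen_ball.mem_nhds (mem_ball_zero_iff.2 hζ)
  refine (ContinuousOn.congr (continuousOn_finsetProd (Finset.range p) fun j _ => ?_) fun z hz =>
    gDelta_eq_prod hp hα hper (mem_ball_zero_iff.1 hz)).continuousAt hball
  exact continuousOn_const.sub
    ((continuousOn_const.mul continuousOn_id).mul (continuousOn_periodicSchur hp hα hper j))

theorem quotientTendsto_starVal_disk :
    QuotientTendsto t p (starVal a) ζ (gDelta p α ζ) := by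
  have hdisk := eventually_norm_lt (t := t) hζ
  refine ⟨hdisk.mono fun y hy => starVal_ne_zero ha hy.le, ?_⟩
  have hbdd (j : ℕ) : (fun y : (ℕ × ℕ) × ℂ =>
      1 - α (y.1.1 + j) * y.2 * periodicSchur p α y.2 (y.1.1 + j)) =O[nearFilter t ζ]
        (1 : (ℕ × ℕ) × ℂ → ℝ) := by
    refine Asymptotics.IsBigO.of_bound 2 ?_
    filter_upwards [hdisk] with y hy
    have hle := norm_mul_le_one (norm_mul_le_one (hα (y.1.1 + j)).le hy.le)
      (norm_periodicSchur_le hp hα hper hy (y.1.1 + j))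
    simpa using (norm_sub_le _ _).trans (add_le_add norm_one.le hle) |>.trans one_add_one_eq_two.le
  have hprod := (tendsto_prod_sub_prod (Finset.range p) hbdd
    (tendsto_one_sub_mul_schurVal_sub hp hα hper ha hlim hζ)).add
      ((continuousAt_gDelta hp hα hper hζ).tendsto.comp tendsto_snd_nearFilter)
  rw [zero_add] at hprod
  refine hprod.congr' ?_
  filter_upwards [hdisk] with y hy
  rw [starVal_shift_div ha hy.le, Function.comp_apply, gDelta_eq_prod_add hp hα hper hy y.1.1,
    sub_add_cancel]

theorem quotientTendsto_popucVal_disk {β : ℂ} (hβ : ‖β‖ = 1) :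
    QuotientTendsto t p (popucVal a β) ζ (gDelta p α ζ) := by
  have hdisk := eventually_norm_lt (t := t) hζ
  refine (quotientTendsto_starVal_disk hp hα hper ha hlim hζ).of_tendsto_sub ?_ ?_
  · have h := tendsto_snd_nearFilter.mul
      (tendsto_schurVal_shift_sub_schurVal hp hα hper ha hlim hζ)
    rw [mul_zero] at h
    refine h.congr' ?_
    filter_upwards [hdisk, (tendsto_shift p).eventually hdisk] with y hy hy'
    rw [popucVal_eq_mul_starVal ha hy.le, popucVal_eq_mul_starVal ha hy'.le,
      mul_div_cancel_right₀ _ (starVal_ne_zero ha hy.le),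
      mul_div_cancel_right₀ _ (starVal_ne_zero ha hy'.le)]
    simp only [shift]
    ring
  · obtain ⟨r, hr, hr1⟩ := exists_between hζ
    refine Asymptotics.IsBigO.of_bound (1 - r)⁻¹ ?_
    filter_upwards [eventually_norm_lt hr] with y hy
    have hy1 := (hy.trans hr1).le
    have hlow : 1 - r ≤ ‖y.2 * schurVal a y - conj β‖ := by
      have h1 : ‖y.2 * schurVal a y‖ ≤ r := by
        rw [norm_mul]
        exact (mul_le_of_le_one_right (norm_nonneg _) (norm_schurVal_le ha hy1)).trans hy.le
      have h2 := norm_sub_norm_le (conj β) (y.2 * schurVal a y)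
      rw [RCLike.norm_conj, hβ, norm_sub_rev] at h2
      linarith
    rw [popucVal_eq_mul_starVal ha hy1, norm_mul, ← mul_assoc]
    exact le_mul_of_one_le_left (norm_nonneg _)
      ((one_le_inv_mul₀ (sub_pos.2 hr1)).2 hlow)

omit ha hlim in
theorem exists_le_norm_periodicSchur (hne : ∀ n, periodicSchur p α ζ n ≠ 0) :
    ∃ c > 0, ∀ᶠ z in 𝓝 ζ, ∀ n, c ≤ ‖periodicSchur p α z n‖ := by
  have hball : Metric.ball (0 : ℂ) 1 ∈ 𝓝 ζ :=
    Metric.isOpen_ball.mem_nhds (mem_ball_zero_iff.2 hζ)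
  obtain ⟨j₀, -, hj₀⟩ := (Finset.range p).exists_min_image (fun n => ‖periodicSchur p α ζ n‖)
    ⟨0, Finset.mem_range.2 hp⟩
  have hc := norm_pos_iff.2 (hne j₀)
  refine ⟨_, half_pos hc, ?_⟩
  have hall : ∀ᶠ z in 𝓝 ζ, ∀ n ∈ Finset.range p,
      ‖periodicSchur p α ζ j₀‖ / 2 < ‖periodicSchur p α z n‖ :=
    (Filter.eventually_all_finset _).2 fun n hn =>
      ((continuousOn_periodicSchur hp hα hper n).continuousAt hball).norm.eventually_const_lt
        ((half_lt_self hc).trans_le (hj₀ n hn))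
  filter_upwards [hall, hball] with z hz hz1 n
  rw [← (periodic_periodicSchur hp hα hper (mem_ball_zero_iff.1 hz1)).map_mod_nat]
  exact (hz _ (Finset.mem_range.2 (Nat.mod_lt n hp))).le

theorem quotientTendsto_opucVal_disk (hne : ∀ n, periodicSchur p α ζ n ≠ 0) :
    QuotientTendsto t p (opucVal a) ζ (gDelta p α ζ) := by
  have hdisk := eventually_norm_lt (t := t) hζ
  refine (quotientTendsto_starVal_disk hp hα hper ha hlim hζ).of_tendsto_sub ?_ ?_
  · refine (tendsto_schurVal_shift_sub_schurVal hp hα hper ha hlim hζ).congr' ?_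
    filter_upwards [hdisk, (tendsto_shift p).eventually hdisk] with y hy hy'
    rw [opucVal_div_starVal ha hy.le, opucVal_div_starVal ha hy'.le]
  · obtain ⟨c, hc, hlow⟩ := exists_le_norm_periodicSchur hp hα hper hζ hne
    refine Asymptotics.IsBigO.of_bound (c / 2)⁻¹ ?_
    filter_upwards [hdisk, tendsto_snd_nearFilter.eventually hlow,
      NormedAddGroup.tendsto_nhds_zero.1
        (tendsto_schurVal_sub_periodicSchur hp hα hper ha hlim hζ) (c / 2) (half_pos hc)]
      with y hy hyc hsub
    have hf : c / 2 ≤ ‖schurVal a y‖ := by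
      have := norm_sub_norm_le (periodicSchur p α y.2 y.1.1) (schurVal a y)
      rw [norm_sub_rev] at this
      linarith [hyc y.1.1]
    rw [opucVal_eq_schurVal_mul ha hy.le, norm_mul, ← mul_assoc]
    exact le_mul_of_one_le_left (norm_nonneg _) ((one_le_inv_mul₀ (half_pos hc)).2 hf)

end Disk

/-! ### Convergence in the exterior of the disk -/

theorem opucVal_eq_mul_inv (a : ℕ → ℕ → ℂ) {y : (ℕ × ℕ) × ℂ} (hy : y.2 ≠ 0) :
    opucVal a y = y.2 ^ y.1.1 * starVal (fun n N => conj (a n N)) (y.1, y.2⁻¹) :=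
  eval_opuc_inv _ hy _

theorem starVal_eq_mul_inv (a : ℕ → ℕ → ℂ) {y : (ℕ × ℕ) × ℂ} (hy : y.2 ≠ 0) :
    starVal a y = y.2 ^ y.1.1 * opucVal (fun n N => conj (a n N)) (y.1, y.2⁻¹) :=
  eval_opucStar_inv _ hy _

theorem popucVal_eq_mul_inv (a : ℕ → ℕ → ℂ) {β : ℂ} (hβ : ‖β‖ = 1) {y : (ℕ × ℕ) × ℂ}
    (hy : y.2 ≠ 0) : popucVal a β y =
      -conj β * y.2 ^ (y.1.1 + 1) * popucVal (fun n N => conj (a n N)) (conj β) (y.1, y.2⁻¹) :=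
  eval_popuc_succ_inv _ hβ hy _

section Exterior

variable {p : ℕ} {α : ℕ → ℂ} {a : ℕ → ℕ → ℂ} {t : ℝ} {ζ : ℂ} (hp : 0 < p) (hα : ∀ n, ‖α n‖ < 1)
  (hper : Function.Periodic α p) (ha : ∀ n N, ‖a n N‖ < 1)
  (hlim : Tendsto (fun x : ℕ × ℕ => a x.1 x.2 - α x.1) (ratioFilter t) (𝓝 0)) (hζ : 1 < ‖ζ‖)

include hlim in
theorem tendsto_conj_sub :
    Tendsto (fun x : ℕ × ℕ => conj (a x.1 x.2) - conj (α x.1)) (ratioFilter t) (𝓝 0) := by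
  simpa [Function.comp_def] using (Complex.continuous_conj.tendsto 0).comp hlim

include hp hα hper ha hlim hζ

theorem quotientTendsto_popucVal_exterior {β : ℂ} (hβ : ‖β‖ = 1) :
    QuotientTendsto t p (popucVal a β) ζ (gDelta p α ζ) := by
  have hζ0 : ζ ≠ 0 := norm_pos_iff.1 (one_pos.trans hζ)
  have hβ0 : β ≠ 0 := norm_ne_zero_iff.1 (hβ ▸ one_ne_zero)
  rw [gDelta_eq_pow_mul hp hα hper hζ]
  refine QuotientTendsto.of_inv (c := fun z => -conj β * z)
    (fun z hz => mul_ne_zero (neg_ne_zero.2 (by simpa using hβ0)) hz) (fun y hy => ?_) hζ0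
    (quotientTendsto_popucVal_disk (a := fun n N => conj (a n N)) (α := fun j => conj (α j))
      hp (fun n => by simpa using hα n)
      (hper.comp conj)
      (fun n N => by simpa using ha n N) (tendsto_conj_sub hlim)
      (by simpa using inv_lt_one_of_one_lt₀ hζ) (β := conj β) (by simpa using hβ))
  rw [popucVal_eq_mul_inv a hβ hy]
  ring

theorem quotientTendsto_opucVal_exterior :
    QuotientTendsto t p (opucVal a) ζ (gDelta p α ζ) := by
  rw [gDelta_eq_pow_mul hp hα hper hζ]
  refine QuotientTendsto.of_inv (c := 1) (fun _ _ => one_ne_zero)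
    (fun y hy => by simpa using opucVal_eq_mul_inv a hy) (norm_pos_iff.1 (one_pos.trans hζ))
    (quotientTendsto_starVal_disk (α := fun j => conj (α j)) hp (fun n => by simpa using hα n)
      (hper.comp conj)
      (fun n N => by simpa using ha n N) (tendsto_conj_sub hlim)
      (by simpa using inv_lt_one_of_one_lt₀ hζ))

theorem quotientTendsto_starVal_exterior
    (hne : ∀ n, periodicSchur p (fun j => conj (α j)) ζ⁻¹ n ≠ 0) :
    QuotientTendsto t p (starVal a) ζ (gDelta p α ζ) := by
  rw [gDelta_eq_pow_mul hp hα hper hζ]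
  refine QuotientTendsto.of_inv (c := 1) (fun _ _ => one_ne_zero)
    (fun y hy => by simpa using starVal_eq_mul_inv a hy) (norm_pos_iff.1 (one_pos.trans hζ))
    (quotientTendsto_opucVal_disk (α := fun j => conj (α j)) hp (fun n => by simpa using hα n)
      (hper.comp conj)
      (fun n N => by simpa using ha n N) (tendsto_conj_sub hlim)
      (by simpa using inv_lt_one_of_one_lt₀ hζ) hne)

end Exterior

/-! ### Bounds near a zero-free arc of the unit circle -/

section CircleBounds

variable {α : ℕ → ℂ} {β z ζ : ℂ} {s : ℝ}

theorem eval_opuc_ne_zero (hα : ∀ n, ‖α n‖ < 1) (hz : 1 ≤ ‖z‖) (n : ℕ) :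
    (opuc α n).eval z ≠ 0 := by
  have hz0 : z ≠ 0 := norm_pos_iff.1 (one_pos.trans_le hz)
  rw [eval_opuc_inv α hz0]
  exact mul_ne_zero (pow_ne_zero n hz0) (eval_opucStar_ne_zero (fun n => by simpa using hα n)
    (by simpa using inv_le_one_of_one_le₀ hz) n)

theorem norm_eval_opucStar_le (hα : ∀ n, ‖α n‖ < 1) (hz : 1 ≤ ‖z‖) (n : ℕ) :
    ‖(opucStar α n).eval z‖ ≤ ‖(opuc α n).eval z‖ := by
  have hz0 : z ≠ 0 := norm_pos_iff.1 (one_pos.trans_le hz)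
  rw [eval_opuc_inv α hz0, eval_opucStar_inv α hz0, norm_mul, norm_mul]
  gcongr
  exact norm_eval_opuc_le (fun n => by simpa using hα n)
    (by simpa using inv_le_one_of_one_le₀ hz) n

theorem abs_norm_sub_one_mul_le (hα : ∀ n, ‖α n‖ < 1) (hβ : ‖β‖ = 1) (z : ℂ) (n : ℕ) :
    |‖z‖ - 1| * ‖(opucStar α n).eval z‖ ≤ ‖(popuc α β (n + 1)).eval z‖ := by
  have hle := abs_norm_sub_norm_le (z * (opuc α n).eval z) (conj β * (opucStar α n).eval z)
  rw [← eval_popuc_succ, norm_mul, norm_mul, RCLike.norm_conj, hβ, one_mul] at hle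
  rcases le_total ‖z‖ 1 with hz | hz
  · have := norm_eval_opuc_le hα hz n
    rw [abs_of_nonpos (sub_nonpos.2 hz)]
    nlinarith [neg_le_abs (‖z‖ * ‖(opuc α n).eval z‖ - ‖(opucStar α n).eval z‖), norm_nonneg z]
  · have := norm_eval_opucStar_le hα hz n
    rw [abs_of_nonneg (sub_nonneg.2 hz)]
    nlinarith [le_abs_self (‖z‖ * ‖(opuc α n).eval z‖ - ‖(opucStar α n).eval z‖), norm_nonneg z]

theorem eval_popuc_succ_ne_zero (hα : ∀ n, ‖α n‖ < 1) (hβ : ‖β‖ = 1) (hz : ‖z‖ ≠ 1) (n : ℕ) :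
    (popuc α β (n + 1)).eval z ≠ 0 := by
  intro h
  have hle := abs_norm_sub_one_mul_le hα hβ z n
  rw [h, norm_zero] at hle
  have hstar : (opucStar α n).eval z = 0 := norm_le_zero_iff.1
    (nonpos_of_mul_nonpos_right hle (abs_pos.2 (sub_ne_zero.2 hz)))
  rcases hz.lt_or_gt with hlt | hgt
  · exact eval_opucStar_ne_zero hα hlt.le n hstar
  · rw [eval_popuc_succ, hstar, mul_zero, sub_zero] at h
    exact mul_ne_zero (norm_pos_iff.1 (one_pos.trans hgt)) (eval_opuc_ne_zero hα hgt.le n) h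

theorem norm_sq_sub_one_eq (hζ : ‖ζ‖ = 1) (w : ℂ) : ((‖w‖ ^ 2 - 1 : ℝ) : ℂ) =
    conj ζ * (w - ζ) + conj (conj ζ * (w - ζ)) + ‖conj ζ * (w - ζ)‖ ^ 2 := by
  have hconj : ζ * conj ζ = 1 := by rw [Complex.mul_conj', hζ, Complex.ofReal_one, one_pow]
  rw [← Complex.mul_conj']
  push_cast
  rw [← Complex.mul_conj']
  simp only [map_mul, map_sub, Complex.conj_conj]
  linear_combination (1 - (w - ζ) * (conj w - conj ζ)) * hconj

/-- Maximum principle for `F q`, where `q = u ^ 2 + s ^ 2 * u + s ^ 2` with `u = conj ζ * (w - ζ)`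
equals `u * (‖w‖ ^ 2 - 1)` on the circle `‖u‖ = s`. -/
theorem norm_le_of_norm_mul_abs_le {F : ℂ → ℂ} {C : ℝ} (hζ : ‖ζ‖ = 1) (hs0 : 0 < s)
    (hs : s ≤ 1 / 2) (hF : DifferentiableOn ℂ F (Metric.closedBall ζ s))
    (hC : ∀ w ∈ Metric.sphere ζ s, ‖F w‖ * |‖w‖ ^ 2 - 1| ≤ C)
    (hz : z ∈ Metric.closedBall ζ (s / 2)) : ‖F z‖ ≤ 2 * C / s := by
  let u : ℂ → ℂ := fun w => conj ζ * (w - ζ)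
  have hu (w : ℂ) : ‖u w‖ = dist w ζ := by simp [u, hζ, dist_eq_norm]
  let q : ℂ → ℂ := fun w => u w ^ 2 + s ^ 2 * u w + s ^ 2
  have hq : Differentiable ℂ q := by fun_prop
  have hsphere (w : ℂ) (hw : w ∈ Metric.sphere ζ s) : ‖F w * q w‖ ≤ s * C := by
    have hus : ‖u w‖ = s := (hu w).trans hw
    have hss : u w * conj (u w) = s ^ 2 := by rw [Complex.mul_conj', hus]
    have hqw : q w = u w * ((‖w‖ ^ 2 - 1 : ℝ) : ℂ) := by
      rw [norm_sq_sub_one_eq hζ, show ‖conj ζ * (w - ζ)‖ = s from hus]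
      linear_combination -hss
    rw [hqw, norm_mul, norm_mul, hus, Complex.norm_real, Real.norm_eq_abs]
    nlinarith [hC w hw]
  have hmax : ‖F z * q z‖ ≤ s * C := by
    refine Complex.norm_le_of_forall_mem_frontier_norm_le (f := fun w => F w * q w)
      Metric.isBounded_ball (DifferentiableOn.diffContOnCl ?_)
      (fun w hw => hsphere w (by rwa [← frontier_ball ζ hs0.ne']))
      (closure_ball ζ hs0.ne' ▸ Metric.closedBall_subset_closedBall (half_le_self hs0.le) hz)
    rw [closure_ball ζ hs0.ne']
    exact hF.mul hq.differentiableOn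
  have hqz : s ^ 2 / 2 ≤ ‖q z‖ := by
    have huz : ‖u z‖ ≤ s / 2 := (hu z).trans_le hz
    have hlow := norm_sub_norm_le ((s : ℂ) ^ 2) (-(u z ^ 2 + s ^ 2 * u z))
    have hup := norm_add_le (u z ^ 2) (s ^ 2 * u z)
    rw [norm_neg, sub_neg_eq_add, add_comm ((s : ℂ) ^ 2)] at hlow
    simp only [norm_mul, norm_pow, Complex.norm_real, Real.norm_of_nonneg hs0.le] at hlow hup
    nlinarith [norm_nonneg (u z)]
  rw [norm_mul] at hmax
  rw [le_div_iff₀ hs0]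
  nlinarith [norm_nonneg (F z)]

variable (hα : ∀ n, ‖α n‖ < 1) (hβ : ‖β‖ = 1) (hζ : ‖ζ‖ = 1) (hs0 : 0 < s) (hs : s ≤ 1 / 2) {n : ℕ}
  (hne : ∀ w ∈ Metric.closedBall ζ s, (popuc α β (n + 1)).eval w ≠ 0)

include hα hβ hζ hs0 hs hne

theorem norm_opucStar_div_popuc_le (hz : z ∈ Metric.closedBall ζ (s / 2)) :
    ‖(opucStar α n).eval z / (popuc α β (n + 1)).eval z‖ ≤ 6 / s := by
  refine (norm_le_of_norm_mul_abs_le (C := 3) (F := fun w => (opucStar α n).eval w /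
    (popuc α β (n + 1)).eval w) hζ hs0 hs ?_ (fun w hw => ?_) hz).trans_eq (by norm_num)
  · exact (Polynomial.differentiable _).differentiableOn.div
      (Polynomial.differentiable _).differentiableOn hne
  · have hpos := norm_pos_iff.2 (hne w (Metric.sphere_subset_closedBall hw))
    have hw1 : ‖w‖ ≤ 2 := by
      have := norm_le_norm_add_norm_sub ζ w
      rw [← dist_eq_norm', Metric.mem_sphere.1 hw, hζ] at this
      linarith
    rw [norm_div, div_mul_eq_mul_div, div_le_iff₀ hpos,
      show ‖w‖ ^ 2 - 1 = (‖w‖ - 1) * (‖w‖ + 1) by ring, abs_mul,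
      abs_of_nonneg (by positivity : 0 ≤ ‖w‖ + 1)]
    nlinarith [abs_norm_sub_one_mul_le hα hβ w n, norm_nonneg w]

theorem norm_opucStar_div_popuc_sub_le (hz : z ∈ Metric.ball ζ (s ^ 2 / 96)) :
    ‖(opucStar α n).eval z / (popuc α β (n + 1)).eval z -
      (opucStar α n).eval ζ / (popuc α β (n + 1)).eval ζ‖ ≤ 1 / 4 := by
  have hball : Metric.ball ζ (s / 2) ⊆ Metric.closedBall ζ (s / 2) := Metric.ball_subset_closedBall
  have hbound := fun w hw => norm_opucStar_div_popuc_le hα hβ hζ hs0 hs hne (z := w) hw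
  have hζs : ζ ∈ Metric.closedBall ζ (s / 2) := Metric.mem_closedBall_self (by positivity)
  have hlip := Complex.dist_le_div_mul_dist_of_mapsTo_ball (R₁ := s / 2) (R₂ := 12 / s) (z := z)
    (f := fun w => (opucStar α n).eval w / (popuc α β (n + 1)).eval w) (c := ζ)
    ((Polynomial.differentiable _).differentiableOn.div
      (Polynomial.differentiable _).differentiableOn fun w hw =>
        hne w (Metric.closedBall_subset_closedBall (half_le_self hs0.le) (hball hw)))
    (fun w hw => ?_) (Metric.ball_subset_ball (by nlinarith) hz)
  · rw [dist_eq_norm] at hlip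
    calc _ ≤ 12 / s / (s / 2) * dist z ζ := hlip
      _ ≤ 12 / s / (s / 2) * (s ^ 2 / 96) := by gcongr; exact (Metric.mem_ball.1 hz).le
      _ = 1 / 4 := by field_simp; norm_num
  · rw [mem_closedBall_iff_norm]
    exact (norm_sub_le_of_le (hbound w (hball hw)) (hbound ζ hζs)).trans_eq (by ring)

/-- On the circle `‖Φ_n‖ = ‖Φ_n^*‖`, so `g = Φ_n^* / Φ_{n+1}^{(β)}` and
`z Φ_n / Φ_{n+1}^{(β)} = 1 + conj β * g` have the same modulus at `ζ`. -/
theorem norm_popuc_le_of_mem_ball (hz : z ∈ Metric.ball ζ (s ^ 2 / 96)) :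
    ‖(popuc α β (n + 1)).eval z‖ ≤ 4 * ‖(opucStar α n).eval z‖ ∧
      ‖(popuc α β (n + 1)).eval z‖ ≤ 4 * ‖z * (opuc α n).eval z‖ := by
  let g : ℂ → ℂ := fun w => (opucStar α n).eval w / (popuc α β (n + 1)).eval w
  have hopuc (w : ℂ) (hw : w ∈ Metric.closedBall ζ s) :
      w * (opuc α n).eval w / (popuc α β (n + 1)).eval w = 1 + conj β * g w := by
    rw [show w * (opuc α n).eval w = (popuc α β (n + 1)).eval w + conj β * (opucStar α n).eval w by
      rw [eval_popuc_succ, sub_add_cancel], add_div, div_self (hne w hw), mul_div_assoc]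
  have hzs : z ∈ Metric.closedBall ζ s :=
    Metric.ball_subset_closedBall (Metric.ball_subset_ball (by nlinarith) hz)
  have hζs : ζ ∈ Metric.closedBall ζ s := Metric.mem_closedBall_self hs0.le
  have heq : ‖1 + conj β * g ζ‖ = ‖g ζ‖ := by
    rw [← hopuc ζ hζs, norm_div, norm_mul, hζ, one_mul, norm_div,
      (norm_eval_opuc_le hα hζ.le n).antisymm (norm_eval_opucStar_le hα hζ.ge n)]
  have hgζ : 1 / 2 ≤ ‖g ζ‖ := by
    have htri := norm_sub_le (1 + conj β * g ζ) (conj β * g ζ)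
    rw [add_sub_cancel_right, norm_one, heq, norm_mul, RCLike.norm_conj, hβ] at htri
    linarith
  have hlip : ‖g z - g ζ‖ ≤ 1 / 4 := norm_opucStar_div_popuc_sub_le hα hβ hζ hs0 hs hne hz
  have hstar : 1 / 4 ≤ ‖g z‖ := by
    linarith [norm_sub_norm_le (g ζ) (g z), norm_sub_rev (g ζ) (g z)]
  have hone : 1 / 4 ≤ ‖1 + conj β * g z‖ := by
    have htri := norm_sub_norm_le (1 + conj β * g ζ) (1 + conj β * g z)
    rw [add_sub_add_left_eq_sub, ← mul_sub, norm_mul, RCLike.norm_conj, hβ, one_mul, heq,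
      norm_sub_rev] at htri
    linarith
  have hpos := norm_pos_iff.2 (hne z hzs)
  rw [← hopuc z hzs, norm_div, le_div_iff₀ hpos] at hone
  rw [norm_div, le_div_iff₀ hpos] at hstar
  exact ⟨by linarith, by linarith⟩

end CircleBounds

section Circle

variable {a : ℕ → ℕ → ℂ} {t : ℝ} {β ζ : ℂ} (ha : ∀ n N, ‖a n N‖ < 1) (hβ : ‖β‖ = 1)
  (hζ : ‖ζ‖ = 1) (hΛ : ζ ∉ limitZeros a t β)

include hζ hΛ in
theorem eventually_notMem_popucZeros :
    ∀ᶠ y in nearFilter t ζ, y.2 ∉ popucZeros a β y.1.1 y.1.2 := by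
  have : (nearFilter t ζ).IsCountablyGenerated := by
    unfold nearFilter
    infer_instance
  by_contra hfreq
  obtain ⟨y, hy, hy0⟩ := exists_seq_forall_of_frequently (not_eventually.1 hfreq)
  refine hΛ ⟨hζ, fun i => (y i).1.1, fun i => (y i).1.2,
    isRatioSeq_iff.2 (tendsto_fst_nearFilter.comp hy), Tendsto.liminf_eq ?_⟩
  have hdist : Tendsto (fun i => edist ζ (y i).2) atTop (𝓝 0) := by
    rw [← edist_self ζ]
    exact tendsto_const_nhds.edist (tendsto_snd_nearFilter.comp hy)
  exact tendsto_of_tendsto_of_tendsto_of_le_of_le tendsto_const_nhds hdist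
    (fun _ => zero_le) fun i => Metric.infEDist_le_edist_of_mem (not_not.1 (hy0 i))

include ha hβ hζ hΛ

theorem eventually_popucVal_ne_zero : ∀ᶠ y in nearFilter t ζ, popucVal a β y ≠ 0 := by
  filter_upwards [(tendsto_shift 1).eventually (eventually_notMem_popucZeros hζ hΛ)] with y hy h0
  exact hy ⟨not_not.1 fun hne => eval_popuc_succ_ne_zero (fun n => ha n _) hβ hne _ h0, h0⟩

theorem exists_popuc_ne_zero_on_closedBall : ∃ s, 0 < s ∧ s ≤ 1 / 2 ∧
    ∀ᶠ x in ratioFilter t, ∀ w ∈ Metric.closedBall ζ s,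
      (popuc (fun m => a m x.2) β (x.1 + 1)).eval w ≠ 0 := by
  obtain ⟨A, hA, B, hB, hAB⟩ :=
    eventually_prod_iff.1 (eventually_popucVal_ne_zero ha hβ hζ hΛ)
  obtain ⟨s, hs, hsB⟩ := Metric.nhds_basis_closedBall.eventually_iff.1 hB
  refine ⟨min s (1 / 2), by positivity, min_le_right _ _, hA.mono fun x hx w hw => hAB hx (hsB ?_)⟩
  exact Metric.closedBall_subset_closedBall (min_le_left _ _) hw

theorem starVal_isBigO_popucVal : starVal a =O[nearFilter t ζ] popucVal a β := by
  obtain ⟨s, hs0, hs, hne⟩ := exists_popuc_ne_zero_on_closedBall ha hβ hζ hΛ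
  refine Asymptotics.IsBigO.of_bound (6 / s) ?_
  filter_upwards [hne.prod_mk (Metric.closedBall_mem_nhds ζ (half_pos hs0))] with y hy
  have hle := norm_opucStar_div_popuc_le (fun n => ha n y.1.2) hβ hζ hs0 hs hy.1 hy.2
  rwa [norm_div, div_le_iff₀ (norm_pos_iff.2 (hy.1 y.2
    (Metric.closedBall_subset_closedBall (half_le_self hs0.le) hy.2)))] at hle

theorem eventually_norm_popucVal_le : ∀ᶠ y in nearFilter t ζ,
    ‖popucVal a β y‖ ≤ 4 * ‖starVal a y‖ ∧ ‖popucVal a β y‖ ≤ 4 * ‖y.2 * opucVal a y‖ := by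
  obtain ⟨s, hs0, hs, hne⟩ := exists_popuc_ne_zero_on_closedBall ha hβ hζ hΛ
  filter_upwards [hne.prod_mk (Metric.ball_mem_nhds ζ (by positivity : 0 < s ^ 2 / 96))] with y hy
  exact norm_popuc_le_of_mem_ball (fun n => ha n y.1.2) hβ hζ hs0 hs hy.1 hy.2

theorem popucVal_isBigO_starVal : popucVal a β =O[nearFilter t ζ] starVal a :=
  Asymptotics.IsBigO.of_bound 4 ((eventually_norm_popucVal_le ha hβ hζ hΛ).mono fun _ hy => hy.1)

theorem starVal_isBigO_opucVal : starVal a =O[nearFilter t ζ] opucVal a := by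
  have hsnd : (fun y : (ℕ × ℕ) × ℂ => y.2) =O[nearFilter t ζ] (1 : (ℕ × ℕ) × ℂ → ℂ) :=
    tendsto_snd_nearFilter.isBigO_one ℂ
  have hpopuc : popucVal a β =O[nearFilter t ζ] fun y => y.2 * opucVal a y :=
    Asymptotics.IsBigO.of_bound 4 ((eventually_norm_popucVal_le ha hβ hζ hΛ).mono fun _ hy => hy.2)
  refine (starVal_isBigO_popucVal ha hβ hζ hΛ).trans (hpopuc.trans ?_)
  simpa using hsnd.mul (Asymptotics.isBigO_refl (opucVal a) _)

theorem opucVal_isBigO_starVal : opucVal a =O[nearFilter t ζ] starVal a := by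
  have hζ0 : ζ ≠ 0 := norm_ne_zero_iff.1 (hζ ▸ one_ne_zero)
  have hinv : (fun y : (ℕ × ℕ) × ℂ => y.2⁻¹) =O[nearFilter t ζ] (1 : (ℕ × ℕ) × ℂ → ℂ) :=
    (tendsto_snd_nearFilter.inv₀ hζ0).isBigO_one ℂ
  have hmul : (fun y => y.2 * opucVal a y) =O[nearFilter t ζ] starVal a := by
    refine ((popucVal_isBigO_starVal ha hβ hζ hΛ).add
      ((Asymptotics.isBigO_refl (starVal a) _).const_mul_left (conj β))).congr_left fun y => ?_
    rw [popucVal_eq, sub_add_cancel]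
  refine (hinv.mul hmul).congr' ?_ (by simp)
  filter_upwards [tendsto_snd_nearFilter.eventually_ne hζ0] with y hy
  exact inv_mul_cancel_left₀ hy _

theorem eventually_starVal_ne_zero : ∀ᶠ y in nearFilter t ζ, starVal a y ≠ 0 := by
  filter_upwards [eventually_popucVal_ne_zero ha hβ hζ hΛ,
    (popucVal_isBigO_starVal ha hβ hζ hΛ).eq_zero_imp] with y hy himp h0 using hy (himp h0)

end Circle

/-! ### Vitali's theorem -/

section Vitali

variable {ι : Type*} {l : Filter ι} {U : Set ℂ}

theorem tendstoLocallyUniformlyOn_iteratedDeriv {F : ι → ℂ → ℂ} {G : ℂ → ℂ} (hU : IsOpen U)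
    (hF : ∀ᶠ i in l, DifferentiableOn ℂ (F i) U) (h : TendstoLocallyUniformlyOn F G l U) (n : ℕ) :
    TendstoLocallyUniformlyOn (fun i => iteratedDeriv n (F i)) (iteratedDeriv n G) l U := by
  suffices (∀ᶠ i in l, DifferentiableOn ℂ (iteratedDeriv n (F i)) U) ∧
    TendstoLocallyUniformlyOn (fun i => iteratedDeriv n (F i)) (iteratedDeriv n G) l U from this.2
  induction n with
  | zero => simpa only [iteratedDeriv_zero] using ⟨hF, h⟩
  | succ n ih =>
    simp only [iteratedDeriv_succ]
    exact ⟨ih.1.mono fun i hi => hi.deriv hU, ih.2.deriv ih.1 hU⟩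

variable {F : ι × ℂ → ℂ} {c z ζ : ℂ} {R M : ℝ}

theorem tendsto_tsum_taylor {d : ℕ → ℂ}
    (hF : ∀ᶠ i in l, DifferentiableOn ℂ (fun w => F (i, w)) (Metric.ball c R))
    (hM : ∀ᶠ i in l, ∀ w ∈ Metric.ball c R, ‖F (i, w)‖ ≤ M)
    (hd : ∀ n, Tendsto (fun i => iteratedDeriv n (fun w => F (i, w)) c) l (𝓝 (d n)))
    (hz : z ∈ Metric.ball c R) :
    Tendsto F (l ×ˢ 𝓝 z) (𝓝 (∑' n : ℕ, (n.factorial : ℂ)⁻¹ • (z - c) ^ n • d n)) := by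
  obtain ⟨r, hzr, hrR⟩ := exists_between (Metric.mem_ball.1 hz)
  obtain ⟨s, hzs, hsr⟩ := exists_between hzr
  have hs0 : 0 ≤ s := dist_nonneg.trans hzs.le
  have hr0 : 0 < r := hs0.trans_lt hsr
  have hterm (n : ℕ) : Tendsto (fun y : ι × ℂ => (n.factorial : ℂ)⁻¹ • (y.2 - c) ^ n •
      iteratedDeriv n (fun w => F (y.1, w)) c) (l ×ˢ 𝓝 z)
      (𝓝 ((n.factorial : ℂ)⁻¹ • (z - c) ^ n • d n)) :=
    (((tendsto_snd.sub_const c).pow n).smul ((hd n).comp tendsto_fst)).const_smul _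
  have hbound : ∀ᶠ y in l ×ˢ 𝓝 z, ∀ n, ‖(n.factorial : ℂ)⁻¹ • (y.2 - c) ^ n •
      iteratedDeriv n (fun w => F (y.1, w)) c‖ ≤ M * (s / r) ^ n := by
    filter_upwards [(hF.and hM).prod_mk (Metric.isOpen_ball.mem_nhds hzs)] with y hy n
    have hcauchy := Complex.norm_iteratedDeriv_le_of_forall_mem_sphere_norm_le n hr0
      ((hy.1.1.mono (Metric.closedBall_subset_ball hrR)).diffContOnCl_ball le_rfl)
      fun w hw => hy.1.2 w (Metric.sphere_subset_closedBall.trans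
        (Metric.closedBall_subset_ball hrR) hw)
    have hys : ‖y.2 - c‖ ≤ s := by
      rw [← dist_eq_norm]
      exact (Metric.mem_ball.1 hy.2).le
    calc _ = (n.factorial : ℝ)⁻¹ * (‖y.2 - c‖ ^ n *
          ‖iteratedDeriv n (fun w => F (y.1, w)) c‖) := by
          simp only [norm_smul, norm_inv, Complex.norm_natCast, norm_pow]
      _ ≤ (n.factorial : ℝ)⁻¹ * (s ^ n * (n.factorial * M / r ^ n)) := by gcongr
      _ = M * (s / r) ^ n := by
          rw [div_pow]
          field_simp
  have hsum : Summable fun n : ℕ => M * (s / r) ^ n :=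
    (summable_geometric_of_lt_one (by positivity) ((div_lt_one hr0).2 hsr)).mul_left M
  refine (tendsto_tsum_of_dominated_convergence hsum hterm hbound).congr' ?_
  filter_upwards [hF.prod_mk (Metric.isOpen_ball.mem_nhds hz)] with y hy
  exact (Complex.hasSum_taylorSeries_on_ball hy.1 hy.2).tsum_eq

/-- Vitali's theorem: near `ζ`, the limit is the Taylor series at a point `c ∈ U`, whose
coefficients converge since `F` converges near `c`. -/
theorem exists_analyticAt_tendsto [l.NeBot] {G : ℂ → ℂ} (hU : IsOpen U) (hζ : ζ ∈ closure U)
    (hF : ∀ᶠ y in l ×ˢ 𝓝 ζ, DifferentiableAt ℂ (fun w => F (y.1, w)) y.2)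
    (hM : F =O[l ×ˢ 𝓝 ζ] (1 : ι × ℂ → ℝ))
    (hG : ∀ z ∈ U, Tendsto F (l ×ˢ 𝓝 z) (𝓝 (G z))) :
    ∃ H : ℂ → ℂ, AnalyticAt ℂ H ζ ∧ ∀ᶠ z in 𝓝 ζ, Tendsto F (l ×ˢ 𝓝 z) (𝓝 (H z)) := by
  obtain ⟨M, hM⟩ := hM.bound
  obtain ⟨A, hA, B, hB, hAB⟩ := eventually_prod_iff.1 (hF.and hM)
  obtain ⟨e, he, heB⟩ := Metric.eventually_nhds_iff_ball.1 hB
  obtain ⟨c, hcU, hcζ⟩ := Metric.mem_closure_iff.1 hζ (e / 4) (by positivity)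
  have hsub : Metric.ball c (e / 2) ⊆ Metric.ball ζ e :=
    Metric.ball_subset_ball' (by rw [dist_comm c]; linarith)
  have hdiff : ∀ᶠ i in l, DifferentiableOn ℂ (fun w => F (i, w)) (Metric.ball c (e / 2)) :=
    hA.mono fun i hi w hw => (hAB hi (heB w (hsub hw))).1.differentiableWithinAt
  have hbound : ∀ᶠ i in l, ∀ w ∈ Metric.ball c (e / 2), ‖F (i, w)‖ ≤ M :=
    hA.mono fun i hi w hw => by simpa using (hAB hi (heB w (hsub hw))).2
  have hopen : IsOpen (U ∩ Metric.ball c (e / 2)) := hU.inter Metric.isOpen_ball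
  have hconv : TendstoLocallyUniformlyOn (fun i w => F (i, w)) G l (U ∩ Metric.ball c (e / 2)) :=
    (tendstoLocallyUniformlyOn_of_tendsto_prod_nhds hG).mono Set.inter_subset_left
  have hd (n : ℕ) := (tendstoLocallyUniformlyOn_iteratedDeriv hopen
    (hdiff.mono fun _ hi => hi.mono Set.inter_subset_right) hconv n).tendsto_at
      ⟨hcU, Metric.mem_ball_self (half_pos he)⟩
  have hlim (z : ℂ) (hz : z ∈ Metric.ball c (e / 2)) := tendsto_tsum_taylor hdiff hbound hd hz
  have hζc : Metric.ball c (e / 2) ∈ 𝓝 ζ :=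
    Metric.isOpen_ball.mem_nhds (Metric.mem_ball.2 (by linarith))
  exact ⟨_, ((tendstoLocallyUniformlyOn_of_tendsto_prod_nhds hlim).differentiableOn hdiff
    Metric.isOpen_ball).analyticAt hζc, mem_of_superset hζc hlim⟩

theorem eventually_tendsto_zero [l.NeBot] (hU : IsOpen U) (hζ : ζ ∈ closure U) (hζU : ζ ∉ U)
    (hF : ∀ᶠ y in l ×ˢ 𝓝 ζ, DifferentiableAt ℂ (fun w => F (y.1, w)) y.2)
    (hM : F =O[l ×ˢ 𝓝 ζ] (1 : ι × ℂ → ℝ))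
    (h0 : ∀ z ∈ U, Tendsto F (l ×ˢ 𝓝 z) (𝓝 0)) :
    ∀ᶠ z in 𝓝 ζ, Tendsto F (l ×ˢ 𝓝 z) (𝓝 0) := by
  obtain ⟨H, hH, hlim⟩ := exists_analyticAt_tendsto hU hζ hF hM h0
  rcases hH.eventually_eq_zero_or_eventually_ne_zero with h | h
  · filter_upwards [hlim, h] with z hz hz0 using hz0 ▸ hz
  · obtain ⟨z, hzU, hz, hne⟩ := ((mem_closure_iff_frequently.1 hζ).and_eventually
      (hlim.and (eventually_nhdsWithin_iff.1 h))).exists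
    exact absurd (tendsto_nhds_unique hz (h0 z hzU)) (hne (ne_of_mem_of_not_mem hzU hζU))

end Vitali

/-! ### Convergence at points of the unit circle away from the limit zeros -/

theorem differentiableAt_opucVal (a : ℕ → ℕ → ℂ) (y : (ℕ × ℕ) × ℂ) :
    DifferentiableAt ℂ (fun w => opucVal a (y.1, w)) y.2 :=
  (opuc (fun m => a m y.1.2) y.1.1).differentiableAt

theorem differentiableAt_starVal (a : ℕ → ℕ → ℂ) (y : (ℕ × ℕ) × ℂ) :
    DifferentiableAt ℂ (fun w => starVal a (y.1, w)) y.2 :=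
  (opucStar (fun m => a m y.1.2) y.1.1).differentiableAt

theorem mem_closure_unitBall {ζ : ℂ} (hζ : ‖ζ‖ = 1) : ζ ∈ closure (Metric.ball (0 : ℂ) 1) := by
  rw [closure_ball 0 one_ne_zero, mem_closedBall_zero_iff]
  exact hζ.le

section CircleBounds

variable {a : ℕ → ℕ → ℂ} {t : ℝ} {β ζ : ℂ} (ha : ∀ n N, ‖a n N‖ < 1) (hβ : ‖β‖ = 1)
  (hζ : ‖ζ‖ = 1) (hΛ : ζ ∉ limitZeros a t β)

include ha hβ hζ hΛ

theorem starVal_shift_isBigO_starVal (m : ℕ) :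
    (fun y => starVal a (shift m y)) =O[nearFilter t ζ] starVal a := by
  have hcoeff : (fun y : (ℕ × ℕ) × ℂ => a y.1.1 y.1.2) =O[nearFilter t ζ]
      (1 : (ℕ × ℕ) × ℂ → ℂ) :=
    Asymptotics.IsBigO.of_bound 1 (Eventually.of_forall fun y => by
      simpa using (ha y.1.1 y.1.2).le)
  have hsnd : (fun y : (ℕ × ℕ) × ℂ => y.2) =O[nearFilter t ζ] (1 : (ℕ × ℕ) × ℂ → ℂ) :=
    tendsto_snd_nearFilter.isBigO_one ℂ
  have hstep : (fun y => starVal a (shift 1 y)) =O[nearFilter t ζ] starVal a := by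
    simp only [starVal_shift_one]
    exact (Asymptotics.isBigO_refl _ _).sub
      (((hcoeff.mul hsnd).mul (opucVal_isBigO_starVal ha hβ hζ hΛ)).congr_right fun y => by simp)
  induction m with
  | zero => exact Asymptotics.isBigO_refl _ _
  | succ m ih => exact (hstep.comp_tendsto (tendsto_shift m)).trans ih

variable (p : ℕ)

theorem starVal_shift_div_starVal_isBigO_one :
    (fun y => starVal a (shift p y) / starVal a y) =O[nearFilter t ζ] (1 : (ℕ × ℕ) × ℂ → ℝ) :=
  (Asymptotics.div_isBoundedUnder_of_isBigO
    (starVal_shift_isBigO_starVal ha hβ hζ hΛ p)).isBigO_one ℝ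

theorem opucVal_div_starVal_isBigO_one :
    (fun y => opucVal a y / starVal a y) =O[nearFilter t ζ] (1 : (ℕ × ℕ) × ℂ → ℝ) :=
  (Asymptotics.div_isBoundedUnder_of_isBigO (opucVal_isBigO_starVal ha hβ hζ hΛ)).isBigO_one ℝ

end CircleBounds

section CircleLimit

variable {p : ℕ} {α : ℕ → ℂ} {a : ℕ → ℕ → ℂ} {t : ℝ} {β ζ : ℂ} [(ratioFilter t).NeBot]
  (hp : 0 < p) (hα : ∀ n, ‖α n‖ < 1) (hper : Function.Periodic α p) (ha : ∀ n N, ‖a n N‖ < 1)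
  (hlim : Tendsto (fun x : ℕ × ℕ => a x.1 x.2 - α x.1) (ratioFilter t) (𝓝 0))
  (hβ : ‖β‖ = 1) (hζ : ‖ζ‖ = 1) (hΛ : ζ ∉ limitZeros a t β)

instance (ζ : ℂ) : (nearFilter t ζ).NeBot := by
  unfold nearFilter
  infer_instance

include hp hα hper ha hlim hβ hζ hΛ

theorem exists_analyticAt_quotientTendsto_starVal :
    ∃ H : ℂ → ℂ, AnalyticAt ℂ H ζ ∧ ∀ᶠ z in 𝓝 ζ, QuotientTendsto t p (starVal a) z (H z) := by
  have hne := eventually_starVal_ne_zero ha hβ hζ hΛ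
  have hdiff : ∀ᶠ y in nearFilter t ζ, DifferentiableAt ℂ
      (fun w => starVal a (shift p (y.1, w)) / starVal a (y.1, w)) y.2 :=
    hne.mono fun y hy =>
      (differentiableAt_starVal a (shift p y)).fun_div (differentiableAt_starVal a y) hy
  obtain ⟨H, hH, hHlim⟩ := exists_analyticAt_tendsto Metric.isOpen_ball (mem_closure_unitBall hζ)
    hdiff (starVal_shift_div_starVal_isBigO_one ha hβ hζ hΛ p) fun z hz =>
      (quotientTendsto_starVal_disk hp hα hper ha hlim (mem_ball_zero_iff.1 hz)).2
  exact ⟨H, hH, (eventually_eventually_nearFilter hne).and hHlim⟩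

theorem eventually_tendsto_opucVal_div_starVal_shift_sub :
    ∀ᶠ z in 𝓝 ζ, Tendsto (fun y => opucVal a (shift p y) / starVal a (shift p y) -
      opucVal a y / starVal a y) (nearFilter t z) (𝓝 0) := by
  have hne := eventually_starVal_ne_zero ha hβ hζ hΛ
  have hbdd := opucVal_div_starVal_isBigO_one ha hβ hζ hΛ
  refine eventually_tendsto_zero Metric.isOpen_ball (mem_closure_unitBall hζ)
    (fun h => (mem_ball_zero_iff.1 h).ne hζ) ?_
    ((hbdd.comp_tendsto (tendsto_shift p)).sub hbdd) fun z hz => ?_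
  · filter_upwards [hne, (tendsto_shift p).eventually hne] with y hy hy'
    exact ((differentiableAt_opucVal a (shift p y)).fun_div
      (differentiableAt_starVal a (shift p y)) hy').fun_sub
        ((differentiableAt_opucVal a y).fun_div (differentiableAt_starVal a y) hy)
  · have hz := mem_ball_zero_iff.1 hz
    refine (tendsto_schurVal_shift_sub_schurVal hp hα hper ha hlim hz).congr' ?_
    filter_upwards [eventually_norm_lt hz] with y hy
    rw [opucVal_div_starVal ha hy.le, opucVal_div_starVal ha (y := shift p y) hy.le]

theorem eventually_eq_gDelta {H : ℂ → ℂ}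
    (hH : ∀ᶠ z in 𝓝 ζ, QuotientTendsto t p (starVal a) z (H z)) :
    ∀ᶠ z in 𝓝 ζ, ‖z‖ ≠ 1 → H z = gDelta p α z := by
  filter_upwards [hH, eventually_tendsto_opucVal_div_starVal_shift_sub hp hα hper ha hlim hβ hζ hΛ]
    with z hz hsub hz1
  rcases hz1.lt_or_gt with h | h
  · exact tendsto_nhds_unique hz.2 (quotientTendsto_starVal_disk hp hα hper ha hlim h).2
  · have hstar : starVal a =O[nearFilter t z] opucVal a :=
      Asymptotics.IsBigO.of_bound 1 (by
        filter_upwards [tendsto_snd_nearFilter.eventually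
          (continuous_norm.continuousAt.eventually_const_lt h)] with y hy
        rw [one_mul]
        exact norm_eval_opucStar_le (fun n => ha n y.1.2) hy.le y.1.1)
    exact tendsto_nhds_unique (hz.of_tendsto_sub hsub hstar).2
      (quotientTendsto_opucVal_exterior hp hα hper ha hlim h).2

theorem quotientTendsto_starVal_circle : QuotientTendsto t p (starVal a) ζ (gDelta p α ζ) := by
  obtain ⟨H, hH, hlimH⟩ := exists_analyticAt_quotientTendsto_starVal hp hα hper ha hlim hβ hζ hΛ
  have hζ0 : ζ ≠ 0 := norm_ne_zero_iff.1 (hζ ▸ one_ne_zero)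
  obtain ⟨r, hr, hball⟩ := Metric.eventually_nhds_iff_ball.1
    ((eventually_eq_gDelta hp hα hper ha hlim hβ hζ hΛ hlimH).and
      (hH.eventually_analyticAt.and (eventually_ne_nhds hζ0)))
  have heq := eqOn_gDelta_of_eqOn_norm_ne_one hp hα hper Metric.isOpen_ball
    (convex_ball ζ r).isPreconnected (fun h0 => (hball 0 h0).2.2 rfl)
    (fun z hz => (hball z hz).2.1.differentiableAt.differentiableWithinAt)
    fun z hz => (hball z hz.1).1 hz.2
  exact heq (Metric.mem_ball_self hr) ▸ hlimH.self_of_nhds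

theorem quotientTendsto_opucVal_circle : QuotientTendsto t p (opucVal a) ζ (gDelta p α ζ) :=
  (quotientTendsto_starVal_circle hp hα hper ha hlim hβ hζ hΛ).of_tendsto_sub
    (eventually_tendsto_opucVal_div_starVal_shift_sub hp hα hper ha hlim hβ hζ hΛ).self_of_nhds
    (starVal_isBigO_opucVal ha hβ hζ hΛ)

theorem quotientTendsto_popucVal_circle :
    QuotientTendsto t p (popucVal a β) ζ (gDelta p α ζ) := by
  refine (quotientTendsto_starVal_circle hp hα hper ha hlim hβ hζ hΛ).of_tendsto_sub ?_
    (starVal_isBigO_popucVal ha hβ hζ hΛ)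
  have hsub := tendsto_snd_nearFilter.mul
    (eventually_tendsto_opucVal_div_starVal_shift_sub hp hα hper ha hlim hβ hζ hΛ).self_of_nhds
  rw [mul_zero] at hsub
  have hne := eventually_starVal_ne_zero ha hβ hζ hΛ
  refine hsub.congr' ?_
  filter_upwards [hne, (tendsto_shift p).eventually hne] with y hy hy'
  rw [popucVal_eq, popucVal_eq, sub_div, sub_div, mul_div_cancel_right₀ _ hy,
    mul_div_cancel_right₀ _ hy', show (shift p y).2 = y.2 from rfl]
  ring

end CircleLimit

theorem exists_notMem_limitZeros {a : ℕ → ℕ → ℂ} {t : ℝ} {z : ℂ} (hz : z ∉ limitZerosInter a t) :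
    ∃ β, ‖β‖ = 1 ∧ z ∉ limitZeros a t β := by
  by_contra! hmem
  exact hz hmem

section Plane

variable {p : ℕ} {α : ℕ → ℂ} {a : ℕ → ℕ → ℂ} {t : ℝ} {z : ℂ} [(ratioFilter t).NeBot]
  (hp : 0 < p) (hα : ∀ n, ‖α n‖ < 1) (hper : Function.Periodic α p) (ha : ∀ n N, ‖a n N‖ < 1)
  (hlim : Tendsto (fun x : ℕ × ℕ => a x.1 x.2 - α x.1) (ratioFilter t) (𝓝 0))

include hp hα hper ha hlim

theorem quotientTendsto_popuc {β : ℂ} (hβ : ‖β‖ = 1) (hz : z ∉ limitZeros a t β) :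
    QuotientTendsto t p (fun y => (popuc (fun m => a m y.1.2) β y.1.1).eval y.2) z
      (gDelta p α z) := by
  refine QuotientTendsto.of_shift 1 (?_ : QuotientTendsto t p (popucVal a β) z (gDelta p α z))
  rcases lt_trichotomy ‖z‖ 1 with h | h | h
  · exact quotientTendsto_popucVal_disk hp hα hper ha hlim h hβ
  · exact quotientTendsto_popucVal_circle hp hα hper ha hlim hβ h hz
  · exact quotientTendsto_popucVal_exterior hp hα hper ha hlim h hβ

theorem quotientTendsto_opuc (hz : z ∉ limitZerosInter a t ∪ zeroSet p α hα) :
    QuotientTendsto t p (opucVal a) z (gDelta p α z) := by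
  rw [Set.mem_union, not_or] at hz
  rcases lt_trichotomy ‖z‖ 1 with h | h | h
  · exact quotientTendsto_opucVal_disk hp hα hper ha hlim h
      (periodicSchur_ne_zero_of_notMem_zeroSet hp hα hper h hz.2)
  · obtain ⟨β, hβ, hzβ⟩ := exists_notMem_limitZeros hz.1
    exact quotientTendsto_opucVal_circle hp hα hper ha hlim hβ h hzβ
  · exact quotientTendsto_opucVal_exterior hp hα hper ha hlim h

theorem quotientTendsto_opucStar (hz : z ∉ limitZerosInter a t ∪ poleSet p α hα) :
    QuotientTendsto t p (starVal a) z (gDelta p α z) := by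
  rw [Set.mem_union, not_or] at hz
  rcases lt_trichotomy ‖z‖ 1 with h | h | h
  · exact quotientTendsto_starVal_disk hp hα hper ha hlim h
  · obtain ⟨β, hβ, hzβ⟩ := exists_notMem_limitZeros hz.1
    exact quotientTendsto_starVal_circle hp hα hper ha hlim hβ h hzβ
  · exact quotientTendsto_starVal_exterior hp hα hper ha hlim h
      (periodicSchur_conj_ne_zero_of_notMem_poleSet hp hα hper h hz.2)

end Plane

end VaryingOPUC

end

theorem corollary3p7 (p : ℕ) (hp : 0 < p) (t : ℝ) (ht : 0 < t) (β : ℂ) (hβ : ‖β‖ = 1)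
    (a : ℕ → ℕ → ℂ) (ha : ∀ n N, ‖a n N‖ < 1)
    (α : ℕ → ℂ) (hα : ∀ n, ‖α n‖ < 1) (hper : Function.Periodic α p) (hne : ∃ j < p, α j ≠ 0)
    (hlim : VaryingOPUC.AsymptoticallyPeriodic a t p α) :
    VaryingOPUC.QuotientsConverge t
      (fun n N => VaryingOPUC.popuc (fun m => a m N) β (n + p))
      (fun n N => VaryingOPUC.popuc (fun m => a m N) β n)
      (VaryingOPUC.gDelta p α) (VaryingOPUC.limitZeros a t β)ᶜ ∧
    VaryingOPUC.QuotientsConverge t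
      (fun n N => VaryingOPUC.opuc (fun m => a m N) (n + p))
      (fun n N => VaryingOPUC.opuc (fun m => a m N) n)
      (VaryingOPUC.gDelta p α)
      (VaryingOPUC.limitZerosInter a t ∪ VaryingOPUC.zeroSet p α hα)ᶜ ∧
    VaryingOPUC.QuotientsConverge t
      (fun n N => VaryingOPUC.opucStar (fun m => a m N) (n + p))
      (fun n N => VaryingOPUC.opucStar (fun m => a m N) n)
      (VaryingOPUC.gDelta p α)
      (VaryingOPUC.limitZerosInter a t ∪ VaryingOPUC.poleSet p α hα)ᶜ := by
  have hratio := VaryingOPUC.ratioFilter_neBot ht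
  have hsub := hlim.tendsto_sub hp hper
  exact ⟨VaryingOPUC.quotientsConverge_of_quotientTendsto
      (T := fun n N => VaryingOPUC.popuc (fun m => a m N) β n)
      fun z hz => VaryingOPUC.quotientTendsto_popuc hp hα hper ha hsub hβ hz,
    VaryingOPUC.quotientsConverge_of_quotientTendsto
      (T := fun n N => VaryingOPUC.opuc (fun m => a m N) n)
      fun z hz => VaryingOPUC.quotientTendsto_opuc hp hα hper ha hsub hz,
    VaryingOPUC.quotientsConverge_of_quotientTendsto
      (T := fun n N => VaryingOPUC.opucStar (fun m => a m N) n)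
      fun z hz => VaryingOPUC.quotientTendsto_opucStar hp hα hper ha hsub hz⟩
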